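/- Let $(\Omega^{2n},\omega)$ be a symplectic manifold, $n\ge 2$, let $H\colon\Omega\to\mathbb R$ be smooth, and let $X_H$ be its Hamiltonian vector field, $\omega(X_H,\cdot)=dH$. A \emph{section} (for $H$) is an embedded smooth hypersurface of $\Omega$ transverse to $X_H$. For sections $\Sigma_0,\Sigma_1$ the \emph{Poincaré map} $R_H\colon\Sigma_0\to\Sigma_1$ sends $y\in\Sigma_0$ to the first point, at a positive time, where the trajectory of $X_H$ starting at $y$ meets $\Sigma_1$; when we say that $R_H$ is the Poincaré map $\Sigma_0\to\Sigma_1$ it is understood that $\Sigma_0$, $\Sigma_1$ are sections for $H$, that this point exists for every $y\in\Sigma_0$, and that the hitting time depends continuously on $y$. Spaces of smooth maps carry the $C^\infty$ topology (uniform convergence on compact sets of all derivatives in charts). Assume that $R_H\colon\Sigma_0\to\Sigma_1$ is a diffeomorphism. Let $y_0\in\Sigma_0$ and let $x_0$ be a point on the segment of the trajectory of $y_0$ from $y_0$ to $R_H(y_0)$. Then for every neighborhood $U$ of $x_0$ in $\Omega$ there exists a neighborhood $V$ of $y_0$ in $\Sigma_0$ such that for every neighborhood $\mathcal H$ of $H$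 in $C^\infty(\Omega,\mathbb R)$ there exists a neighborhood $\mathcal R$ of $R_H$ in $C^\infty(\Sigma_0,\Sigma_1)$ such that the following holds. For every $\widetilde R\in\mathcal R$ satisfying (1) $\widetilde R\colon\Sigma_0\to\Sigma_1$ is a diffeomorphism, (2) $H\circ\widetilde R=H$ on $\Sigma_0$, (3) for every $h\in\mathbb R$, the restriction of $\widetilde R$ to the level set $\Sigma_0^h=\{x\in\Sigma_0: H(x)=h\}$ preserves the symplectic form, i.e. pulls $\omega|_{\Sigma_1^h}$ back to $\omega|_{\Sigma_0^h}$, where $\Sigma_1^h=\{x\in\Sigma_1: H(x)=h\}$, and such that $\widetilde R=R_H$ outside $V$, there exists $\widetilde H\in\mathcal H$ such that $\widetilde H=H$ outside $U$ and $\widetilde R=R_{\widetilde H}$, where $R_{\widetilde H}\colon\Sigma_0\to\Sigma_1$ is the Poincaré map of $\widetilde H$. -/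

import Mathlib

open Set Topology
open scoped Manifold ContDiff

/-- A symplectic form on a smooth manifold `Ω` of dimension `m`: a smooth, closed, nondegenerate
differential 2-form. Smoothness and closedness are expressed for the coordinate expression of the
form in every smooth chart, i.e. for its pullback under the inverse of the chart. -/
structure SymplecticForm (m : ℕ) (Ω : Type*) [TopologicalSpace Ω]
    [ChartedSpace (EuclideanSpace ℝ (Fin m)) Ω] [IsManifold (𝓡 m) ∞ Ω] where
  /-- The alternating bilinear form on each tangent space. -/
  form : ∀ x : Ω, TangentSpace (𝓡 m) x [⋀^Fin 2]→L[ℝ] ℝ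
  smooth : ∀ φ ∈ IsManifold.maximalAtlas (𝓡 m) ∞ Ω,
    ContDiffOn ℝ ∞
      (fun u : EuclideanSpace ℝ (Fin m) =>
        ((form (φ.symm u)).compContinuousLinearMap (mfderiv (𝓡 m) (𝓡 m) φ.symm u) :
          EuclideanSpace ℝ (Fin m) [⋀^Fin 2]→L[ℝ] ℝ))
      φ.target
  closed : ∀ φ ∈ IsManifold.maximalAtlas (𝓡 m) ∞ Ω, ∀ u ∈ φ.target,
    extDeriv
      (fun u : EuclideanSpace ℝ (Fin m) =>
        ((form (φ.symm u)).compContinuousLinearMap (mfderiv (𝓡 m) (𝓡 m) φ.symm u) :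
          EuclideanSpace ℝ (Fin m) [⋀^Fin 2]→L[ℝ] ℝ)) u = 0
  nondegenerate : ∀ (x : Ω) (v : TangentSpace (𝓡 m) x),
    (∀ w : TangentSpace (𝓡 m) x, form x ![v, w] = 0) → v = 0

theorem ContinuousAlternatingMap.exists_eq_of_nondegenerate {E : Type*} [NormedAddCommGroup E]
    [NormedSpace ℝ E] [FiniteDimensional ℝ E] (f : E [⋀^Fin 2]→L[ℝ] ℝ)
    (hf : ∀ v, (∀ w, f ![v, w] = 0) → v = 0) (α : E →L[ℝ] ℝ) :
    ∃ v, ∀ w, f ![v, w] = α w := by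
  have h₀ (v w : E) : Function.update ![0, w] (0 : Fin 2) v = ![v, w] := by
    funext i
    fin_cases i <;> rfl
  have h₁ (v w : E) : Function.update ![v, 0] (1 : Fin 2) w = ![v, w] := by
    funext i
    fin_cases i <;> rfl
  let B : E →ₗ[ℝ] Module.Dual ℝ E :=
    LinearMap.mk₂ ℝ (fun v w => f ![v, w])
      (fun v v' w => by
        have h := f.map_update_add ![0, w] 0 v v'
        simpa only [h₀] using h)
      (fun c v w => by
        have h := f.map_update_smul ![0, w] 0 c v
        simpa only [h₀] using h)
      (fun v w w' => by
        have h := f.map_update_add ![v, 0] 1 w w'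
        simpa only [h₁] using h)
      (fun c v w => by
        have h := f.map_update_smul ![v, 0] 1 c w
        simpa only [h₁] using h)
  have hB : Function.Injective B := by
    rw [← LinearMap.ker_eq_bot, LinearMap.ker_eq_bot']
    intro v hv
    exact hf v fun w => congrArg (fun L => L w) hv
  obtain ⟨v, hv⟩ := (LinearMap.injective_iff_surjective_of_finrank_eq_finrank
    Subspace.dual_finrank_eq.symm).1 hB (α : E →ₗ[ℝ] ℝ)
  exact ⟨v, fun w => congrArg (fun L => L w) hv⟩

namespace SymplecticForm

variable {m : ℕ} {Ω : Type*} [TopologicalSpace Ω]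
  [ChartedSpace (EuclideanSpace ℝ (Fin m)) Ω] [IsManifold (𝓡 m) ∞ Ω]

/-- By nondegeneracy, every covector `α` at `x` is of the form `σ(v, ·)`. -/
theorem exists_form_eq (σ : SymplecticForm m Ω) (x : Ω) (α : TangentSpace (𝓡 m) x →L[ℝ] ℝ) :
    ∃ v : TangentSpace (𝓡 m) x, ∀ w : TangentSpace (𝓡 m) x, σ.form x ![v, w] = α w :=
  ContinuousAlternatingMap.exists_eq_of_nondegenerate (E := EuclideanSpace ℝ (Fin m)) (σ.form x)
    (σ.nondegenerate x) α

/-- The Hamiltonian vector field `X_H` of `H`, characterized by `σ(X_H, ·) = dH`. -/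
noncomputable def hamiltonianField (σ : SymplecticForm m Ω) (H : Ω → ℝ) (x : Ω) :
    TangentSpace (𝓡 m) x :=
  Classical.choose (σ.exists_form_eq x (mfderiv (𝓡 m) 𝓘(ℝ, ℝ) H x))

theorem form_hamiltonianField (σ : SymplecticForm m Ω) (H : Ω → ℝ) (x : Ω)
    (w : TangentSpace (𝓡 m) x) :
    σ.form x ![σ.hamiltonianField H x, w] = (mfderiv (𝓡 m) 𝓘(ℝ, ℝ) H x w : ℝ) :=
  Classical.choose_spec (σ.exists_form_eq x (mfderiv (𝓡 m) 𝓘(ℝ, ℝ) H x)) w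

/-- The curve `γ` follows the Hamiltonian flow of `H` during the time interval `[0, T]`, `T > 0`,
from the point `x` to the point `ι₁ z` of the section `ι₁ : S₁ → Ω`,
which it does not meet at any time strictly between `0` and `T`. -/
structure IsFirstPassage (σ : SymplecticForm m Ω) (H : Ω → ℝ) {S₁ : Type*} (ι₁ : S₁ → Ω)
    (x : Ω) (T : ℝ) (γ : ℝ → Ω) (z : S₁) : Prop where
  pos : 0 < T
  integralCurve : IsMIntegralCurveOn γ (σ.hamiltonianField H) (Icc 0 T)
  start : γ 0 = x
  finish : γ T = ι₁ z
  first : ∀ t ∈ Ioo 0 T, γ t ∉ range ι₁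

/-- `ι : S → Ω` is (the inclusion of) a section of the Hamiltonian flow of `H`: a smoothly embedded
hypersurface transverse to the Hamiltonian vector field. -/
structure IsSection (σ : SymplecticForm m Ω) (H : Ω → ℝ) {S : Type*} [TopologicalSpace S]
    [ChartedSpace (EuclideanSpace ℝ (Fin (m - 1))) S] (ι : S → Ω) : Prop where
  isSmoothEmbedding : Manifold.IsSmoothEmbedding (𝓡 (m - 1)) (𝓡 m) ∞ ι
  transverse : ∀ y : S, σ.hamiltonianField H (ι y) ∉ range (mfderiv (𝓡 (m - 1)) (𝓡 m) ι y)

/-- `R : S₀ → S₁` is the Poincaré map of the Hamiltonian flow of `H` between the sections `S₀` and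
`S₁`: it sends `y` to the first point (at a positive time) at which the orbit of `y` meets `S₁`, the
passage time depending continuously on `y`. -/
structure IsPoincareMap (σ : SymplecticForm m Ω) (H : Ω → ℝ)
    {S₀ : Type*} [TopologicalSpace S₀] [ChartedSpace (EuclideanSpace ℝ (Fin (m - 1))) S₀]
    {S₁ : Type*} [TopologicalSpace S₁] [ChartedSpace (EuclideanSpace ℝ (Fin (m - 1))) S₁]
    (ι₀ : S₀ → Ω) (ι₁ : S₁ → Ω) (R : S₀ → S₁) : Prop where
  section₀ : σ.IsSection H ι₀
  section₁ : σ.IsSection H ι₁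
  exists_time : ∃ τ : S₀ → ℝ, Continuous τ ∧
    ∀ y : S₀, ∃ γ : ℝ → Ω, σ.IsFirstPassage H ι₁ (ι₀ y) (τ y) γ (R y)

/-- `R : S₀ → S₁` preserves the symplectic form on the level sets of `H`: for every `y` and all
vectors `v`, `w` tangent at `y` to the level set of `H` in `S₀` through `y`
(that is, in the kernel of the differential of `H` restricted to `S₀`), the form takes the same
value on `(v, w)` and on its image under the differential of `R`. -/
def PreservesFormOnLevels (σ : SymplecticForm m Ω) (H : Ω → ℝ)
    {S₀ : Type*} [TopologicalSpace S₀] [ChartedSpace (EuclideanSpace ℝ (Fin (m - 1))) S₀]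
    {S₁ : Type*} [TopologicalSpace S₁] [ChartedSpace (EuclideanSpace ℝ (Fin (m - 1))) S₁]
    (ι₀ : S₀ → Ω) (ι₁ : S₁ → Ω) (R : S₀ → S₁) : Prop :=
  ∀ (y : S₀) (v w : TangentSpace (𝓡 (m - 1)) y),
    mfderiv (𝓡 (m - 1)) 𝓘(ℝ, ℝ) (H ∘ ι₀) y v = 0 →
    mfderiv (𝓡 (m - 1)) 𝓘(ℝ, ℝ) (H ∘ ι₀) y w = 0 →
    σ.form (ι₁ (R y))
        ![mfderiv (𝓡 (m - 1)) (𝓡 m) ι₁ (R y) (mfderiv (𝓡 (m - 1)) (𝓡 (m - 1)) R y v),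
          mfderiv (𝓡 (m - 1)) (𝓡 m) ι₁ (R y) (mfderiv (𝓡 (m - 1)) (𝓡 (m - 1)) R y w)] =
      σ.form (ι₀ y)
        ![mfderiv (𝓡 (m - 1)) (𝓡 m) ι₀ y v, mfderiv (𝓡 (m - 1)) (𝓡 m) ι₀ y w]

end SymplecticForm

/-- The `C^∞` topology on `C^∞(M, ℝ)`: uniform convergence on compact subsets of charts of all
derivatives. A subbasis is formed by the sets of all `g` whose derivatives up to order `r`, in a
smooth chart `φ`, are within `ε` of those of `f` on a compact subset `K` of the domain of `φ`. -/
abbrev smoothFunctionTopology (m : ℕ) (M : Type*) [TopologicalSpace M]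
    [ChartedSpace (EuclideanSpace ℝ (Fin m)) M] :
    TopologicalSpace C^∞⟮𝓡 m, M; 𝓘(ℝ, ℝ), ℝ⟯ :=
  TopologicalSpace.generateFrom
    {W | ∃ (f : C^∞⟮𝓡 m, M; 𝓘(ℝ, ℝ), ℝ⟯)
        (φ : OpenPartialHomeomorph M (EuclideanSpace ℝ (Fin m))) (K : Set M) (r : ℕ) (ε : ℝ),
      φ ∈ IsManifold.maximalAtlas (𝓡 m) ∞ M ∧ IsCompact K ∧ K ⊆ φ.source ∧ 0 < ε ∧
      W = {g : C^∞⟮𝓡 m, M; 𝓘(ℝ, ℝ), ℝ⟯ | ∀ k ≤ r, ∀ x ∈ K,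
        ‖iteratedFDeriv ℝ k (g ∘ φ.symm) (φ x) - iteratedFDeriv ℝ k (f ∘ φ.symm) (φ x)‖ < ε}}

/-- The `C^∞` topology on `C^∞(M, N)`: uniform convergence on compact sets of all derivatives in
charts. A subbasis is formed by the sets of all `g` which map a compact subset `K` of the domain of
a smooth chart `φ` of `M` into the domain of a smooth chart `ψ` of `N` and whose derivatives up to
order `r` in these charts are within `ε` of those of `f` on `K`,
where `f` maps `K` into the domain of `ψ` as well. -/
abbrev smoothMapTopology (m k : ℕ) (M N : Type*)
    [TopologicalSpace M] [ChartedSpace (EuclideanSpace ℝ (Fin m)) M]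
    [TopologicalSpace N] [ChartedSpace (EuclideanSpace ℝ (Fin k)) N] :
    TopologicalSpace C^∞⟮𝓡 m, M; 𝓡 k, N⟯ :=
  TopologicalSpace.generateFrom
    {W | ∃ (f : C^∞⟮𝓡 m, M; 𝓡 k, N⟯)
        (φ : OpenPartialHomeomorph M (EuclideanSpace ℝ (Fin m)))
        (ψ : OpenPartialHomeomorph N (EuclideanSpace ℝ (Fin k))) (K : Set M) (r : ℕ) (ε : ℝ),
      φ ∈ IsManifold.maximalAtlas (𝓡 m) ∞ M ∧ ψ ∈ IsManifold.maximalAtlas (𝓡 k) ∞ N ∧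
      IsCompact K ∧ K ⊆ φ.source ∧ MapsTo f K ψ.source ∧ 0 < ε ∧
      W = {g : C^∞⟮𝓡 m, M; 𝓡 k, N⟯ | MapsTo g K ψ.source ∧ ∀ j ≤ r, ∀ x ∈ K,
        ‖iteratedFDeriv ℝ j (ψ ∘ g ∘ φ.symm) (φ x) -
          iteratedFDeriv ℝ j (ψ ∘ f ∘ φ.symm) (φ x)‖ < ε}}

/-! Near an interior point of the orbit of `y₀` there are symplectic coordinates `(q, p)` in which
`H` is `p₁` up to a constant. There the flow is translation in `q₁`, orbits are labelled by the
transversal coordinates `(p₁, q', p')`, and these labels are also coordinates on `S₀` near `y₀`. Put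
`Ψ = R⁻¹ ∘ R'`. Conditions (2) and (3) say that in these coordinates `Ψ` preserves `p₁` and acts on
each level as a symplectic map of `(q', p')`; moreover it is the identity outside a small ball. It
suffices to change `H` inside the box so that an orbit entering along the line labelled `y` leaves
along the line labelled `Ψ y`: from there the old flow carries it to `R (Ψ y) = R' y`.

For `Ψ` near the identity there is a compactly supported generating function `S (p₁, q', p')`
(`exists_generating_function`). The condition `n ≥ 2` is used here: the exterior of a ball in the
`(q', p')`-space has to be connected. If `χ` steps from `0` to `1`, then `χ(q₁) S` generates a
symplectic map `Φ` which is the identity before the step and is `Ψ` together with a shift of `q₁`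
after it. The images of the coordinate lines under `Φ` are orbits of `p₁ ∘ Φ⁻¹ = p₁ + D`, and `D`
lives where `χ` changes (`exists_hamiltonian_perturbation`). `IsFlowBox.exists_isFirstPassage` glues
the orbit of `y`, the bent line and the orbit of `Ψ y`. No old orbit enters the box twice or meets a
section there, so nothing else changes.

That `H'` is close to `H` when `R'` is close to `R` is not estimated directly. If it failed, there
would be counterexamples converging to `R` as fast as desired; `exists_special_curve` interpolates
them by one smooth family with parameter `s`, the construction depends smoothly on `s`, and the
resulting Hamiltonians tend to `H` as `s → 0`, a contradiction.

The coordinates come from straightening `H` and its field together (`exists_straightening`) followed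
by Moser's method (`exists_moser`). Both rest on smooth dependence of flows on initial data,
obtained from the inverse function theorem in a space of paths (`exists_contDiff_flow`). -/

set_option maxSynthPendingDepth 3

/-! ### Parametrized perturbations of the identity -/

section Perturbation

variable {P X : Type*} [NormedAddCommGroup P] [NormedSpace ℝ P] [CompleteSpace P]
  [NormedAddCommGroup X] [NormedSpace ℝ X] [CompleteSpace X]

theorem exists_equiv_one_add (T : X →L[ℝ] X) (hT : ‖T‖ ≤ 1 / 2) :
    ∃ e : X ≃L[ℝ] X, ∀ x, e x = x + T x := by
  have h : ‖-T‖ < 1 := by rw [norm_neg]; linarith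
  refine ⟨ContinuousLinearEquiv.unitsEquiv ℝ X (Units.oneSub (-T) h), fun x => ?_⟩
  change ((Units.oneSub (-T) h : (X →L[ℝ] X)ˣ) : X →L[ℝ] X) x = _
  simp

/-- The perturbation `g` is a contraction, so the map approximates the identity well enough to be a
homeomorphism. -/
theorem bijective_add_of_norm_fderiv_le {g : X → X} (hg : Differentiable ℝ g)
    (hb : ∀ x, ‖fderiv ℝ g x‖ ≤ 1 / 2) : Function.Bijective fun x => x + g x := by
  have hlip : LipschitzWith (1 / 2) g :=
    lipschitzWith_of_nnnorm_fderiv_le hg fun x => by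
      rw [← NNReal.coe_le_coe]; simpa using hb x
  have hA : ApproximatesLinearOn (fun x => x + g x)
      ((ContinuousLinearEquiv.refl ℝ X : X ≃L[ℝ] X) : X →L[ℝ] X) univ (1 / 2) := by
    intro x _ y _
    have := hlip.dist_le_mul x y
    simpa [dist_eq_norm, add_sub_add_comm] using this
  have hc : Subsingleton X ∨ (1 / 2 : NNReal) <
      ‖((ContinuousLinearEquiv.refl ℝ X).symm : X →L[ℝ] X)‖₊⁻¹ := by
    rcases subsingleton_or_nontrivial X with h | h
    · exact Or.inl h
    · right
      have : ‖((ContinuousLinearEquiv.refl ℝ X).symm : X →L[ℝ] X)‖₊ = 1 := by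
        rw [← NNReal.coe_inj]
        exact ContinuousLinearMap.norm_id
      rw [this, inv_one, ← NNReal.coe_lt_coe]
      norm_num
  exact (hA.toHomeomorph _ hc).bijective

/-- If `‖∂ₓ g‖ ≤ 1 / 2`, the maps `x ↦ x + g (p, x)` have an inverse which depends smoothly on all
variables. -/
theorem exists_contDiff_inverse {g : P × X → X} (hg : ContDiff ℝ ∞ g)
    (hb : ∀ p x, ‖fderiv ℝ (fun x => g (p, x)) x‖ ≤ 1 / 2) :
    ∃ inv : P × X → X, ContDiff ℝ ∞ inv ∧ (∀ p x, inv (p, x + g (p, x)) = x) ∧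
      ∀ p y, inv (p, y) + g (p, inv (p, y)) = y := by
  have hgd : Differentiable ℝ g := hg.differentiable (by simp)
  have hpart (p : P) (x : X) : HasFDerivAt (fun x => g (p, x))
      ((fderiv ℝ g (p, x)).comp (ContinuousLinearMap.inr ℝ P X)) x :=
    (hgd (p, x)).hasFDerivAt.comp x (hasFDerivAt_prodMk_right p x)
  have hbij (p : P) : Function.Bijective fun x => x + g (p, x) :=
    bijective_add_of_norm_fderiv_le (fun x => (hpart p x).differentiableAt) (hb p)
  choose inv hinv using fun q : P × X => (hbij q.1).2 q.2
  refine ⟨inv, ?_, fun p x => (hbij p).1 (hinv (p, x + g (p, x))), fun p y => hinv (p, y)⟩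
  rw [contDiff_iff_contDiffAt]
  rintro ⟨p₀, y₀⟩
  set x₀ := inv (p₀, y₀)
  have hx₀ : x₀ + g (p₀, x₀) = y₀ := hinv (p₀, y₀)
  -- Carrying the parameter along lets the inverse function theorem give joint smoothness. The
  -- derivative is block triangular, with invertible blocks by the bound on `∂ₓ g`.
  set Fm : P × X → P × X := fun q => (q.1, q.2 + g q) with hFm
  have hF : ContDiff ℝ ∞ Fm := contDiff_fst.prodMk (contDiff_snd.add hg)
  obtain ⟨e, he⟩ := exists_equiv_one_add _ (hb p₀ x₀)
  let e' := ContinuousLinearEquiv.skewProd (ContinuousLinearEquiv.refl ℝ P) e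
    ((fderiv ℝ g (p₀, x₀)).comp (ContinuousLinearMap.inl ℝ P X))
  have hF' : HasFDerivAt Fm (e' : P × X →L[ℝ] P × X) (p₀, x₀) := by
    have h1 : HasFDerivAt Fm _ (p₀, x₀) :=
      hasFDerivAt_fst.prodMk (hasFDerivAt_snd.add (hgd (p₀, x₀)).hasFDerivAt)
    refine h1.congr_fderiv ?_
    refine ContinuousLinearMap.ext fun v => Prod.ext (by simp [e']) ?_
    have : fderiv ℝ g (p₀, x₀) v = fderiv ℝ g (p₀, x₀) (v.1, 0) + fderiv ℝ g (p₀, x₀) (0, v.2) := by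
      rw [← map_add]; simp
    simp [e', he, (hpart p₀ x₀).fderiv, this]
    abel
  let Φ := hF.contDiffAt.toOpenPartialHomeomorph Fm hF' (by simp)
  have hΦ : ⇑Φ = Fm := rfl
  have hsrc : (p₀, x₀) ∈ Φ.source := hF.contDiffAt.mem_toOpenPartialHomeomorph_source hF' (by simp)
  have hval : Φ (p₀, x₀) = (p₀, y₀) := by simp [hΦ, hFm, hx₀]
  have htgt : (p₀, y₀) ∈ Φ.target := hval ▸ Φ.map_source hsrc
  have hsymm : Φ.symm (p₀, y₀) = (p₀, x₀) := by rw [← hval, Φ.left_inv hsrc]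
  have hsm : ContDiffAt ℝ ∞ Φ.symm (p₀, y₀) :=
    Φ.contDiffAt_symm htgt (f₀' := e') (by rw [hsymm]; exact hF') (by rw [hsymm]; exact hF.contDiffAt)
  refine (contDiff_snd.contDiffAt.comp (p₀, y₀) hsm).congr_of_eventuallyEq ?_
  filter_upwards [Φ.open_target.mem_nhds htgt] with q hq
  have h1 : Fm (Φ.symm q) = q := Φ.right_inv hq
  have h2 : (Φ.symm q).1 = q.1 := (Prod.ext_iff.1 h1).1
  have h3 : (Φ.symm q).2 + g (Φ.symm q) = q.2 := (Prod.ext_iff.1 h1).2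
  -- Injectivity for a fixed parameter identifies the global inverse with the local smooth one.
  apply (hbij q.1).1
  refine (hinv q).trans ?_
  simp only [Function.comp_apply]
  rw [← h2, Prod.mk.eta, h3]

end Perturbation

/-! ### Composition operators on spaces of continuous functions -/

section CompositionOperator

universe u

variable (K : Type*) [TopologicalSpace K] [CompactSpace K]

/-- The pointwise application of a continuous family of operators. -/
noncomputable def ContinuousMap.applyOperator (A B : Type*) [NormedAddCommGroup A]
    [NormedSpace ℝ A] [NormedAddCommGroup B] [NormedSpace ℝ B] :
    C(K, A →L[ℝ] B) →L[ℝ] C(K, A) →L[ℝ] C(K, B) :=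
  LinearMap.mkContinuous₂
    (LinearMap.mk₂ ℝ (fun (T : C(K, A →L[ℝ] B)) (u : C(K, A)) =>
        (⟨fun k => T k (u k), T.continuous.clm_apply u.continuous⟩ : C(K, B)))
      (fun _ _ _ => by ext; simp) (fun _ _ _ => by ext; simp)
      (fun _ _ _ => by ext; simp) (fun _ _ _ => by ext; simp)) 1
    (fun T u => by
      rw [one_mul, ContinuousMap.norm_le _ (by positivity)]
      intro k
      exact ((T k).le_opNorm (u k)).trans
        (by gcongr; exacts [T.norm_coe_le_norm k, u.norm_coe_le_norm k]))

@[simp]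
theorem ContinuousMap.applyOperator_apply {A B : Type*} [NormedAddCommGroup A]
    [NormedSpace ℝ A] [NormedAddCommGroup B] [NormedSpace ℝ B] (T : C(K, A →L[ℝ] B)) (u : C(K, A))
    (k : K) : ContinuousMap.applyOperator K A B T u k = T k (u k) := rfl

/-- By the mean value inequality the remainder at `k` is controlled by the oscillation of `f'` on
the segment from `u k` to `u k + h k`. This is small uniformly in `k` because postcomposition with
`f'` is continuous in the supremum norm. -/
theorem ContinuousMap.hasFDerivAt_comp {A B : Type*} [NormedAddCommGroup A]
    [NormedSpace ℝ A] [NormedAddCommGroup B] [NormedSpace ℝ B] (f : C(A, B)) (f' : C(A, A →L[ℝ] B))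
    (hf : ∀ x, HasFDerivAt f (f' x) x) (u : C(K, A)) :
    HasFDerivAt (fun u : C(K, A) => f.comp u)
      (ContinuousMap.applyOperator K A B (f'.comp u)) u := by
  rw [hasFDerivAt_iff_isLittleO_nhds_zero, Asymptotics.isLittleO_iff]
  intro ε hε
  have hcont : ContinuousAt (fun v : C(K, A) => f'.comp v) u :=
    (ContinuousMap.continuous_postcomp f').continuousAt
  obtain ⟨δ, hδ, hδ'⟩ := (Metric.continuousAt_iff (f := fun v : C(K, A) => f'.comp v)).1 hcont ε hε
  filter_upwards [Metric.ball_mem_nhds (0 : C(K, A)) hδ] with h hh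
  rw [mem_ball_zero_iff] at hh
  rw [ContinuousMap.norm_le _ (by positivity)]
  intro k
  have key : ∀ a ∈ segment ℝ (u k) (u k + h k), ‖f' a - f' (u k)‖ ≤ ε := by
    intro a ha
    rw [segment_eq_image'] at ha
    obtain ⟨t, ht, rfl⟩ := ha
    have hd : dist (u + t • h) u < δ := by
      rw [dist_eq_norm, add_sub_cancel_left, norm_smul, Real.norm_eq_abs, abs_of_nonneg ht.1]
      exact (mul_le_of_le_one_left (norm_nonneg _) ht.2).trans_lt hh
    have h1 := ((ContinuousMap.dist_le hε.le).1 (hδ' hd).le) k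
    simpa [dist_eq_norm] using h1
  have := (convex_segment (u k) (u k + h k)).norm_image_sub_le_of_norm_hasFDerivWithin_le'
    (f := f) (f' := f') (fun a _ => (hf a).hasFDerivWithinAt) key
    (left_mem_segment ℝ _ _) (right_mem_segment ℝ _ _)
  simp only [ContinuousMap.sub_apply, ContinuousMap.comp_apply, ContinuousMap.add_apply,
    ContinuousMap.applyOperator_apply]
  rw [add_sub_cancel_left] at this
  exact this.trans <| mul_le_mul_of_nonneg_left (h.norm_coe_le_norm k) hε.le

/-- The derivative is again a postcomposition, with `fderiv ℝ f`, so the induction changes the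
codomain to `A →L[ℝ] B`; this is why `B` is quantified inside and shares the universe of `A`. -/
theorem ContinuousMap.contDiff_comp_nat {A : Type u} [NormedAddCommGroup A]
    [NormedSpace ℝ A] (n : ℕ) : ∀ {B : Type u} [NormedAddCommGroup B] [NormedSpace ℝ B]
    (f : C(A, B)), ContDiff ℝ ∞ f → ContDiff ℝ n (fun u : C(K, A) => f.comp u) := by
  induction n with
  | zero => exact fun f _ => contDiff_zero.2 (ContinuousMap.continuous_postcomp f)
  | succ n ih =>
    intro B _ _ f hf
    have hf' := contDiff_infty_iff_fderiv.1 hf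
    let f' : C(A, A →L[ℝ] B) := ⟨fderiv ℝ f, hf'.2.continuous⟩
    push_cast
    refine contDiff_succ_iff_hasFDerivAt.2 ⟨_, ?_, fun u => ContinuousMap.hasFDerivAt_comp K f f'
      (fun x => (hf'.1 x).hasFDerivAt) u⟩
    exact (ContinuousMap.applyOperator K A B).contDiff.comp (ih f' hf'.2)

theorem ContinuousMap.contDiff_comp {A : Type u} [NormedAddCommGroup A] [NormedSpace ℝ A]
    {B : Type u} [NormedAddCommGroup B] [NormedSpace ℝ B] (f : C(A, B)) (hf : ContDiff ℝ ∞ f) :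
    ContDiff ℝ ∞ (fun u : C(K, A) => f.comp u) :=
  contDiff_infty.2 fun n => ContinuousMap.contDiff_comp_nat K n f hf

end CompositionOperator

/-- Precomposing a parameter with this function extends bounds that hold for small parameters to all
of `ℝ`, without altering anything at small parameters. -/
theorem exists_contDiff_clip {r : ℝ} (hr : 0 < r) :
    ∃ a : ℝ → ℝ, ContDiff ℝ ∞ a ∧ (∀ t, |t| ≤ r → a t = t) ∧ ∀ t, |a t| ≤ 2 * r := by
  let b : ContDiffBump (0 : ℝ) := ⟨r, 2 * r, hr, by linarith⟩
  refine ⟨fun t => b t * t, b.contDiff.mul contDiff_id, fun t ht => ?_, fun t => ?_⟩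
  · change b t * t = t
    rw [b.one_of_mem_closedBall (by simpa using ht), one_mul]
  · change |b t * t| ≤ 2 * r
    rcases le_total (2 * r) |t| with h | h
    · rw [b.zero_of_le_dist (by simpa using h)]
      simp [hr.le]
    · rw [abs_mul, abs_of_nonneg b.nonneg]
      exact (mul_le_of_le_one_left (abs_nonneg _) b.le_one).trans h

/-! ### Integrals depending smoothly on a parameter -/

section Integration

universe u

/-- The constant functions. -/
noncomputable def ContinuousMap.constCLM (K E : Type*) [TopologicalSpace K] [CompactSpace K]
    [NormedAddCommGroup E] [NormedSpace ℝ E] : E →L[ℝ] C(K, E) :=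
  LinearMap.mkContinuous ⟨⟨fun x => ContinuousMap.const K x, fun _ _ => rfl⟩, fun _ _ => rfl⟩ 1
    fun x => by
      rw [one_mul, ContinuousMap.norm_le _ (norm_nonneg x)]
      exact fun _ => le_rfl

@[simp]
theorem ContinuousMap.constCLM_apply {K E : Type*} [TopologicalSpace K] [CompactSpace K]
    [NormedAddCommGroup E] [NormedSpace ℝ E] (x : E) (k : K) :
    ContinuousMap.constCLM K E x k = x := rfl

variable {E F : Type u} [NormedAddCommGroup E] [NormedSpace ℝ E]
  [NormedAddCommGroup F] [NormedSpace ℝ F]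

theorem ContinuousMap.continuous_IccExtend' {X : Type*} [TopologicalSpace X]
    (u : C(Icc (0 : ℝ) 1, X)) : Continuous (IccExtend zero_le_one u) := u.continuous.Icc_extend'

/-- The primitive of a continuous function on `[0, 1]`. -/
noncomputable def ContinuousMap.primitive (E : Type*) [NormedAddCommGroup E] [NormedSpace ℝ E] :
    C(Icc (0 : ℝ) 1, E) →L[ℝ] C(Icc (0 : ℝ) 1, E) :=
  LinearMap.mkContinuous
    { toFun := fun u => ⟨fun t => ∫ s in (0 : ℝ)..t, IccExtend zero_le_one u s,
        (intervalIntegral.continuous_primitive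
          (fun _ _ => u.continuous_IccExtend'.intervalIntegrable _ _) 0).comp
            continuous_subtype_val⟩
      map_add' := fun u v => by
        ext t
        simp only [ContinuousMap.coe_mk, ContinuousMap.add_apply]
        rw [← intervalIntegral.integral_add (u.continuous_IccExtend'.intervalIntegrable _ _)
          (v.continuous_IccExtend'.intervalIntegrable _ _)]
        rfl
      map_smul' := fun c u => by
        ext t
        simp only [ContinuousMap.coe_mk, ContinuousMap.smul_apply, RingHom.id_apply]
        rw [← intervalIntegral.integral_smul]
        rfl } 1
    fun u => by
      rw [one_mul, ContinuousMap.norm_le _ (norm_nonneg u)]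
      intro t
      have h := intervalIntegral.norm_integral_le_of_norm_le_const (a := 0) (b := (t : ℝ))
        (f := IccExtend zero_le_one u) (C := ‖u‖) (fun s _ => u.norm_coe_le_norm _)
      refine h.trans (mul_le_of_le_one_right (norm_nonneg _) ?_)
      rw [sub_zero, abs_of_nonneg t.2.1]
      exact t.2.2

theorem ContinuousMap.primitive_apply (u : C(Icc (0 : ℝ) 1, E)) (t : Icc (0 : ℝ) 1) :
    ContinuousMap.primitive E u t = ∫ s in (0 : ℝ)..t, IccExtend zero_le_one u s := rfl

theorem ContinuousMap.norm_primitive_apply_le (u : C(Icc (0 : ℝ) 1, E)) :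
    ‖ContinuousMap.primitive E u‖ ≤ ‖u‖ := by
  simpa using (ContinuousMap.primitive E).le_of_opNorm_le
    (LinearMap.mkContinuous_norm_le _ zero_le_one _) u

/-- The integral is a continuous linear functional of the path `t ↦ f (t, x)`, and this path depends
smoothly on `x` as an element of the space of continuous functions. The chain rule thus replaces
differentiation under the integral sign. -/
theorem contDiff_hasFDerivAt_integral {f : ℝ × E → F} (hf : ContDiff ℝ ∞ f) :
    ContDiff ℝ ∞ (fun x => ∫ t in (0 : ℝ)..1, f (t, x)) ∧
      ∀ x v, fderiv ℝ (fun x => ∫ t in (0 : ℝ)..1, f (t, x)) x v =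
        ∫ t in (0 : ℝ)..1, fderiv ℝ (fun x => f (t, x)) x v := by
  let I := Icc (0 : ℝ) 1
  let J : E →L[ℝ] C(I, ℝ × E) :=
    ((ContinuousLinearMap.inr ℝ ℝ E).compLeftContinuous ℝ I).comp (ContinuousMap.constCLM I E)
  let τ : C(I, ℝ × E) := ⟨fun t => ((t : ℝ), 0), by fun_prop⟩
  let fc : C(ℝ × E, F) := ⟨f, hf.continuous⟩
  have hf' := contDiff_infty_iff_fderiv.1 hf
  let f' : C(ℝ × E, ℝ × E →L[ℝ] F) := ⟨fderiv ℝ f, hf'.2.continuous⟩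
  let ev : C(I, F) →L[ℝ] F :=
    (ContinuousMap.evalCLM ℝ (⟨1, zero_le_one, le_rfl⟩ : I)).comp (ContinuousMap.primitive F)
  have hev (u : C(I, F)) (w : ℝ → F) (hw : ∀ t : I, u t = w t) :
      ev u = ∫ t in (0 : ℝ)..1, w t := by
    change ∫ s in (0 : ℝ)..1, IccExtend zero_le_one u s = _
    refine intervalIntegral.integral_congr fun s hs => ?_
    rw [uIcc_of_le zero_le_one] at hs
    simp only [IccExtend_of_mem _ _ hs]
    exact hw _
  have hpath (x : E) (t : I) : (J x + τ) t = ((t : ℝ), x) :=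
    Prod.ext (zero_add _) (add_zero _)
  have heq : (fun x => ∫ t in (0 : ℝ)..1, f (t, x)) = fun x => ev (fc.comp (J x + τ)) := by
    ext x
    exact (hev _ _ fun t => congrArg f (hpath x t)).symm
  have hJ : ContDiff ℝ ∞ fun x => J x + τ := J.contDiff.add contDiff_const
  rw [heq]
  refine ⟨ev.contDiff.comp ((ContinuousMap.contDiff_comp I fc hf).comp hJ), fun x v => ?_⟩
  have h1 := ev.hasFDerivAt.comp x ((ContinuousMap.hasFDerivAt_comp I fc f'
    (fun y => (hf'.1 y).hasFDerivAt) (J x + τ)).comp x (J.hasFDerivAt.add_const τ))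
  have h2 : fderiv ℝ (fun x => ev (fc.comp (J x + τ))) x = _ := h1.fderiv
  rw [h2]
  refine hev _ _ fun t => ?_
  have h3 : HasFDerivAt (fun x => f (t, x)) _ x :=
    (hf'.1 ((t : ℝ), x)).hasFDerivAt.comp x (hasFDerivAt_prodMk_right (t : ℝ) x)
  rw [h3.fderiv]
  change fderiv ℝ f ((J x + τ) t) (J v t) = _
  rw [hpath]
  rfl

end Integration

/-! ### Smooth flows of nonautonomous vector fields -/

section Flow

universe u

variable {E : Type u} [NormedAddCommGroup E] [NormedSpace ℝ E] [CompleteSpace E]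

/-- A nonautonomous smooth vector field with small derivative has a smooth flow. -/
theorem exists_contDiff_flow {f : ℝ × E → E} (hf : ContDiff ℝ ∞ f)
    (hb : ∀ t, LipschitzWith (1 / 8) fun x => f (t, x)) :
    ∃ φ : ℝ × E → E, ContDiff ℝ ∞ φ ∧ (∀ x, φ (0, x) = x) ∧
      ∀ t ∈ Ioo (-2 : ℝ) 2, ∀ x, HasDerivAt (fun t => φ (t, x)) (f (t, φ (t, x))) t := by
  obtain ⟨a, ha, hat, hab⟩ := exists_contDiff_clip (r := 2) two_pos
  -- The path `u(s) = φ (s t, x)` satisfies `u(s) = x + ∫₀ˢ t f (t r, u(r)) dr` on the fixed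
  -- interval `[0, 1]`, so `t` is a mere parameter of an equation in one Banach space. The clip
  -- bounds the factor `t` by `4`, whence the Lipschitz constant `4 · 1/8 = 1/2`.
  let fh : ℝ × ℝ × E → E := fun q => a q.1 • f (a q.1 * q.2.1, q.2.2)
  have hfh : ContDiff ℝ ∞ fh :=
    (ha.comp contDiff_fst).smul (hf.comp (((ha.comp contDiff_fst).mul
      (contDiff_fst.comp contDiff_snd)).prodMk (contDiff_snd.comp contDiff_snd)))
  let fc : C(ℝ × ℝ × E, E) := ⟨fh, hfh.continuous⟩
  let J : ℝ × C(Icc (0 : ℝ) 1, E) →L[ℝ] C(Icc (0 : ℝ) 1, ℝ × ℝ × E) :=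
    ((ContinuousMap.constCLM (Icc (0 : ℝ) 1) (ℝ × ℝ × E)).comp (ContinuousLinearMap.inl ℝ ℝ (ℝ × E))).comp
      (ContinuousLinearMap.fst ℝ ℝ C(Icc (0 : ℝ) 1, E)) +
    (((ContinuousLinearMap.inr ℝ ℝ (ℝ × E)).comp
      (ContinuousLinearMap.inr ℝ ℝ E)).compLeftContinuous ℝ (Icc (0 : ℝ) 1)).comp (ContinuousLinearMap.snd ℝ ℝ C(Icc (0 : ℝ) 1, E))
  let τ : C(Icc (0 : ℝ) 1, ℝ × ℝ × E) := ⟨fun t => (0, (t : ℝ), 0), by fun_prop⟩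
  have hJ (t : ℝ) (u : C(Icc (0 : ℝ) 1, E)) (s : Icc (0 : ℝ) 1) : (J (t, u) + τ) s = (t, (s : ℝ), u s) := by
    change ((t, 0, 0) + (0, 0, u s) + (0, (s : ℝ), 0) : ℝ × ℝ × E) = _
    ext <;> simp
  let g : ℝ × C(Icc (0 : ℝ) 1, E) → C(Icc (0 : ℝ) 1, E) := fun q => -ContinuousMap.primitive E (fc.comp (J q + τ))
  have hJd : ContDiff ℝ ∞ fun q => J q + τ := J.contDiff.add contDiff_const
  have hg : ContDiff ℝ ∞ g := ((ContinuousMap.primitive E).contDiff.comp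
    ((ContinuousMap.contDiff_comp (Icc (0 : ℝ) 1) fc hfh).comp hJd)).neg
  have hlip (t : ℝ) : LipschitzWith (1 / 2) fun u => g (t, u) := by
    refine LipschitzWith.of_dist_le_mul fun u v => ?_
    have h1 : g (t, u) - g (t, v) = ContinuousMap.primitive E
        (fc.comp (J (t, v) + τ) - fc.comp (J (t, u) + τ)) := by
      rw [map_sub]; simp only [g]; abel
    rw [dist_eq_norm, h1]
    refine (ContinuousMap.norm_primitive_apply_le _).trans ?_
    rw [ContinuousMap.norm_le _ (by positivity)]
    intro s
    change ‖fh ((J (t, v) + τ) s) - fh ((J (t, u) + τ) s)‖ ≤ _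
    rw [hJ, hJ]
    simp only [fh]
    rw [← smul_sub, norm_smul, ← dist_eq_norm, dist_comm u v]
    have h2 := (hb (a t * s)).dist_le_mul (v s) (u s)
    have h3 : ‖a t‖ ≤ 4 := (hab t).trans (by norm_num)
    have h4 := ContinuousMap.dist_apply_le_dist (f := v) (g := u) s
    calc ‖a t‖ * dist (f (a t * s, v s)) (f (a t * s, u s)) ≤ 4 * ((1 / 8) * dist (v s) (u s)) := by
          gcongr
          simpa using h2
      _ ≤ 1 / 2 * dist v u := by linarith
      _ = _ := by norm_num
  obtain ⟨inv, hinv, hinv1, hinv2⟩ := exists_contDiff_inverse hg fun p x => by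
    simpa using norm_fderiv_le_of_lipschitz ℝ (hlip p)
  let U : ℝ → E → C(Icc (0 : ℝ) 1, E) := fun t x => inv (t, ContinuousMap.constCLM (Icc (0 : ℝ) 1) E x)
  let φ : ℝ × E → E := fun q => U q.1 q.2 ⟨1, zero_le_one, le_rfl⟩
  have hUeq (t : ℝ) (x : E) (s : ℝ) (hs : s ∈ Icc (0 : ℝ) 1) : U t x ⟨s, hs⟩ = x + ∫ r in (0 : ℝ)..s,
      a t • f (a t * r, IccExtend zero_le_one (U t x) r) := by
    have h1 : U t x = ContinuousMap.constCLM (Icc (0 : ℝ) 1) E x +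
        ContinuousMap.primitive E (fc.comp (J (t, U t x) + τ)) := by
      have := hinv2 t (ContinuousMap.constCLM (Icc (0 : ℝ) 1) E x)
      simp only [g] at this
      rw [← sub_eq_add_neg, sub_eq_iff_eq_add] at this
      exact this
    have h2 := congrArg (fun u : C(Icc (0 : ℝ) 1, E) => u ⟨s, hs⟩) h1
    refine h2.trans ?_
    simp only [ContinuousMap.add_apply, ContinuousMap.constCLM_apply, ContinuousMap.primitive_apply]
    congr 1
    refine intervalIntegral.integral_congr fun r hr => ?_
    rw [uIcc_of_le hs.1] at hr
    have hr' : r ∈ Icc (0 : ℝ) 1 := ⟨hr.1, hr.2.trans hs.2⟩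
    refine (IccExtend_of_mem zero_le_one (fc.comp (J (t, U t x) + τ)) hr').trans ?_
    rw [IccExtend_of_mem _ _ hr']
    change fh ((J (t, U t x) + τ) ⟨r, hr'⟩) = _
    rw [hJ]
  -- The path `r ↦ U T x (s r)` solves the integral equation with parameter `s T`, and solutions are
  -- unique.
  have hscale (T : ℝ) (hT : |T| ≤ 2) (x : E) (s : ℝ) (hs : s ∈ Icc (0 : ℝ) 1) :
      U T x ⟨s, hs⟩ = φ (s * T, x) := by
    have hsT : |s * T| ≤ 2 := by
      rw [abs_mul, abs_of_nonneg hs.1]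
      exact (mul_le_of_le_one_left (abs_nonneg _) hs.2).trans hT
    have hmem (r : Icc (0 : ℝ) 1) : s * (r : ℝ) ∈ Icc (0 : ℝ) 1 :=
      ⟨mul_nonneg hs.1 r.2.1, mul_le_one₀ hs.2 r.2.1 r.2.2⟩
    let v : C(Icc (0 : ℝ) 1, E) := ⟨fun r => U T x ⟨s * r, hmem r⟩, by fun_prop⟩
    have hv : v + g (s * T, v) = ContinuousMap.constCLM (Icc (0 : ℝ) 1) E x := by
      ext r
      simp only [g, ContinuousMap.add_apply, ContinuousMap.neg_apply, ContinuousMap.primitive_apply,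
        ContinuousMap.constCLM_apply]
      rw [← sub_eq_add_neg, sub_eq_iff_eq_add]
      change U T x ⟨s * r, hmem r⟩ = _
      rw [hUeq]
      congr 1
      have h0 := intervalIntegral.smul_integral_comp_mul_left (a := 0) (b := (r : ℝ))
        (fun r => a T • f (a T * r, IccExtend zero_le_one (U T x) r)) s
      rw [mul_zero] at h0
      rw [← h0, ← intervalIntegral.integral_smul]
      refine intervalIntegral.integral_congr fun ρ hρ => ?_
      rw [uIcc_of_le r.2.1] at hρ
      have hρ' : ρ ∈ Icc (0 : ℝ) 1 := ⟨hρ.1, hρ.2.trans r.2.2⟩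
      refine Eq.trans ?_ (IccExtend_of_mem zero_le_one (fc.comp (J (s * T, v) + τ)) hρ').symm
      simp only [IccExtend_of_mem _ _ (hmem ⟨ρ, hρ'⟩)]
      change _ = fh ((J (s * T, v) + τ) ⟨ρ, hρ'⟩)
      rw [hJ]
      simp only [fh, hat _ hT, hat _ hsT, smul_smul]
      rw [show T * (s * ρ) = s * T * ρ by ring]
      rfl
    have hvU : v = U (s * T) x := by
      simp only [U]
      rw [← hv, hinv1]
    calc U T x ⟨s, hs⟩ = v ⟨1, zero_le_one, le_rfl⟩ := by simp [v]
      _ = _ := by rw [hvU]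
  have hφ : ContDiff ℝ ∞ φ := (ContinuousMap.evalCLM ℝ (M := E)
      (⟨1, zero_le_one, le_rfl⟩ : Icc (0 : ℝ) 1)).contDiff.comp
    (hinv.comp (contDiff_fst.prodMk ((ContinuousMap.constCLM (Icc (0 : ℝ) 1) E).contDiff.comp contDiff_snd)))
  have hder (T : ℝ) (hT : |T| ≤ 2) (hT0 : T ≠ 0) (x : E) (s : ℝ) (hs : s ∈ Ioo (0 : ℝ) 1) :
      HasDerivAt (fun t => φ (t, x)) (f (s * T, φ (s * T, x))) (s * T) := by
    have hcont : Continuous fun r => a T • f (a T * r, IccExtend zero_le_one (U T x) r) :=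
      (hf.continuous.comp ((continuous_const.mul continuous_id).prodMk
        (U T x).continuous_IccExtend')).const_smul _
    have h1 : HasDerivAt (fun s => x + ∫ r in (0 : ℝ)..s,
        a T • f (a T * r, IccExtend zero_le_one (U T x) r)) (T • f (s * T, φ (s * T, x))) s := by
      have := (intervalIntegral.integral_hasDerivAt_right (hcont.intervalIntegrable 0 s)
        (hcont.stronglyMeasurableAtFilter _ _) hcont.continuousAt).const_add x
      rw [hat _ hT, IccExtend_of_mem _ _ (Ioo_subset_Icc_self hs), hscale T hT x, mul_comm T s]
        at this
      rw [hat _ hT]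
      exact this
    have h2 : HasDerivAt (fun s => φ (s * T, x)) (T • f (s * T, φ (s * T, x))) s := by
      refine h1.congr_of_eventuallyEq ?_
      filter_upwards [isOpen_Ioo.mem_nhds hs] with r hr
      rw [← hscale T hT x r (Ioo_subset_Icc_self hr), hUeq]
    have h3 : HasDerivAt (fun t : ℝ => t * T⁻¹) T⁻¹ (s * T) := by
      simpa using (hasDerivAt_id (s * T)).mul_const T⁻¹
    have h4 : s * T * T⁻¹ = s := by field_simp
    have h5 := HasDerivAt.scomp (h := fun t : ℝ => t * T⁻¹) (s * T) (by rw [h4]; exact h2) h3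
    simp only [smul_smul, inv_mul_cancel₀ hT0, one_smul] at h5
    refine h5.congr_of_eventuallyEq (Filter.Eventually.of_forall fun t => ?_)
    simp [hT0]
  -- Write `t = s · (±2)` with `s ∈ (0, 1)` and differentiate the integral equation in `s`. The time
  -- `0` follows afterwards, by continuity of both sides of the differential equation.
  have hne (t : ℝ) (ht : t ∈ Ioo (-2 : ℝ) 2) (ht0 : t ≠ 0) (x : E) :
      HasDerivAt (fun t => φ (t, x)) (f (t, φ (t, x))) t := by
    rcases lt_or_gt_of_ne ht0 with h | h
    · have := hder (-2) (by simp) (by norm_num) x (-t / 2)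
        ⟨by linarith, by linarith [ht.1]⟩
      rwa [show -t / 2 * (-2) = t by ring] at this
    · have := hder 2 (by simp) (by norm_num) x (t / 2) ⟨by linarith, by linarith [ht.2]⟩
      rwa [show t / 2 * 2 = t by ring] at this
  have hφt (x : E) : ContDiff ℝ ∞ fun t => φ (t, x) := hφ.comp (contDiff_id.prodMk contDiff_const)
  refine ⟨φ, hφ, fun x => ?_, fun t ht x => ?_⟩
  · have h0 : (0 : ℝ) ∈ Icc (0 : ℝ) 1 := ⟨le_rfl, zero_le_one⟩
    have := hscale 0 (by simp) x 0 h0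
    rw [zero_mul] at this
    rw [← this, hUeq]
    simp
  · rcases eq_or_ne t 0 with rfl | h0
    · have h1 : Continuous (deriv fun t => φ (t, x)) := (hφt x).continuous_deriv (by simp)
      have h2 : Continuous fun t => f (t, φ (t, x)) :=
        hf.continuous.comp (continuous_id.prodMk (hφt x).continuous)
      have h3 : deriv (fun t => φ (t, x)) 0 = f (0, φ (0, x)) := by
        refine tendsto_nhds_unique_of_eventuallyEq (l := 𝓝[≠] (0 : ℝ))
          (h1.continuousAt.mono_left nhdsWithin_le_nhds)
          (h2.continuousAt.mono_left nhdsWithin_le_nhds) ?_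
        filter_upwards [self_mem_nhdsWithin, mem_nhdsWithin_of_mem_nhds (isOpen_Ioo.mem_nhds ht)]
          with s hs hs'
        exact (hne s hs' hs x).deriv
      rw [← h3]
      exact ((hφt x).differentiable (by simp) 0).hasDerivAt
    · exact hne t ht h0 x

end Flow

/-! ### Symplectic bases -/

section SymplecticBasis

universe u

/-- Symplectic Gram–Schmidt: choose `f` with `β e f = 1` and pass to the common kernel of `β e` and
`β f`. The form stays nondegenerate there, since every vector differs from one in the kernel by a
combination of `e` and `f`. Prescribing the first vector will align `q₁` with the Hamiltonian field.
-/
theorem exists_symplectic_basis (k : ℕ) : ∀ (V : Type u) [AddCommGroup V] [Module ℝ V]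
    [FiniteDimensional ℝ V] (β : V →ₗ[ℝ] V →ₗ[ℝ] ℝ), (∀ v, β v v = 0) →
    (∀ v, (∀ w, β v w = 0) → v = 0) → Module.finrank ℝ V = 2 * k →
    ∀ e : V, (k ≠ 0 → e ≠ 0) → ∃ u w : Fin k → V, (∀ i : Fin k, i.val = 0 → u i = e) ∧
      (∀ i j, β (u i) (u j) = 0) ∧ (∀ i j, β (w i) (w j) = 0) ∧
      ∀ i j, β (u i) (w j) = if i = j then 1 else 0 := by
  induction k with
  | zero =>
    intro V _ _ _ β _ _ _ e _
    exact ⟨fun i => i.elim0, fun i => i.elim0, fun i => i.elim0, fun i => i.elim0,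
      fun i => i.elim0, fun i => i.elim0⟩
  | succ k ih =>
    intro V _ _ _ β halt hnd hdim e he
    have hskew (v w : V) : β v w = -β w v := by
      have := halt (v + w)
      simp only [map_add, LinearMap.add_apply, halt] at this
      linarith
    obtain ⟨f₀, hf₀⟩ : ∃ f, β e f ≠ 0 := by
      by_contra! h
      exact he k.succ_ne_zero (hnd e h)
    set f := (β e f₀)⁻¹ • f₀ with hf
    have hef : β e f = 1 := by simp [hf, hf₀]
    have hfe : β f e = -1 := by rw [hskew, hef]
    let Λ : V →ₗ[ℝ] ℝ × ℝ := (β e).prod (β f)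
    have hΛ : LinearMap.range Λ = ⊤ := by
      rw [LinearMap.range_eq_top]
      rintro ⟨a, b⟩
      refine ⟨a • f - b • e, ?_⟩
      simp [Λ, hef, hfe, halt]
    let W := LinearMap.ker Λ
    have hW (v : W) : β e v = 0 ∧ β f v = 0 := by
      have := v.2
      simpa [W, Λ, LinearMap.mem_ker] using this
    have hWdim : Module.finrank ℝ W = 2 * k := by
      have := Λ.finrank_range_add_finrank_ker
      rw [hΛ, finrank_top, hdim] at this
      simp only [Module.finrank_prod, Module.finrank_self] at this
      change 1 + 1 + Module.finrank ℝ W = _ at this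
      omega
    let βW : W →ₗ[ℝ] W →ₗ[ℝ] ℝ := β.domRestrict₁₂ W W
    have hβW (v w : W) : βW v w = β v w := rfl
    have hndW (v : W) (hv : ∀ w, βW v w = 0) : v = 0 := by
      apply Subtype.ext
      refine hnd v fun w => ?_
      have hw : w - (β e w) • f + (β f w) • e ∈ W := by
        simp [W, Λ, LinearMap.mem_ker, hef, hfe, halt]
      have h1 : β v (w - (β e w) • f + (β f w) • e) = 0 := hv ⟨_, hw⟩
      have h2 : β v f = 0 := by rw [hskew, (hW v).2, neg_zero]
      have h3 : β v e = 0 := by rw [hskew, (hW v).1, neg_zero]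
      simpa [h2, h3] using h1
    obtain ⟨e', he'⟩ : ∃ e' : W, k ≠ 0 → e' ≠ 0 := by
      rcases eq_or_ne k 0 with hk | hk
      · exact ⟨0, fun h => absurd hk h⟩
      · have : Nontrivial W := Module.nontrivial_of_finrank_pos (R := ℝ) (by omega)
        obtain ⟨e', he'⟩ := exists_ne (0 : W)
        exact ⟨e', fun _ => he'⟩
    obtain ⟨u, w, -, huu, hww, huw⟩ := ih W βW (fun v => halt v) hndW hWdim e' he'
    refine ⟨Fin.cons e fun i => u i, Fin.cons f fun i => w i, ?_, ?_, ?_, ?_⟩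
    · intro i hi
      rw [Fin.ext hi (b := 0), Fin.cons_zero]
    · intro i j
      refine Fin.cases ?_ (fun i => ?_) i <;> refine Fin.cases ?_ (fun j => ?_) j
      · simp [halt]
      · simp [(hW _).1]
      · simp [hskew _ e, (hW _).1]
      · simp only [Fin.cons_succ]
        exact huu i j
    · intro i j
      refine Fin.cases ?_ (fun i => ?_) i <;> refine Fin.cases ?_ (fun j => ?_) j
      · simp [halt]
      · simp [(hW _).2]
      · simp [hskew _ f, (hW _).2]
      · simp only [Fin.cons_succ]
        exact hww i j
    · intro i j
      refine Fin.cases ?_ (fun i => ?_) i <;> refine Fin.cases ?_ (fun j => ?_) j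
      · simp [hef]
      · simp [(hW _).1, (Fin.succ_ne_zero _).symm]
      · simp [hskew _ f, (hW _).2, Fin.succ_ne_zero]
      · simp only [Fin.cons_succ, Fin.succ_inj]
        exact huw i j

end SymplecticBasis

/-! ### The standard symplectic form -/

section StdForm

variable (F : Type*) [NormedAddCommGroup F] [InnerProductSpace ℝ F]

/-- The space of positions `(q₁, q')` (or of momenta). -/
abbrev Pos := ℝ × F

/-- The phase space of pairs `(q, p)` of positions and momenta. -/
abbrev Phase := Pos F × Pos F

/-- The pairing of positions with momenta. -/
noncomputable def pairing : Pos F →L[ℝ] Pos F →L[ℝ] ℝ :=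
  (ContinuousLinearMap.mul ℝ ℝ).bilinearComp (.fst ℝ ℝ F) (.fst ℝ ℝ F) +
    ((innerₗ F).mkContinuous₂ 1 fun x y => by
      simpa using norm_inner_le_norm (𝕜 := ℝ) x y).bilinearComp (.snd ℝ ℝ F) (.snd ℝ ℝ F)

/-- The symplectic form `dq ∧ dp` on the phase space. -/
noncomputable def stdForm : Phase F →L[ℝ] Phase F →L[ℝ] ℝ :=
  (pairing F).bilinearComp (.fst ℝ _ _) (.snd ℝ _ _) -
    (pairing F).bilinearComp (.snd ℝ _ _) (.fst ℝ _ _)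

/-- The direction of the coordinate `q₁`. -/
def flowDir : Phase F := ((1, 0), 0)

variable {F}

theorem pairing_apply (a b : Pos F) : pairing F a b = a.1 * b.1 + inner ℝ a.2 b.2 := rfl

theorem pairing_comm (a b : Pos F) : pairing F a b = pairing F b a := by
  rw [pairing_apply, pairing_apply, mul_comm, real_inner_comm]

theorem stdForm_apply (u v : Phase F) :
    stdForm F u v = pairing F u.1 v.2 - pairing F u.2 v.1 := rfl

theorem stdForm_flowDir (v : Phase F) : stdForm F (flowDir F) v = v.2.1 := by
  simp [stdForm_apply, pairing_apply, flowDir]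

theorem eq_zero_of_pairing {a : Pos F} (h : ∀ b, pairing F a b = 0) : a = 0 := by
  have := h a
  rw [pairing_apply] at this
  have h1 := mul_self_nonneg a.1
  have h2 : (0 : ℝ) ≤ inner ℝ a.2 a.2 := real_inner_self_nonneg
  exact Prod.ext (mul_self_eq_zero.1 (by linarith)) ((inner_self_eq_zero (𝕜 := ℝ)).1 (by linarith))

theorem eq_zero_of_stdForm {u : Phase F} (h : ∀ v, stdForm F u v = 0) : u = 0 := by
  refine Prod.ext (eq_zero_of_pairing fun b => ?_) (eq_zero_of_pairing fun b => ?_)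
  · simpa [stdForm_apply] using h (0, b)
  · simpa [stdForm_apply] using h (b, 0)

theorem exists_symplectic_coordinates {k : ℕ} {E : Type*} [NormedAddCommGroup E] [NormedSpace ℝ E]
    [FiniteDimensional ℝ E] (hE : Module.finrank ℝ E = 2 * (k + 1)) (β : E →L[ℝ] E →L[ℝ] ℝ)
    (halt : ∀ v, β v v = 0) (hnd : ∀ v, (∀ w, β v w = 0) → v = 0) {e : E} (he : e ≠ 0) :
    ∃ L : Phase (EuclideanSpace ℝ (Fin k)) ≃L[ℝ] E, L (flowDir _) = e ∧
      ∀ u v, β (L u) (L v) = stdForm _ u v := by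
  let β' : E →ₗ[ℝ] E →ₗ[ℝ] ℝ :=
    LinearMap.mk₂ ℝ (fun v w => β v w) (by simp) (by simp) (by simp) (by simp)
  obtain ⟨u, w, hu0, huu, hww, huw⟩ := exists_symplectic_basis (k + 1) E β' halt hnd hE e
    fun _ => he
  have hskew (v w : E) : β v w = -β w v := by
    have := halt (v + w)
    simp only [map_add, add_apply, halt] at this
    linarith
  replace huu (i j) : β (u i) (u j) = 0 := huu i j
  replace hww (i j) : β (w i) (w j) = 0 := hww i j
  replace huw (i j) : β (u i) (w j) = if i = j then 1 else 0 := huw i j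
  have hwu (i j) : β (w i) (u j) = if j = i then -1 else 0 := by
    rw [hskew, huw]; split_ifs <;> simp
  let L₀ : Phase (EuclideanSpace ℝ (Fin k)) →ₗ[ℝ] E :=
    { toFun := fun z => (z.1.1 • u 0 + ∑ i : Fin k, z.1.2 i • u i.succ) +
        (z.2.1 • w 0 + ∑ i : Fin k, z.2.2 i • w i.succ)
      map_add' := fun x y => by
        simp only [Prod.fst_add, Prod.snd_add, PiLp.add_apply, add_smul, Finset.sum_add_distrib]
        abel
      map_smul' := fun c x => by
        simp only [Prod.smul_fst, Prod.smul_snd, PiLp.smul_apply, smul_eq_mul, mul_smul,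
          Finset.smul_sum, smul_add, RingHom.id_apply] }
  have hL₀ (z z' : Phase (EuclideanSpace ℝ (Fin k))) : β (L₀ z) (L₀ z') = stdForm _ z z' := by
    simp [L₀, stdForm_apply, pairing_apply, huu, hww, huw, hwu, PiLp.inner_apply, Fin.succ_inj,
      Fin.succ_ne_zero, (Fin.succ_ne_zero _).symm, mul_comm]
    ring
  have hinj : Function.Injective L₀ := by
    rw [← LinearMap.ker_eq_bot, LinearMap.ker_eq_bot']
    intro z hz
    refine eq_zero_of_stdForm fun v => ?_
    rw [← hL₀, hz, map_zero, zero_apply]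
  have hfr : Module.finrank ℝ (Phase (EuclideanSpace ℝ (Fin k))) = Module.finrank ℝ E := by
    rw [hE]
    simp
    ring
  let L := (LinearEquiv.ofInjectiveOfFinrankEq L₀ hinj hfr).toContinuousLinearEquiv
  have hL (z : Phase (EuclideanSpace ℝ (Fin k))) : L z = L₀ z := rfl
  refine ⟨L, ?_, fun u v => by rw [hL, hL, hL₀]⟩
  rw [hL]
  simp [L₀, flowDir, hu0 0 rfl]

end StdForm

/-! ### Cutting off vector fields near a zero of second order -/

section Cutoff

variable {E : Type*} [NormedAddCommGroup E] [NormedSpace ℝ E] [FiniteDimensional ℝ E]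

theorem fderiv_partial {P E F : Type*} [NormedAddCommGroup P] [NormedSpace ℝ P]
    [NormedAddCommGroup E] [NormedSpace ℝ E] [NormedAddCommGroup F] [NormedSpace ℝ F]
    {Y : P × E → F} {p : P} {x : E} (hY : DifferentiableAt ℝ Y (p, x)) :
    HasFDerivAt (fun x => Y (p, x))
      ((fderiv ℝ Y (p, x)).comp (ContinuousLinearMap.inr ℝ P E)) x :=
  hY.hasFDerivAt.comp x (hasFDerivAt_prodMk_right p x)

/-- A family of vector fields vanishing to second order at the origin agrees near the origin with a
family of vector fields of small Lipschitz constant. -/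
theorem exists_lipschitz_cutoff {Y : ℝ × E → E} {O : Set (ℝ × E)} (hO : IsOpen O)
    (hY : ContDiffOn ℝ ∞ Y O) {c : ℝ} (hcO : ∀ a ∈ Icc (-c) c, (a, (0 : E)) ∈ O)
    (hY0 : ∀ a ∈ Icc (-c) c, Y (a, 0) = 0)
    (hY1 : ∀ a ∈ Icc (-c) c, fderiv ℝ (fun x => Y (a, x)) 0 = 0)
    {a : ℝ → ℝ} (ha : ContDiff ℝ ∞ a) (hac : ∀ t, a t ∈ Icc (-c) c) :
    ∃ Z : ℝ × E → E, ContDiff ℝ ∞ Z ∧ (∀ t, LipschitzWith (1 / 8) fun x => Z (t, x)) ∧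
      ∃ ρ > 0, ∀ t x, ‖x‖ < ρ → Z (t, x) = Y (a t, x) ∧ (a t, x) ∈ O := by
  let b : ContDiffBump (0 : E) := ⟨1, 2, one_pos, one_lt_two⟩
  have hb : ContDiff ℝ ∞ b := b.contDiff
  obtain ⟨C₀, hC₀⟩ := (hb.continuous_fderiv (by simp)).bounded_above_of_compact_support
    (b.hasCompactSupport.fderiv (𝕜 := ℝ))
  set C := max C₀ 0
  have hC : ∀ x, ‖fderiv ℝ b x‖ ≤ C := fun x => (hC₀ x).trans (le_max_left _ _)
  have hC0 : 0 ≤ C := le_max_right _ _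
  -- If `‖∂ₓ Y‖ ≤ ε` on the ball of radius `r = 3 ρ` and the cutoff has derivative at most `C / ρ`,
  -- the product has derivative at most `ε + (C / ρ) · ε · 3ρ = (3 C + 1) ε = 1/8`.
  set ε : ℝ := 1 / (8 * (3 * C + 1)) with hε
  have hε0 : 0 < ε := by positivity
  have hdO (q) (hq : q ∈ O) : ContDiffAt ℝ ∞ Y q := hY.contDiffAt (hO.mem_nhds hq)
  have hnear : ∀ᶠ x in 𝓝 (0 : E), ∀ s ∈ Icc (-c) c, (s, x) ∈ O ∧
      ‖(fderiv ℝ Y (s, x)).comp (ContinuousLinearMap.inr ℝ ℝ E)‖ < ε := by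
    refine isCompact_Icc.eventually_forall_of_forall_eventually
      (P := fun x s => (s, x) ∈ O ∧
        ‖(fderiv ℝ Y (s, x)).comp (ContinuousLinearMap.inr ℝ ℝ E)‖ < ε) fun s hs => ?_
    have h1 : ∀ᶠ q in 𝓝 (s, (0 : E)), q ∈ O ∧
        ‖(fderiv ℝ Y q).comp (ContinuousLinearMap.inr ℝ ℝ E)‖ < ε := by
      refine Filter.Eventually.and (hO.mem_nhds (hcO s hs)) ?_
      have hc1 : ContinuousAt (fun q => ‖(fderiv ℝ Y q).comp (ContinuousLinearMap.inr ℝ ℝ E)‖)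
          (s, (0 : E)) :=
        (((hdO _ (hcO s hs)).fderiv_right (m := ∞) (by simp)).continuousAt.clm_comp
          continuousAt_const).norm
      refine hc1.eventually_lt continuousAt_const ?_
      rw [← (fderiv_partial ((hdO _ (hcO s hs)).differentiableAt (by simp))).fderiv, hY1 s hs,
        norm_zero]
      exact hε0
    have h2 : Filter.Tendsto (fun z : E × ℝ => (z.2, z.1)) (𝓝 (0, s)) (𝓝 (s, (0 : E))) :=
      (continuous_snd.prodMk continuous_fst).tendsto _
    exact h2.eventually h1
  obtain ⟨r, hr, hball⟩ := Metric.eventually_nhds_iff_ball.1 hnear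
  set ρ := r / 3 with hρ
  have hρ0 : 0 < ρ := by positivity
  let Z : ℝ × E → E := fun q => b (ρ⁻¹ • q.2) • Y (a q.1, q.2)
  have hb0 (x : E) (hx : 2 * ρ ≤ ‖x‖) : b (ρ⁻¹ • x) = 0 := by
    apply b.zero_of_le_dist
    rw [dist_zero_right, norm_smul, Real.norm_eq_abs, abs_of_pos (by positivity)]
    change 2 ≤ _
    rw [inv_mul_eq_div, le_div_iff₀ hρ0]
    exact hx
  have hpair : ContDiff ℝ ∞ fun q : ℝ × E => (a q.1, q.2) :=
    (ha.comp contDiff_fst).prodMk contDiff_snd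
  have hZ : ContDiff ℝ ∞ Z := by
    rw [contDiff_iff_contDiffAt]
    rintro ⟨t, x⟩
    rcases lt_or_ge ‖x‖ r with hx | hx
    · have hm := (hball x (by simpa using hx) _ (hac t)).1
      exact (hb.comp (contDiff_snd.const_smul _)).contDiffAt.smul
        (ContDiffAt.comp (t, x) (f := fun q : ℝ × E => (a q.1, q.2)) (hdO _ hm) hpair.contDiffAt)
    · refine (contDiffAt_const (c := (0 : E))).congr_of_eventuallyEq ?_
      have : ∀ᶠ q : ℝ × E in 𝓝 (t, x), 2 * ρ < ‖q.2‖ :=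
        continuousAt_const.eventually_lt continuous_snd.norm.continuousAt
          (by change 2 * ρ < ‖x‖; linarith)
      filter_upwards [this] with q hq
      simp [Z, hb0 _ hq.le]
  refine ⟨Z, hZ, fun t => ?_, ρ, hρ0, fun t x hx => ⟨?_, ?_⟩⟩
  · have hZt : ContDiff ℝ ∞ fun x => Z (t, x) := hZ.comp (contDiff_const.prodMk contDiff_id)
    refine lipschitzWith_of_nnnorm_fderiv_le (𝕜 := ℝ) (hZt.differentiable (by simp)) fun x => ?_
    rw [← NNReal.coe_le_coe]
    simp only [coe_nnnorm, NNReal.coe_div, NNReal.coe_one, NNReal.coe_ofNat]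
    rcases lt_or_ge ‖x‖ r with hx | hx
    · have hYd (y : E) (hy : ‖y‖ < r) : HasFDerivAt (fun y => Y (a t, y))
          ((fderiv ℝ Y (a t, y)).comp (ContinuousLinearMap.inr ℝ ℝ E)) y :=
        fderiv_partial ((hdO _ (hball y (by simpa using hy) _ (hac t)).1).differentiableAt (by simp))
      have hYn : ‖Y (a t, x)‖ ≤ ε * ‖x‖ := by
        have h1 := (convex_ball (0 : E) r).norm_image_sub_le_of_norm_hasFDerivWithin_le (C := ε)
          (fun y hy => (hYd y (by simpa using hy)).hasFDerivWithinAt)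
          (fun y hy => (hball y hy _ (hac t)).2.le) (Metric.mem_ball_self hr)
          (by simpa using hx : x ∈ Metric.ball 0 r)
        simpa [hY0 _ (hac t)] using h1
      have hbd : HasFDerivAt (fun x : E => b (ρ⁻¹ • x)) (ρ⁻¹ • fderiv ℝ b (ρ⁻¹ • x)) x := by
        have h1 := ((hb.differentiable (by simp)) (ρ⁻¹ • x)).hasFDerivAt.comp x
          ((hasFDerivAt_id x).const_smul ρ⁻¹)
        refine h1.congr_fderiv ?_
        ext v; simp
      have hd := hbd.smul (hYd x hx)
      have hd' : fderiv ℝ (fun x => Z (t, x)) x = _ := hd.fderiv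
      rw [hd']
      refine (norm_add_le _ _).trans ?_
      have e1 : ‖b (ρ⁻¹ • x) • (fderiv ℝ Y (a t, x)).comp (ContinuousLinearMap.inr ℝ ℝ E)‖ ≤ ε := by
        rw [norm_smul, Real.norm_eq_abs, abs_of_nonneg b.nonneg]
        exact (mul_le_of_le_one_left (norm_nonneg _) b.le_one).trans
          (hball x (by simpa using hx) _ (hac t)).2.le
      have e2 : ‖(ρ⁻¹ • fderiv ℝ b (ρ⁻¹ • x)).smulRight (Y (a t, x))‖ ≤ 3 * C * ε := by
        rw [ContinuousLinearMap.norm_smulRight_apply, norm_smul, Real.norm_eq_abs,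
          abs_of_pos (by positivity)]
        calc ρ⁻¹ * ‖fderiv ℝ b (ρ⁻¹ • x)‖ * ‖Y (a t, x)‖ ≤ ρ⁻¹ * C * (ε * r) := by
              gcongr
              · exact hC _
              · exact hYn.trans (by gcongr)
          _ = 3 * C * ε := by rw [hρ]; field_simp
      calc _ ≤ ε + 3 * C * ε := add_le_add e1 e2
        _ = (3 * C + 1) * ε := by ring
        _ = 1 / 8 := by rw [hε]; field_simp
        _ ≤ _ := le_rfl
    · have : (fun y => Z (t, y)) =ᶠ[𝓝 x] fun _ => 0 := by
        have : ∀ᶠ y : E in 𝓝 x, 2 * ρ < ‖y‖ :=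
          continuousAt_const.eventually_lt continuous_norm.continuousAt (by linarith)
        filter_upwards [this] with q hq
        simp [Z, hb0 _ hq.le]
      rw [this.fderiv_eq]
      simp
  · have : b (ρ⁻¹ • x) = 1 := by
      apply b.one_of_mem_closedBall
      rw [mem_closedBall_zero_iff, norm_smul, Real.norm_eq_abs, abs_of_pos (by positivity)]
      change _ ≤ 1
      rw [inv_mul_eq_div, div_le_one hρ0]
      exact hx.le
    simp only [Z, this, one_smul]
  · exact (hball x (by simp; linarith) _ (hac t)).1

end Cutoff

/-! ### The Poincaré lemma -/

section Poincare

universe u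

variable {E : Type u} [NormedAddCommGroup E] [NormedSpace ℝ E]

/-- The Poincaré lemma for two-forms: an explicit primitive. -/
theorem exists_primitive_twoForm {τ : E → E →L[ℝ] E →L[ℝ] ℝ} (hτ : ContDiff ℝ ∞ τ)
    (halt : ∀ x v, τ x v v = 0) {r : ℝ}
    (hcl : ∀ x, ‖x‖ < r → ∀ u v w,
      fderiv ℝ τ x u v w + fderiv ℝ τ x v w u + fderiv ℝ τ x w u v = 0) :
    ∃ l : E → E →L[ℝ] ℝ, ContDiff ℝ ∞ l ∧ l 0 = 0 ∧ (τ 0 = 0 → fderiv ℝ l 0 = 0) ∧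
      (∀ e, (∀ x, τ x e = 0) → ∀ x, l x e = 0) ∧
      ∀ x, ‖x‖ < r → ∀ u v, fderiv ℝ l x u v - fderiv ℝ l x v u = τ x u v := by
  have hskew (x v w) : τ x v w = -τ x w v := by
    have := halt x (v + w)
    simp only [map_add, add_apply, halt] at this
    linarith
  -- The homotopy operator of the contraction `x ↦ t x`. It shows at once that the primitive kills
  -- every vector killed by `τ`, and that it vanishes to second order at `0` if `τ 0 = 0`.
  let f : ℝ × E → E →L[ℝ] ℝ := fun q => q.1 • τ (q.1 • q.2) q.2
  have hf : ContDiff ℝ ∞ f := contDiff_fst.smul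
    ((hτ.comp (contDiff_fst.smul contDiff_snd)).clm_apply contDiff_snd)
  obtain ⟨hl, hl'⟩ := contDiff_hasFDerivAt_integral hf
  set l : E → E →L[ℝ] ℝ := fun x => ∫ t in (0 : ℝ)..1, f (t, x) with hldef
  have hcf (x : E) : Continuous fun t : ℝ => f (t, x) :=
    hf.continuous.comp (continuous_id.prodMk continuous_const)
  have hτd : Differentiable ℝ τ := hτ.differentiable (by simp)
  have hτc : Continuous (fderiv ℝ τ) := hτ.continuous_fderiv (by simp)
  have hfd (t : ℝ) (x u v : E) : fderiv ℝ (fun x => f (t, x)) x u v =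
      t ^ 2 * fderiv ℝ τ (t • x) u x v + t * τ (t • x) u v := by
    have h0 : HasFDerivAt (fun x : E => t • x) (t • ContinuousLinearMap.id ℝ E) x :=
      (hasFDerivAt_id x).const_smul t
    have h1 : HasFDerivAt (fun x : E => τ (t • x)) _ x := (hτd (t • x)).hasFDerivAt.comp x h0
    have h2 : HasFDerivAt (fun x => f (t, x)) _ x :=
      (h1.clm_apply (hasFDerivAt_id x)).const_smul t
    rw [h2.fderiv]
    simp
    ring
  have hlv (x u v : E) : fderiv ℝ l x u v =
      ∫ t in (0 : ℝ)..1, (t ^ 2 * fderiv ℝ τ (t • x) u x v + t * τ (t • x) u v) := by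
    rw [hl' x u]
    have hc : Continuous fun t : ℝ => fderiv ℝ (fun x => f (t, x)) x u := by
      have : (fun t : ℝ => fderiv ℝ (fun x => f (t, x)) x u) =
          fun t => fderiv ℝ f (t, x) (0, u) := by
        ext1 t
        rw [(fderiv_partial (hf.differentiable (by simp) (t, x))).fderiv]
        rfl
      rw [this]
      exact ((hf.continuous_fderiv (by simp)).comp
        (continuous_id.prodMk continuous_const)).clm_apply continuous_const
    rw [ContinuousLinearMap.intervalIntegral_apply (hc.intervalIntegrable _ _)]
    simp only [hfd]
  have hci (x u v : E) : Continuous fun t : ℝ =>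
      t ^ 2 * fderiv ℝ τ (t • x) u x v + t * τ (t • x) u v := by
    have h1 : Continuous fun t : ℝ => t • x := by fun_prop
    have h2 : Continuous fun t : ℝ => fderiv ℝ τ (t • x) := hτc.comp h1
    have h3 : Continuous fun t : ℝ => τ (t • x) := hτ.continuous.comp h1
    fun_prop
  refine ⟨l, hl, ?_, fun h0 => ?_, fun e he x => ?_, fun x hx u v => ?_⟩
  · simp [hldef, f]
  · ext u v
    rw [hlv]
    simp [h0]
  · rw [hldef]
    simp only
    rw [ContinuousLinearMap.intervalIntegral_apply ((hcf x).intervalIntegrable _ _)]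
    have (t : ℝ) : f (t, x) e = 0 := by
      simp only [f, smul_apply]
      rw [hskew, he]
      simp
    simp [this]
  · rw [hlv, hlv, ← intervalIntegral.integral_sub ((hci x u v).intervalIntegrable _ _)
      ((hci x v u).intervalIntegrable _ _)]
    -- By closedness the integrand of `dl(u, v)` is this `t`-derivative, so the integral is the
    -- value at `t = 1`.
    have hder (t : ℝ) : HasDerivAt (fun t : ℝ => t ^ 2 * τ (t • x) u v)
        (2 * t * τ (t • x) u v + t ^ 2 * fderiv ℝ τ (t • x) x u v) t := by
      have h1 : HasDerivAt (fun t : ℝ => τ (t • x)) (fderiv ℝ τ (t • x) x) t := by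
        have h0 : HasDerivAt (fun t : ℝ => t • x) x t := by
          simpa using (hasDerivAt_id t).smul_const x
        exact (hτd (t • x)).hasFDerivAt.comp_hasDerivAt t h0
      have h2 := (h1.clm_apply (hasDerivAt_const t u)).clm_apply (hasDerivAt_const t v)
      have h3 := (hasDerivAt_pow 2 t).mul h2
      refine h3.congr_deriv ?_
      simp
    have heq : ∀ t ∈ uIcc (0 : ℝ) 1, t ^ 2 * fderiv ℝ τ (t • x) u x v + t * τ (t • x) u v -
        (t ^ 2 * fderiv ℝ τ (t • x) v x u + t * τ (t • x) v u) =
        2 * t * τ (t • x) u v + t ^ 2 * fderiv ℝ τ (t • x) x u v := by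
      intro t ht
      rw [uIcc_of_le zero_le_one] at ht
      have hn : ‖t • x‖ < r := by
        rw [norm_smul, Real.norm_eq_abs, abs_of_nonneg ht.1]
        exact (mul_le_of_le_one_left (norm_nonneg _) ht.2).trans_lt hx
      have hsk' (a b c) : fderiv ℝ τ (t • x) a b c = -fderiv ℝ τ (t • x) a c b := by
        have h1 (b c : E) : HasFDerivAt (fun y => τ y b c) _ (t • x) :=
          ((hτd (t • x)).hasFDerivAt.clm_apply (hasFDerivAt_const b (t • x))).clm_apply
            (hasFDerivAt_const c (t • x))
        have h2 := (h1 b c).unique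
          (((h1 c b).neg).congr_of_eventuallyEq (Filter.Eventually.of_forall fun y => hskew y b c))
        have := congrArg (fun T : E →L[ℝ] ℝ => T a) h2
        simpa using this
      have h4 := hcl _ hn u x v
      rw [hsk' x v u] at h4
      rw [hsk' v u x] at h4
      rw [hskew _ v u]
      linear_combination t ^ 2 * h4
    rw [intervalIntegral.integral_congr heq]
    have hcd : Continuous fun t : ℝ => 2 * t * τ (t • x) u v + t ^ 2 * fderiv ℝ τ (t • x) x u v := by
      have h1 : Continuous fun t : ℝ => t • x := by fun_prop
      have h2 : Continuous fun t : ℝ => fderiv ℝ τ (t • x) := hτc.comp h1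
      have h3 : Continuous fun t : ℝ => τ (t • x) := hτ.continuous.comp h1
      fun_prop
    rw [intervalIntegral.integral_eq_sub_of_hasDerivAt (fun t _ => hder t)
      (hcd.intervalIntegrable _ _)]
    simp

end Poincare

/-! ### Moser's method -/

section Moser

variable {E : Type*} [NormedAddCommGroup E] [NormedSpace ℝ E]

/-- The derivative of a flow in the initial condition satisfies the variational equation. -/
theorem hasDerivAt_fderiv_flow {φ : ℝ × E → E} (hφ : ContDiff ℝ ∞ φ) {Z : ℝ × E → E}
    (hZ : ContDiff ℝ ∞ Z) {t : ℝ}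
    (hder : ∀ x, HasDerivAt (fun t => φ (t, x)) (Z (t, φ (t, x))) t) (x u : E) :
    HasDerivAt (fun t => fderiv ℝ (fun x => φ (t, x)) x u)
      (fderiv ℝ (fun y => Z (t, y)) (φ (t, x)) (fderiv ℝ (fun x => φ (t, x)) x u)) t := by
  have hφd : Differentiable ℝ φ := hφ.differentiable (by simp)
  have hΨ : ContDiff ℝ ∞ (fderiv ℝ φ) := hφ.fderiv_right (by simp)
  have hΨd : Differentiable ℝ (fderiv ℝ φ) := hΨ.differentiable (by simp)
  have hpart (t : ℝ) (x : E) : fderiv ℝ (fun x => φ (t, x)) x u = fderiv ℝ φ (t, x) (0, u) := by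
    rw [(fderiv_partial (hφd (t, x))).fderiv]; rfl
  have h1 : HasDerivAt (fun t => fderiv ℝ φ (t, x) (0, u))
      (fderiv ℝ (fderiv ℝ φ) (t, x) (1, 0) (0, u)) t := by
    have hc : HasDerivAt (fun t : ℝ => (t, x)) ((1 : ℝ), (0 : E)) t :=
      (hasDerivAt_id t).prodMk (hasDerivAt_const t x)
    have h0 : HasDerivAt (fun t => fderiv ℝ φ (t, x)) (fderiv ℝ (fderiv ℝ φ) (t, x) (1, 0)) t :=
      (hΨd (t, x)).hasFDerivAt.comp_hasDerivAt t hc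
    refine (h0.clm_apply (hasDerivAt_const t ((0 : ℝ), u))).congr_deriv ?_
    rw [map_zero, add_zero]
  -- Exchanging the time derivative and the space derivative is what turns the flow equation into
  -- the variational equation.
  have hsymm : fderiv ℝ (fderiv ℝ φ) (t, x) (1, 0) (0, u) =
      fderiv ℝ (fderiv ℝ φ) (t, x) (0, u) (1, 0) :=
    (hφ.contDiffAt.isSymmSndFDerivAt (by
      simpa using (show ((2 : ℕ∞) : WithTop ℕ∞) ≤ ∞ from WithTop.coe_le_coe.2 le_top))).eq _ _
  have htime (y : E) : fderiv ℝ φ (t, y) (1, 0) = Z (t, φ (t, y)) := by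
    have hc : HasDerivAt (fun t : ℝ => (t, y)) ((1 : ℝ), (0 : E)) t :=
      (hasDerivAt_id t).prodMk (hasDerivAt_const t y)
    exact ((hφd (t, y)).hasFDerivAt.comp_hasDerivAt t hc).unique (hder y)
  have h2 : HasFDerivAt (fun y => fderiv ℝ φ (t, y) (1, 0)) _ x :=
    (fderiv_partial (hΨd (t, x))).clm_apply (hasFDerivAt_const ((1 : ℝ), (0 : E)) x)
  have h3 : HasFDerivAt (fun y => Z (t, φ (t, y))) _ x :=
    HasFDerivAt.comp (g := fun y => Z (t, y)) x
      (fderiv_partial (hZ.differentiable (by simp) (t, φ (t, x)))) (fderiv_partial (hφd (t, x)))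
  simp only [htime] at h2
  have h4 := congrArg (fun T : E →L[ℝ] E => T u) (h2.unique h3)
  simp only [hpart]
  refine h1.congr_deriv ?_
  rw [hsymm, (fderiv_partial (hZ.differentiable (by simp) (t, φ (t, x)))).fderiv]
  simpa using h4

variable [FiniteDimensional ℝ E]

theorem exists_continuousLinearEquiv_of_nondegenerate (Ω : E →L[ℝ] E →L[ℝ] ℝ)
    (hnd : ∀ v, (∀ w, Ω v w = 0) → v = 0) :
    ∃ e : E ≃L[ℝ] (E →L[ℝ] ℝ), (e : E →L[ℝ] E →L[ℝ] ℝ) = Ω := by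
  have hinj : Function.Injective (Ω : E →ₗ[ℝ] E →L[ℝ] ℝ) := by
    rw [← LinearMap.ker_eq_bot, LinearMap.ker_eq_bot']
    exact fun v hv => hnd v fun w => congrArg (fun T : E →L[ℝ] ℝ => T w) hv
  have hfr : Module.finrank ℝ E = Module.finrank ℝ (E →L[ℝ] ℝ) := by
    rw [← (LinearMap.toContinuousLinearMap : (E →ₗ[ℝ] ℝ) ≃ₗ[ℝ] (E →L[ℝ] ℝ)).finrank_eq]
    exact Subspace.dual_finrank_eq.symm
  exact ⟨(LinearEquiv.ofInjectiveOfFinrankEq _ hinj hfr).toContinuousLinearEquiv,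
    ContinuousLinearMap.ext fun _ => rfl⟩

/-- Moser's method: a closed two-form which agrees with the constant form `Ω` at the origin, and
whose contraction with the vector `e` is constant, is locally equivalent to `Ω` by a map preserving
the linear form `Ω e`. -/
theorem exists_moser (Ω : E →L[ℝ] E →L[ℝ] ℝ) (hΩnd : ∀ v, (∀ w, Ω v w = 0) → v = 0)
    {β : E → E →L[ℝ] E →L[ℝ] ℝ} {r : ℝ} (hr : 0 < r) (hβ : ContDiffOn ℝ ∞ β (Metric.ball 0 r))
    (halt : ∀ x ∈ Metric.ball 0 r, ∀ v, β x v v = 0)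
    (hcl : ∀ x ∈ Metric.ball 0 r, ∀ u v w,
      fderiv ℝ β x u v w + fderiv ℝ β x v w u + fderiv ℝ β x w u v = 0)
    (hβ0 : β 0 = Ω) (e : E) (he : ∀ x ∈ Metric.ball 0 r, β x e = Ω e) :
    ∃ g : E → E, ContDiff ℝ ∞ g ∧ g 0 = 0 ∧ ∀ᶠ x in 𝓝 0, ‖g x‖ < r ∧
      (∀ u v, β (g x) (fderiv ℝ g x u) (fderiv ℝ g x v) = Ω u v) ∧ Ω e (g x) = Ω e x := by
  have hΩalt (v) : Ω v v = 0 := hβ0 ▸ halt 0 (Metric.mem_ball_self hr) v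
  let b : ContDiffBump (0 : E) := ⟨r / 3, r / 2, by positivity, by linarith⟩
  have hb : ContDiff ℝ ∞ b := b.contDiff
  -- The cutoff makes the form global; it remains closed on the ball of radius `r / 3`, which
  -- suffices for a primitive there.
  let τ : E → E →L[ℝ] E →L[ℝ] ℝ := fun x => b x • (β x - Ω)
  have hbz (x : E) (hx : r / 2 ≤ ‖x‖) : b x = 0 := b.zero_of_le_dist (by simpa using hx)
  have hb1 (x : E) (hx : ‖x‖ ≤ r / 3) : b x = 1 := b.one_of_mem_closedBall (by simpa using hx)
  have hτ : ContDiff ℝ ∞ τ := by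
    rw [contDiff_iff_contDiffAt]
    intro x
    rcases lt_or_ge ‖x‖ r with hx | hx
    · exact hb.contDiffAt.smul ((hβ.contDiffAt
        (Metric.isOpen_ball.mem_nhds (by simpa using hx))).sub contDiffAt_const)
    · refine (contDiffAt_const (c := 0)).congr_of_eventuallyEq ?_
      have : ∀ᶠ y : E in 𝓝 x, r / 2 < ‖y‖ :=
        continuousAt_const.eventually_lt continuous_norm.continuousAt (by linarith)
      filter_upwards [this] with y hy
      simp [τ, hbz y hy.le]
  have hτeq (x : E) (hx : ‖x‖ < r / 3) : τ =ᶠ[𝓝 x] fun y => β y - Ω := by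
    filter_upwards [continuous_norm.continuousAt.eventually_lt continuousAt_const hx] with y hy
    simp [τ, hb1 y hy.le]
  have hτalt (x v) : τ x v v = 0 := by
    rcases lt_or_ge ‖x‖ r with hx | hx
    · simp [τ, halt x (by simpa using hx), hΩalt]
    · simp [τ, hbz x (by linarith)]
  have hτe (x) : τ x e = 0 := by
    rcases lt_or_ge ‖x‖ r with hx | hx
    · simp [τ, he x (by simpa using hx)]
    · simp [τ, hbz x (by linarith)]
  have hτ0 : τ 0 = 0 := by simp [τ, hβ0]
  have hτcl (x : E) (hx : ‖x‖ < r / 3) (u v w) :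
      fderiv ℝ τ x u v w + fderiv ℝ τ x v w u + fderiv ℝ τ x w u v = 0 := by
    rw [(hτeq x hx).fderiv_eq, fderiv_sub_const]
    exact hcl x (by simp; linarith) u v w
  obtain ⟨l, hl, hl0, hl1, hle, hdl⟩ := exists_primitive_twoForm hτ hτalt hτcl
  replace hle := hle e hτe
  replace hl1 := hl1 hτ0
  -- the Moser vector field
  let ψ : ℝ × E → E →L[ℝ] E →L[ℝ] ℝ := fun q => Ω + q.1 • τ q.2
  have hψ : ContDiff ℝ ∞ ψ :=
    contDiff_const.add (contDiff_fst.smul (hτ.comp contDiff_snd))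
  let O : Set (ℝ × E) := ψ ⁻¹' range ((↑) : (E ≃L[ℝ] (E →L[ℝ] ℝ)) → E →L[ℝ] E →L[ℝ] ℝ)
  have hO : IsOpen O := ContinuousLinearEquiv.isOpen.preimage hψ.continuous
  let Y : ℝ × E → E := fun q => -(ContinuousLinearMap.inverse (ψ q) (l q.2))
  have hinvO (q) (hq : q ∈ O) : ContDiffAt ℝ ∞ (fun q => ContinuousLinearMap.inverse (ψ q)) q := by
    obtain ⟨e', he'⟩ := hq
    exact ContDiffAt.comp q (he' ▸ contDiffAt_map_inverse e') hψ.contDiffAt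
  have hY : ContDiffOn ℝ ∞ Y O := fun q hq =>
    (((hinvO q hq).clm_apply (hl.comp contDiff_snd).contDiffAt).neg).contDiffWithinAt
  have hYeq (q) (hq : q ∈ O) : ψ q (Y q) = -l q.2 := by
    obtain ⟨e', he'⟩ := hq
    simp only [Y]
    rw [← he', ContinuousLinearMap.inverse_equiv]
    simp
  have h0O (a : ℝ) : (a, (0 : E)) ∈ O := by
    obtain ⟨e', he'⟩ := exists_continuousLinearEquiv_of_nondegenerate Ω hΩnd
    exact ⟨e', by simp [ψ, hτ0, he']⟩
  have hY0 (a : ℝ) : Y (a, 0) = 0 := by simp [Y, hl0]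
  -- Both `l` and its derivative vanish at `0`, so the field vanishes to second order. After a
  -- cutoff its Lipschitz constant is small enough for a flow up to time `1`.
  have hY1 (a : ℝ) : fderiv ℝ (fun x => Y (a, x)) 0 = 0 := by
    have h1 : DifferentiableAt ℝ (fun x => ContinuousLinearMap.inverse (ψ (a, x))) 0 :=
      (fderiv_partial ((hinvO _ (h0O a)).differentiableAt (by simp))).differentiableAt
    have h2 := (h1.hasFDerivAt.clm_apply (hl.differentiable (by simp) 0).hasFDerivAt).neg
    have h3 : fderiv ℝ (fun x => Y (a, x)) 0 = _ := h2.fderiv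
    rw [h3, hl1, hl0]
    simp
  obtain ⟨a, ha, hat, hac⟩ := exists_contDiff_clip (r := 2) two_pos
  obtain ⟨Z, hZ, hZlip, ρ₀, hρ₀, hZY⟩ := exists_lipschitz_cutoff hO hY (c := 2 * 2)
    (fun a _ => h0O a) (fun a _ => hY0 a) (fun a _ => hY1 a) ha (fun t => abs_le.1 (hac t))
  set ρ := min ρ₀ (r / 3) with hρ
  have hρpos : 0 < ρ := lt_min hρ₀ (by positivity)
  have hZeq (t : ℝ) (ht : |t| ≤ 2) (y : E) (hy : ‖y‖ < ρ) :
      (Ω + t • τ y) (Z (t, y)) = -l y := by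
    have h := hZY t y (hy.trans_le (min_le_left _ _))
    rw [hat t ht] at h
    rw [h.1]
    exact hYeq _ h.2
  obtain ⟨φ, hφ, hφ0, hφd⟩ := exists_contDiff_flow hZ hZlip
  have hIcc {t : ℝ} (ht : t ∈ Icc (0 : ℝ) 1) : t ∈ Ioo (-2 : ℝ) 2 ∧ |t| ≤ 2 :=
    ⟨⟨by linarith [ht.1], by linarith [ht.2]⟩, abs_le.2 ⟨by linarith [ht.1], by linarith [ht.2]⟩⟩
  have hZ0 (t : ℝ) : Z (t, 0) = 0 := by
    rw [(hZY t 0 (by simpa using hρ₀)).1, hY0]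
  have hφz (t : ℝ) (ht : t ∈ Icc (0 : ℝ) 1) : φ (t, 0) = 0 := by
    refine ODE_solution_unique (v := fun t x => Z (t, x)) (K := 1 / 8) (a := 0) (b := 1)
      (f := fun t => φ (t, 0)) (g := fun _ => 0) hZlip
      (fun t ht => (hφd t (hIcc ht).1 0).continuousAt.continuousWithinAt)
      (fun t ht => (hφd t (hIcc (Ico_subset_Icc_self ht)).1 0).hasDerivWithinAt)
      continuousOn_const (fun t _ => ?_) (hφ0 0) ht
    simpa [hZ0] using hasDerivWithinAt_const t (Ici t) (0 : E)
  have hsmall : ∀ᶠ x in 𝓝 (0 : E), ∀ t ∈ Icc (0 : ℝ) 1, ‖φ (t, x)‖ < ρ := by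
    refine isCompact_Icc.eventually_forall_of_forall_eventually
      (P := fun x t => ‖φ (t, x)‖ < ρ) fun t ht => ?_
    have hc : Continuous fun z : E × ℝ => ‖φ (z.2, z.1)‖ :=
      (hφ.continuous.comp (continuous_snd.prodMk continuous_fst)).norm
    exact hc.continuousAt.eventually_lt continuousAt_const (by simpa [hφz t ht] using hρpos)
  have h1mem : (1 : ℝ) ∈ Icc (0 : ℝ) 1 := ⟨zero_le_one, le_rfl⟩
  have hτd : Differentiable ℝ τ := hτ.differentiable (by simp)
  have hZd : Differentiable ℝ Z := hZ.differentiable (by simp)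
  refine ⟨fun x => φ (1, x), hφ.comp (contDiff_const.prodMk contDiff_id), hφz 1 h1mem, ?_⟩
  filter_upwards [hsmall] with x hx
  have hrρ : ρ ≤ r / 3 := min_le_right _ _
  refine ⟨(hx 1 h1mem).trans (by linarith), fun u v => ?_, ?_⟩
  · let A : E → ℝ → E := fun u t => fderiv ℝ (fun x => φ (t, x)) x u
    -- The pullback of `Ω + t τ` by the flow at time `t`. Its derivative vanishes: combine the
    -- differentiated equation `(Ω + t τ) Z = -l` with `dl = τ` and the closedness of `τ`.
    let Fn : ℝ → ℝ := fun t => (Ω + t • τ (φ (t, x))) (A u t) (A v t)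
    have hF (t : ℝ) (ht : t ∈ Icc (0 : ℝ) 1) : HasDerivAt Fn 0 t := by
      set y := φ (t, x)
      have hy : ‖y‖ < ρ := hx t ht
      have hA (u : E) : HasDerivAt (A u) (fderiv ℝ (fun y => Z (t, y)) y (A u t)) t :=
        hasDerivAt_fderiv_flow hφ hZ (fun x => hφd t (hIcc ht).1 x) x u
      have hτφ : HasDerivAt (fun t => τ (φ (t, x))) (fderiv ℝ τ y (Z (t, y))) t :=
        (hτd y).hasFDerivAt.comp_hasDerivAt t (hφd t (hIcc ht).1 x)
      have hFd := (((hasDerivAt_const t Ω).add ((hasDerivAt_id t).smul hτφ)).clm_apply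
        (hA u)).clm_apply (hA v)
      refine HasDerivAt.congr_deriv (f' := _) hFd ?_
      have hZy : HasFDerivAt (fun y => Z (t, y)) (fderiv ℝ (fun y => Z (t, y)) y) y :=
        (fderiv_partial (hZd (t, y))).differentiableAt.hasFDerivAt
      have hrel : HasFDerivAt (fun y => (Ω + t • τ y) (Z (t, y))) _ y :=
        (((hτd y).hasFDerivAt.const_smul t).const_add Ω).clm_apply hZy
      have hrel' : HasFDerivAt (fun y => (Ω + t • τ y) (Z (t, y))) (-fderiv ℝ l y) y := by
        refine ((hl.differentiable (by simp) y).hasFDerivAt.neg).congr_of_eventuallyEq ?_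
        filter_upwards [continuous_norm.continuousAt.eventually_lt continuousAt_const hy] with z hz
        exact hZeq t (hIcc ht).2 z hz
      have key (p q : E) := congrArg (fun T : E →L[ℝ] E →L[ℝ] ℝ => T p q) (hrel.unique hrel')
      have k1 := key (A u t) (A v t)
      have k2 := key (A v t) (A u t)
      have k3 := hdl y (hy.trans_le hrρ) (A u t) (A v t)
      have k4 := hτcl y (hy.trans_le hrρ) (Z (t, y)) (A u t) (A v t)
      have hskτ (z p q) : τ z p q = -τ z q p := by
        have := hτalt z (p + q)
        simp only [map_add, add_apply, hτalt] at this
        linarith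
      have hskΩ (p q) : Ω p q = -Ω q p := by
        have := hΩalt (p + q)
        simp only [map_add, add_apply, hΩalt] at this
        linarith
      have hsk' (p q s) : fderiv ℝ τ y p q s = -fderiv ℝ τ y p s q := by
        have h1 (b c : E) : HasFDerivAt (fun y => τ y b c) _ y :=
          ((hτd y).hasFDerivAt.clm_apply (hasFDerivAt_const b y)).clm_apply (hasFDerivAt_const c y)
        have h2 := (h1 q s).unique
          (((h1 s q).neg).congr_of_eventuallyEq (Filter.Eventually.of_forall fun y => hskτ y q s))
        have := congrArg (fun T : E →L[ℝ] ℝ => T p) h2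
        simpa using this
      simp at k1 k2 ⊢
      change _ + _ + (_ + _) + _ = 0
      rw [hskΩ _ (A u t), hskτ y _ (A u t)] at k2
      rw [hsk' (A u t)] at k4
      rw [show φ (t, x) = y from rfl]
      linear_combination k1 - k2 + t * k4 - k3
    have hconst := constant_of_has_deriv_right_zero (f := Fn) (a := 0) (b := 1)
      (fun t ht => (hF t ht).continuousAt.continuousWithinAt)
      (fun t ht => (hF t (Ico_subset_Icc_self ht)).hasDerivWithinAt) 1 h1mem
    have hid : (fun x => φ (0, x)) = id := funext hφ0
    have hF0 : Fn 0 = Ω u v := by simp [Fn, A, hid]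
    have hF1 : Fn 1 = β (φ (1, x)) (fderiv ℝ (fun x => φ (1, x)) x u)
        (fderiv ℝ (fun x => φ (1, x)) x v) := by
      simp [Fn, A, τ, hb1 _ ((hx 1 h1mem).le.trans hrρ)]
    rw [← hF1, hconst, hF0]
  -- Since `l` and `τ` kill `e`, the equation for `Z` evaluated at `e` gives `Ω e Z = 0`, so the
  -- flow preserves `Ω e`.
  · have hF (t : ℝ) (ht : t ∈ Icc (0 : ℝ) 1) : HasDerivAt (fun t => Ω e (φ (t, x))) 0 t := by
      refine ((Ω e).hasFDerivAt.comp_hasDerivAt t (hφd t (hIcc ht).1 x)).congr_deriv ?_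
      have h1 := congrArg (fun T : E →L[ℝ] ℝ => T e) (hZeq t (hIcc ht).2 _ (hx t ht))
      have h2 : (Ω + t • τ (φ (t, x))) (Z (t, φ (t, x)) + e) (Z (t, φ (t, x)) + e) = 0 := by
        simp [hΩalt, hτalt, -map_add]
      simp [hle, hτe, hΩalt, hτalt] at h1 h2
      linarith
    have hconst := constant_of_has_deriv_right_zero (f := fun t => Ω e (φ (t, x))) (a := 0) (b := 1)
      (fun t ht => (hF t ht).continuousAt.continuousWithinAt)
      (fun t ht => (hF t (Ico_subset_Icc_self ht)).hasDerivWithinAt) 1 h1mem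
    simpa [hφ0] using hconst

end Moser

/-! ### Darboux coordinates adapted to a function on a normed space -/

section LocalDarboux

variable {E : Type*} [NormedAddCommGroup E] [NormedSpace ℝ E]

theorem ContDiffOn.bilinearComp_fderiv {E' : Type*} [NormedAddCommGroup E'] [NormedSpace ℝ E']
    {β : E' → E →L[ℝ] E →L[ℝ] ℝ} {T : E' → E' →L[ℝ] E} {s : Set E'} (hβ : ContDiffOn ℝ ∞ β s)
    (hT : ContDiffOn ℝ ∞ T s) :
    ContDiffOn ℝ ∞ (fun z => (β z).bilinearComp (T z) (T z)) s := by
  change ContDiffOn ℝ ∞ (fun z => (((β z).comp (T z)).flip.comp (T z)).flip) _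
  have h2 : ContDiffOn ℝ ∞ (fun z => ((β z).comp (T z)).flip) s :=
    (ContinuousLinearMap.flipₗᵢ ℝ E' E ℝ).contDiff.comp_contDiffOn (hβ.clm_comp hT)
  exact (ContinuousLinearMap.flipₗᵢ ℝ E' E' ℝ).contDiff.comp_contDiffOn (h2.clm_comp hT)

/-- The pullback of a closed alternating two-form is closed. -/
theorem fderiv_pullback_twoForm_cyclic {E' : Type*} [NormedAddCommGroup E'] [NormedSpace ℝ E']
    {g : E' → E} (hg : ContDiff ℝ ∞ g) {β : E → E →L[ℝ] E →L[ℝ] ℝ} {x : E'}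
    (hβ : DifferentiableAt ℝ β (g x)) (halt : ∀ᶠ y in 𝓝 (g x), ∀ v, β y v v = 0)
    (hcl : ∀ u v w, fderiv ℝ β (g x) u v w + fderiv ℝ β (g x) v w u + fderiv ℝ β (g x) w u v = 0)
    (u v w : E') :
    fderiv ℝ (fun x => (β (g x)).bilinearComp (fderiv ℝ g x) (fderiv ℝ g x)) x u v w +
      fderiv ℝ (fun x => (β (g x)).bilinearComp (fderiv ℝ g x) (fderiv ℝ g x)) x v w u +
      fderiv ℝ (fun x => (β (g x)).bilinearComp (fderiv ℝ g x) (fderiv ℝ g x)) x w u v = 0 := by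
  have hgd : DifferentiableAt ℝ g x := hg.differentiable (by simp) x
  have hgd' : DifferentiableAt ℝ (fderiv ℝ g) x :=
    (hg.fderiv_right (m := ∞) (by simp)).differentiable (by simp) x
  have hβg : HasFDerivAt (fun x => β (g x)) ((fderiv ℝ β (g x)).comp (fderiv ℝ g x)) x :=
    hβ.hasFDerivAt.comp x hgd.hasFDerivAt
  have hsymm := (hg.contDiffAt (x := x)).isSymmSndFDerivAt (by
      simpa using (show ((2 : ℕ∞) : WithTop ℕ∞) ≤ ∞ from WithTop.coe_le_coe.2 le_top))
  have hd : DifferentiableAt ℝ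
      (fun x => (β (g x)).bilinearComp (fderiv ℝ g x) (fderiv ℝ g x)) x := by
    change DifferentiableAt ℝ (fun x => (((β (g x)).comp (fderiv ℝ g x)).flip.comp
      (fderiv ℝ g x)).flip) x
    have h1 : DifferentiableAt ℝ (fun x => ((β (g x)).comp (fderiv ℝ g x))) x :=
      hβg.differentiableAt.clm_comp hgd'
    have h2 : DifferentiableAt ℝ (fun x => ((β (g x)).comp (fderiv ℝ g x)).flip) x :=
      (ContinuousLinearMap.flipₗᵢ ℝ E' E ℝ).differentiable.differentiableAt.comp x h1
    exact (ContinuousLinearMap.flipₗᵢ ℝ E' E' ℝ).differentiable.differentiableAt.comp x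
      (h2.clm_comp hgd')
  -- The terms with second derivatives of `g` cancel in the cyclic sum, by their symmetry and the
  -- skewness of `β`.
  have key (u v w : E') : fderiv ℝ (fun x => (β (g x)).bilinearComp (fderiv ℝ g x) (fderiv ℝ g x))
      x u v w = fderiv ℝ β (g x) (fderiv ℝ g x u) (fderiv ℝ g x v) (fderiv ℝ g x w) +
        β (g x) (fderiv ℝ (fderiv ℝ g) x u v) (fderiv ℝ g x w) +
        β (g x) (fderiv ℝ g x v) (fderiv ℝ (fderiv ℝ g) x u w) := by
    have h1 : HasFDerivAt (fun x => β (g x) (fderiv ℝ g x v) (fderiv ℝ g x w)) _ x :=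
      (hd.hasFDerivAt.clm_apply (hasFDerivAt_const v x)).clm_apply (hasFDerivAt_const w x)
    have h2 : HasFDerivAt (fun x => β (g x) (fderiv ℝ g x v) (fderiv ℝ g x w)) _ x :=
      (hβg.clm_apply (hgd'.hasFDerivAt.clm_apply (hasFDerivAt_const v x))).clm_apply
        (hgd'.hasFDerivAt.clm_apply (hasFDerivAt_const w x))
    have h3 := congrArg (fun T : E' →L[ℝ] ℝ => T u) (h1.unique h2)
    simp at h3
    rw [h3]
    ring
  have hsk (p q : E) : β (g x) p q = -β (g x) q p := by
    have h := halt.self_of_nhds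
    have := h (p + q)
    simp only [map_add, add_apply, h] at this
    linarith
  rw [key, key, key]
  have h := hcl (fderiv ℝ g x u) (fderiv ℝ g x v) (fderiv ℝ g x w)
  rw [hsymm.eq v u, hsymm.eq w u, hsymm.eq w v,
    hsk (fderiv ℝ (fderiv ℝ g) x u v), hsk (fderiv ℝ (fderiv ℝ g) x u w),
    hsk (fderiv ℝ g x u)]
  linear_combination h

variable [FiniteDimensional ℝ E]

/-- A function with a nonzero differential and a vector field preserving it are both straightened
by the same local coordinates. -/
theorem exists_straightening {O : Set E} (hO : IsOpen O) {u₀ : E} (hu₀ : u₀ ∈ O) {h : E → ℝ}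
    (hh : ContDiffOn ℝ ∞ h O) (hh0 : fderiv ℝ h u₀ ≠ 0) {X : E → E} (hX : ContDiffOn ℝ ∞ X O)
    (hX0 : X u₀ ≠ 0) (hhX : ∀ u ∈ O, fderiv ℝ h u (X u) = 0) :
    ∃ g : E → E, ContDiff ℝ ∞ g ∧ g 0 = u₀ ∧ fderiv ℝ g 0 = .id ℝ E ∧ ∀ᶠ w in 𝓝 0, g w ∈ O ∧
      h (g w) = h u₀ + fderiv ℝ h u₀ w ∧ fderiv ℝ g w (X u₀) = X (g w) := by
  obtain ⟨y, hy⟩ : ∃ y, fderiv ℝ h u₀ y = 1 := by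
    obtain ⟨y, hy⟩ : ∃ y, fderiv ℝ h u₀ y ≠ 0 := by
      by_contra! H
      exact hh0 (ContinuousLinearMap.ext H)
    exact ⟨(fderiv ℝ h u₀ y)⁻¹ • y, by simp [hy]⟩
  obtain ⟨ℓ, hℓ⟩ : ∃ ℓ : E →L[ℝ] ℝ, ℓ (X u₀) = 1 := by
    obtain ⟨ℓ, hℓ⟩ := SeparatingDual.exists_eq_one (R := ℝ) hX0
    exact ⟨ℓ, hℓ⟩
  -- linearization of the function
  let Y : ℝ × E → E := fun q => (h (u₀ + q.2) - h u₀ - fderiv ℝ h u₀ q.2) • y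
  let O' : Set (ℝ × E) := (fun q : ℝ × E => u₀ + q.2) ⁻¹' O
  have hO' : IsOpen O' := hO.preimage (by fun_prop)
  have hY : ContDiffOn ℝ ∞ Y O' := by
    refine ContDiffOn.smul ((ContDiffOn.sub ?_ contDiffOn_const).sub ?_) contDiffOn_const
    · exact hh.comp (contDiff_const.add contDiff_snd).contDiffOn fun q hq => hq
    · exact ((fderiv ℝ h u₀).contDiff.comp contDiff_snd).contDiffOn
  have hY1 : fderiv ℝ (fun x => Y ((0 : ℝ), x)) 0 = 0 := by
    have hd : HasFDerivAt h (fderiv ℝ h u₀) (u₀ + 0) := by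
      rw [add_zero]
      exact ((hh.contDiffAt (hO.mem_nhds hu₀)).differentiableAt (by simp)).hasFDerivAt
    have h1 : HasFDerivAt (fun x => h (u₀ + x)) _ 0 :=
      hd.comp 0 ((hasFDerivAt_id (0 : E)).const_add u₀)
    have h2 : HasFDerivAt (fun x => Y ((0 : ℝ), x)) _ 0 :=
      ((h1.sub_const (h u₀)).sub (fderiv ℝ h u₀).hasFDerivAt).smul_const y
    rw [h2.fderiv]
    ext v
    simp
  obtain ⟨a, ha, -, hac⟩ := exists_contDiff_clip (r := 1) one_pos
  obtain ⟨Z, hZ, hZlip, ρ, hρ, hZY⟩ := exists_lipschitz_cutoff hO' hY (c := 2 * 1)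
    (fun a _ => by simpa [O'] using hu₀) (fun a _ => by simp [Y]) (fun a _ => hY1) ha
    (fun t => abs_le.1 (hac t))
  -- Applying `dh` at `u₀` to `κ + Z κ = w` and using `dh y = 1` shows that `h (u₀ + κ)` is affine
  -- in `w`. The real variable of `Y` is a dummy, kept at `0`.
  obtain ⟨κ, hκ, hκ1, hκ2⟩ := exists_contDiff_inverse (g := Z) hZ fun p x => by
    refine (norm_fderiv_le_of_lipschitz ℝ (hZlip p)).trans ?_
    norm_num
  let ψ : E → E := fun w => u₀ + κ (0, w)
  have hψ : ContDiff ℝ ∞ ψ := contDiff_const.add (hκ.comp (contDiff_const.prodMk contDiff_id))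
  have hZ0 : Z (0, 0) = 0 := by
    rw [(hZY 0 0 (by simpa using hρ)).1]; simp [Y]
  have hκ0 : κ (0, 0) = 0 := by simpa [hZ0] using hκ1 0 0
  have hψ0 : ψ 0 = u₀ := by simp [ψ, hκ0]
  have hκsmall : ∀ᶠ w in 𝓝 (0 : E), ‖κ (0, w)‖ < ρ := by
    have : Continuous fun w => ‖κ (0, w)‖ :=
      (hκ.continuous.comp (continuous_const.prodMk continuous_id)).norm
    exact this.continuousAt.eventually_lt continuousAt_const (by simpa [hκ0] using hρ)
  have hψh : ∀ᶠ w in 𝓝 (0 : E), h (ψ w) = h u₀ + fderiv ℝ h u₀ w := by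
    filter_upwards [hκsmall] with w hw
    have h1 := congrArg (fderiv ℝ h u₀) (hκ2 0 w)
    rw [(hZY 0 _ hw).1] at h1
    simp [Y, hy] at h1
    simp only [ψ]
    linarith
  have hψ1 : fderiv ℝ ψ 0 = .id ℝ E := by
    have hZ1 : fderiv ℝ (fun x => Z (0, x)) 0 = 0 := by
      rw [← hY1]
      refine Filter.EventuallyEq.fderiv_eq ?_
      filter_upwards [continuous_norm.continuousAt.eventually_lt (x₀ := (0 : E))
        (g := fun _ => ρ) continuousAt_const (by simpa using hρ)] with x hx
      exact (hZY 0 x hx).1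
    have hκd : HasFDerivAt (fun w => κ (0, w)) (fderiv ℝ (fun w => κ (0, w)) 0) 0 :=
      ((hκ.comp (contDiff_const.prodMk contDiff_id)).differentiable (by simp) 0).hasFDerivAt
    have hZd : HasFDerivAt (fun x => Z (0, x)) (fderiv ℝ (fun x => Z (0, x)) 0) (κ (0, 0)) := by
      rw [hκ0]
      exact ((hZ.comp (contDiff_const.prodMk contDiff_id)).differentiable (by simp) 0).hasFDerivAt
    have h1 : HasFDerivAt (fun w => κ (0, w) + Z (0, κ (0, w))) _ 0 :=
      hκd.add (HasFDerivAt.comp (g := fun x => Z (0, x)) (0 : E) hZd hκd)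
    simp only [hκ2, hZ1] at h1
    have h2 := h1.unique (hasFDerivAt_id 0)
    simp only [ContinuousLinearMap.zero_comp, add_zero] at h2
    rw [← h2]
    exact fderiv_const_add _
  -- straightening of the vector field
  obtain ⟨r, hr, hrO⟩ := Metric.isOpen_iff.1 hO u₀ hu₀
  let b : ContDiffBump u₀ := ⟨r / 3, r / 2, by positivity, by linarith⟩
  have hb : ContDiff ℝ ∞ b := b.contDiff
  let W : E → E := fun u => b u • X u
  have hWs : HasCompactSupport W := b.hasCompactSupport.smul_right
  have hW : ContDiff ℝ ∞ W := by
    rw [contDiff_iff_contDiffAt]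
    intro u
    rcases lt_or_ge (dist u u₀) r with hu | hu
    · exact hb.contDiffAt.smul (hX.contDiffAt (hO.mem_nhds (hrO hu)))
    · refine (contDiffAt_const (c := 0)).congr_of_eventuallyEq ?_
      have : ∀ᶠ v in 𝓝 u, r / 2 < dist v u₀ :=
        continuousAt_const.eventually_lt (by fun_prop) (by linarith)
      filter_upwards [this] with v hv
      simp [W, b.zero_of_le_dist (x := v) hv.le]
  have hW1 (u : E) (hu : dist u u₀ < r / 3) : W u = X u := by
    simp [W, b.one_of_mem_closedBall (x := u) hu.le]
  obtain ⟨C, hC⟩ := (hW.continuous_fderiv (by simp)).bounded_above_of_compact_support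
    (hWs.fderiv (𝕜 := ℝ))
  have hC0 : 0 ≤ C := (norm_nonneg _).trans (hC u₀)
  -- Slowing the field down by `η` meets the Lipschitz bound required for the flow; the form `ℓ'`
  -- below restores the time scale.
  set η : ℝ := 1 / (8 * (C + 1)) with hη
  have hη0 : 0 < η := by positivity
  have hlip : LipschitzWith (1 / 8) fun x => η • W x := by
    refine lipschitzWith_of_nnnorm_fderiv_le (𝕜 := ℝ)
      ((hW.differentiable (by simp)).const_smul η) fun x => ?_
    rw [← NNReal.coe_le_coe, coe_nnnorm, fderiv_fun_const_smul (hW.differentiable (by simp) x),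
      norm_smul, Real.norm_of_nonneg hη0.le]
    calc η * ‖fderiv ℝ W x‖ ≤ η * (C + 1) := by
          gcongr; linarith [hC x]
      _ = _ := by rw [hη]; push_cast; field_simp
  obtain ⟨φ, hφ, hφ0, hφd⟩ := exists_contDiff_flow (f := fun q : ℝ × E => η • W q.2)
    ((hW.comp contDiff_snd).const_smul η) (fun _ => hlip)
  have hφdiff : Differentiable ℝ φ := hφ.differentiable (by simp)
  have hφt (t : ℝ) (ht : t ∈ Ioo (-2 : ℝ) 2) (x : E) :
      fderiv ℝ φ (t, x) (1, 0) = η • W (φ (t, x)) := by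
    have hc : HasDerivAt (fun t : ℝ => (t, x)) ((1 : ℝ), (0 : E)) t :=
      (hasDerivAt_id t).prodMk (hasDerivAt_const t x)
    exact ((hφdiff (t, x)).hasFDerivAt.comp_hasDerivAt t hc).unique (hφd t ht x)
  let P : E →L[ℝ] E := .id ℝ E - ℓ.smulRight (X u₀)
  let ℓ' : E →L[ℝ] ℝ := η⁻¹ • ℓ
  have hP (w : E) : P w = w - ℓ w • X u₀ := by simp [P]
  have hPX : P (X u₀) = 0 := by simp [hP, hℓ]
  have hℓX : ℓ' (X u₀) = η⁻¹ := by simp [ℓ', hℓ]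
  -- The component of `w` along `X u₀` is used as flow time and the rest, `P w`, as starting point.
  -- The field preserves `h`, so `h` stays affine in the new coordinates.
  let g : E → E := fun w => φ (ℓ' w, ψ (P w))
  have hg : ContDiff ℝ ∞ g := hφ.comp (ℓ'.contDiff.prodMk (hψ.comp P.contDiff))
  have hgd (w : E) : fderiv ℝ g w = (fderiv ℝ φ (ℓ' w, ψ (P w))).comp
      (ℓ'.prod ((fderiv ℝ ψ (P w)).comp P)) := by
    have h1 : HasFDerivAt (fun w => ψ (P w)) ((fderiv ℝ ψ (P w)).comp P) w :=
      (hψ.differentiable (by simp) (P w)).hasFDerivAt.comp w P.hasFDerivAt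
    have h2 : HasFDerivAt (fun w => (ℓ' w, ψ (P w))) (ℓ'.prod ((fderiv ℝ ψ (P w)).comp P)) w :=
      ℓ'.hasFDerivAt.prodMk h1
    exact ((hφdiff _).hasFDerivAt.comp w h2).fderiv
  have hg0 : g 0 = u₀ := by simp [g, hφ0, hψ0]
  have hℓsmall : ∀ᶠ w in 𝓝 (0 : E), |ℓ' w| < 1 :=
    (ℓ'.continuous.abs).continuousAt.eventually_lt continuousAt_const (by simp)
  have hnear : ∀ᶠ w in 𝓝 (0 : E), ∀ s ∈ Icc (0 : ℝ) 1,
      dist (φ (s * ℓ' w, ψ (P w))) u₀ < r / 3 := by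
    refine isCompact_Icc.eventually_forall_of_forall_eventually
      (P := fun w s => dist (φ (s * ℓ' w, ψ (P w))) u₀ < r / 3) fun s _ => ?_
    have hc : Continuous fun z : E × ℝ => dist (φ (z.2 * ℓ' z.1, ψ (P z.1))) u₀ :=
      (hφ.continuous.comp ((continuous_snd.mul (ℓ'.continuous.comp continuous_fst)).prodMk
        (hψ.continuous.comp (P.continuous.comp continuous_fst)))).dist continuous_const
    exact hc.continuousAt.eventually_lt continuousAt_const (by simpa [hφ0, hψ0] using hr)
  have hPev : ∀ᶠ w in 𝓝 (0 : E), h (ψ (P w)) = h u₀ + fderiv ℝ h u₀ (P w) := by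
    have : Filter.Tendsto P (𝓝 0) (𝓝 0) := by simpa using P.continuous.tendsto 0
    exact this.eventually hψh
  have hball (u : E) (hu : dist u u₀ < r / 3) : u ∈ O := hrO (by
    rw [Metric.mem_ball]; linarith)
  refine ⟨g, hg, hg0, ?_, ?_⟩
  · rw [hgd]
    ext v
    have h0 : fderiv ℝ φ (0, u₀) (0, P v) = P v := by
      have h1 := fderiv_partial (hφdiff ((0 : ℝ), u₀))
      simp only [hφ0] at h1
      exact (congrArg (fun T : E →L[ℝ] E => T (P v)) (h1.unique (hasFDerivAt_id u₀)))
    have h2 : fderiv ℝ φ (0, u₀) (ℓ' v, P v) = ℓ' v • fderiv ℝ φ (0, u₀) (1, 0) +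
        fderiv ℝ φ (0, u₀) (0, P v) := by
      rw [← map_smul, ← map_add]; simp
    simp only [map_zero, hψ0, hψ1, ContinuousLinearMap.comp_apply, ContinuousLinearMap.prod_apply,
      ContinuousLinearMap.id_apply]
    rw [h2, h0, hφt 0 (by norm_num), hφ0, hW1 u₀ (by simpa using hr), hP, smul_smul]
    simp [ℓ', hη0.ne', mul_comm]
  · filter_upwards [hℓsmall, hnear, hPev] with w hw1 hw2 hw3
    have h1 : dist (g w) u₀ < r / 3 := by simpa [g] using hw2 1 (by simp)
    refine ⟨hball _ h1, ?_, ?_⟩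
    · have hder (s : ℝ) (hs : s ∈ Icc (0 : ℝ) 1) :
          HasDerivAt (fun s => h (φ (s * ℓ' w, ψ (P w)))) 0 s := by
        have habs := abs_lt.1 hw1
        have hin : s * ℓ' w ∈ Ioo (-2 : ℝ) 2 := by
          constructor <;> nlinarith [hs.1, hs.2, habs.1, habs.2]
        have hφs := (hφd (s * ℓ' w) hin (ψ (P w))).scomp s ((hasDerivAt_id s).mul_const (ℓ' w))
        have hhd := ((hh.contDiffAt (hO.mem_nhds (hball _ (hw2 s hs)))).differentiableAt
          (by simp)).hasFDerivAt
        refine (hhd.comp_hasDerivAt s hφs).congr_deriv ?_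
        rw [hW1 _ (hw2 s hs)]
        simp [hhX _ (hball _ (hw2 s hs))]
      have hconst := constant_of_has_deriv_right_zero
        (f := fun s => h (φ (s * ℓ' w, ψ (P w)))) (a := 0) (b := 1)
        (fun t ht => (hder t ht).continuousAt.continuousWithinAt)
        (fun t ht => (hder t (Ico_subset_Icc_self ht)).hasDerivWithinAt) 1 (by simp)
      simp only [one_mul, zero_mul, hφ0] at hconst
      rw [show h (g w) = _ from hconst, hw3, hP, map_sub, map_smul, hhX u₀ hu₀]
      simp
    · have habs := abs_lt.1 hw1
      have h2 : ((η⁻¹ : ℝ), (0 : E)) = η⁻¹ • (1, 0) := by simp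
      rw [hgd, ContinuousLinearMap.comp_apply, ContinuousLinearMap.prod_apply,
        ContinuousLinearMap.comp_apply, hPX, hℓX, map_zero, h2, map_smul,
        hφt _ ⟨by linarith, by linarith⟩, smul_smul, inv_mul_cancel₀ hη0.ne', one_smul]
      exact hW1 _ h1

/-- Local Darboux coordinates adapted to a Hamiltonian function. -/
theorem exists_local_darboux {k : ℕ} (hE : Module.finrank ℝ E = 2 * (k + 1)) {O : Set E}
    (hO : IsOpen O) {u₀ : E} (hu₀ : u₀ ∈ O) {h : E → ℝ} (hh : ContDiffOn ℝ ∞ h O)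
    (hh0 : fderiv ℝ h u₀ ≠ 0) {β : E → E →L[ℝ] E →L[ℝ] ℝ} (hβ : ContDiffOn ℝ ∞ β O)
    (halt : ∀ u ∈ O, ∀ v, β u v v = 0) (hnd : ∀ u ∈ O, ∀ v, (∀ w, β u v w = 0) → v = 0)
    (hcl : ∀ x ∈ O, ∀ u v w,
      fderiv ℝ β x u v w + fderiv ℝ β x v w u + fderiv ℝ β x w u v = 0) :
    ∃ g : Phase (EuclideanSpace ℝ (Fin k)) → E, ContDiff ℝ ∞ g ∧ g 0 = u₀ ∧
      ∀ᶠ z in 𝓝 0, g z ∈ O ∧ h (g z) = h u₀ + z.2.1 ∧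
        ∀ v w, β (g z) (fderiv ℝ g z v) (fderiv ℝ g z w) = stdForm _ v w := by
  let X : E → E := fun u => ContinuousLinearMap.inverse (β u) (fderiv ℝ h u)
  have hXβ (u) (hu : u ∈ O) : β u (X u) = fderiv ℝ h u := by
    obtain ⟨e, he⟩ := exists_continuousLinearEquiv_of_nondegenerate (β u) (hnd u hu)
    simp only [X, ← he, ContinuousLinearMap.inverse_equiv]
    simp
  have hX : ContDiffOn ℝ ∞ X O := fun u hu => by
    obtain ⟨e, he⟩ := exists_continuousLinearEquiv_of_nondegenerate (β u) (hnd u hu)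
    have h1 : ContDiffAt ℝ ∞ (fun u => ContinuousLinearMap.inverse (β u)) u :=
      ContDiffAt.comp (g := ContinuousLinearMap.inverse) u (he ▸ contDiffAt_map_inverse e) (hβ.contDiffAt (hO.mem_nhds hu))
    exact (h1.clm_apply ((hh.contDiffAt (hO.mem_nhds hu)).fderiv_right (m := ∞) (by simp))
      ).contDiffWithinAt
  have hX0 : X u₀ ≠ 0 := fun H => hh0 (by rw [← hXβ u₀ hu₀, H, map_zero])
  have hhX (u) (hu : u ∈ O) : fderiv ℝ h u (X u) = 0 := by rw [← hXβ u hu, halt u hu]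
  obtain ⟨g₁, hg₁, hg₁0, hg₁1, hg₁ev⟩ := exists_straightening hO hu₀ hh hh0 hX hX0 hhX
  obtain ⟨L, hLe, hL⟩ := exists_symplectic_coordinates hE (β u₀) (halt u₀ hu₀) (hnd u₀ hu₀) hX0
  let G : Phase (EuclideanSpace ℝ (Fin k)) → E := fun z => g₁ (L z)
  have hG : ContDiff ℝ ∞ G := hg₁.comp L.contDiff
  have hGd (z) : fderiv ℝ G z = (fderiv ℝ g₁ (L z)).comp (L : _ →L[ℝ] E) :=
    ((hg₁.differentiable (by simp) (L z)).hasFDerivAt.comp z L.hasFDerivAt).fderiv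
  have hGev : ∀ᶠ z in 𝓝 0, G z ∈ O ∧ h (G z) = h u₀ + z.2.1 ∧
      fderiv ℝ G z (flowDir _) = X (G z) := by
    have hLt : Filter.Tendsto L (𝓝 0) (𝓝 0) := by simpa using L.continuous.tendsto 0
    filter_upwards [hLt.eventually hg₁ev] with z hz
    refine ⟨hz.1, ?_, ?_⟩
    · rw [show h (G z) = _ from hz.2.1, ← hXβ u₀ hu₀, ← hLe, hL, stdForm_flowDir]
    · rw [hGd, ContinuousLinearMap.comp_apply, ContinuousLinearEquiv.coe_coe, hLe]
      exact hz.2.2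
  obtain ⟨r, hr, hball⟩ := Metric.eventually_nhds_iff_ball.1 hGev
  let β₁ : Phase (EuclideanSpace ℝ (Fin k)) → _ := fun z =>
    (β (G z)).bilinearComp (fderiv ℝ G z) (fderiv ℝ G z)
  have hβ₁ : ContDiffOn ℝ ∞ β₁ (Metric.ball 0 r) := by
    have h0 : ContDiffOn ℝ ∞ (fun z => β (G z)) (Metric.ball 0 r) :=
      hβ.comp hG.contDiffOn fun z hz => (hball z hz).1
    have h1 : ContDiffOn ℝ ∞ (fderiv ℝ G) (Metric.ball 0 r) :=
      (hG.fderiv_right (m := ∞) (by simp)).contDiffOn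
    exact h0.bilinearComp_fderiv h1
  have hG0 : G 0 = u₀ := by simp [G, hg₁0]
  -- After the straightening, the contraction of the pulled back form with `flowDir` is `dp₁`,
  -- exactly as for the standard form. Moser's map with `e = flowDir` therefore also keeps `p₁`.
  obtain ⟨g₂, hg₂, hg₂0, hg₂ev⟩ := exists_moser (stdForm _) (fun v => eq_zero_of_stdForm) hr hβ₁
    (fun z hz v => halt _ (hball z hz).1 _)
    (fun z hz => fderiv_pullback_twoForm_cyclic hG
      ((hβ.contDiffAt (hO.mem_nhds (hball z hz).1)).differentiableAt (by simp))
      (by filter_upwards [hO.mem_nhds (hball z hz).1] with y hy using halt y hy)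
      (hcl _ (hball z hz).1))
    (by
      refine ContinuousLinearMap.ext fun u => ContinuousLinearMap.ext fun v => ?_
      change β (G 0) (fderiv ℝ G 0 u) (fderiv ℝ G 0 v) = _
      rw [hGd, map_zero, hg₁1, hG0]
      exact hL u v)
    (flowDir _) (fun z hz => by
      refine ContinuousLinearMap.ext fun v => ?_
      change β (G z) (fderiv ℝ G z (flowDir _)) (fderiv ℝ G z v) = _
      obtain ⟨h1, h2, h3⟩ := hball z hz
      rw [h3, hXβ _ h1]
      have h4 : HasFDerivAt (fun z => h (G z)) ((fderiv ℝ h (G z)).comp (fderiv ℝ G z)) z :=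
        ((hh.contDiffAt (hO.mem_nhds h1)).differentiableAt (by simp)).hasFDerivAt.comp z
          (hG.differentiable (by simp) z).hasFDerivAt
      have h5 : HasFDerivAt (fun z => h (G z))
          (stdForm (EuclideanSpace ℝ (Fin k)) (flowDir _)) z := by
        refine ((stdForm (EuclideanSpace ℝ (Fin k))
          (flowDir _)).hasFDerivAt.const_add (h u₀)).congr_of_eventuallyEq ?_
        filter_upwards [Metric.isOpen_ball.mem_nhds hz] with y hy
        rw [(hball y hy).2.1, stdForm_flowDir]
      exact congrArg (fun T : _ →L[ℝ] ℝ => T v) (h4.unique h5))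
  refine ⟨fun z => G (g₂ z), hG.comp hg₂, by simp only [hg₂0, hG0], ?_⟩
  filter_upwards [hg₂ev] with z hz
  obtain ⟨h1, h2, h3⟩ := hz
  obtain ⟨k1, k2, k3⟩ := hball (g₂ z) (by simpa using h1)
  refine ⟨k1, ?_, fun v w => ?_⟩
  · rw [k2, ← stdForm_flowDir, h3, stdForm_flowDir]
  · have h4 : fderiv ℝ (fun z => G (g₂ z)) z = (fderiv ℝ G (g₂ z)).comp (fderiv ℝ g₂ z) :=
      ((hG.differentiable (by simp) (g₂ z)).hasFDerivAt.comp z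
        (hg₂.differentiable (by simp) z).hasFDerivAt).fderiv
    rw [h4]
    exact h2 v w

end LocalDarboux

/-! ### Generating functions of symplectic maps close to the identity -/

section GeneratingFunction

/-- A continuous family of functions with supports in a fixed compact set which vanishes at the
parameter zero is uniformly small for small parameters. -/
theorem exists_forall_norm_le_of_compact {X Y : Type*} [TopologicalSpace X]
    [NormedAddCommGroup Y] {f : ℝ × X → Y} (hf : Continuous f) (hf0 : ∀ x, f (0, x) = 0)
    {C : Set X} (hC : IsCompact C) (hfC : ∀ s, ∀ x ∉ C, f (s, x) = 0) {ε : ℝ} (hε : 0 < ε) :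
    ∃ δ > 0, ∀ s, |s| ≤ δ → ∀ x, ‖f (s, x)‖ ≤ ε := by
  have h : ∀ᶠ s in 𝓝 (0 : ℝ), ∀ x ∈ C, ‖f (s, x)‖ < ε := by
    refine hC.eventually_forall_of_forall_eventually (P := fun s x => ‖f (s, x)‖ < ε) fun x _ => ?_
    exact hf.norm.continuousAt.eventually_lt continuousAt_const (by simpa [hf0] using hε)
  obtain ⟨δ, hδ, hδε⟩ := Metric.eventually_nhds_iff.1 h
  refine ⟨δ / 2, by positivity, fun s hs x => ?_⟩
  by_cases hx : x ∈ C
  · exact (hδε (by rw [Real.dist_0_eq_abs]; linarith) x hx).le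
  · simpa [hfC s x hx] using hε.le

/-- Polar coordinates present the set as an image of a ray times a sphere, and the sphere is
connected in dimension at least two. -/
theorem isPreconnected_norm_gt {E : Type*} [NormedAddCommGroup E] [NormedSpace ℝ E]
    (hE : 1 < Module.rank ℝ E) {ρ : ℝ} (hρ : 0 < ρ) : IsPreconnected {x : E | ρ < ‖x‖} := by
  have h1 : IsPreconnected (Ioi ρ ×ˢ Metric.sphere (0 : E) 1) :=
    isPreconnected_Ioi.prod (isPreconnected_sphere hE 0 1)
  have h2 := h1.image (fun q : ℝ × E => q.1 • q.2) (by fun_prop)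
  convert h2 using 1
  ext x
  simp only [mem_ofPred_eq, mem_image, mem_prod, mem_Ioi, mem_sphere_zero_iff_norm, Prod.exists]
  constructor
  · intro hx
    have : ‖x‖ ≠ 0 := by linarith
    exact ⟨‖x‖, ‖x‖⁻¹ • x, ⟨hx, by simp [norm_smul, this]⟩, by simp [smul_smul, this]⟩
  · rintro ⟨a, b, ⟨ha, hb⟩, rfl⟩
    rw [norm_smul, hb, mul_one, Real.norm_of_nonneg (by linarith)]
    exact ha

/-- A primitive of a closed one-form, given by integration along segments. -/
theorem fderiv_segment_integral {Z : Type} [NormedAddCommGroup Z] [NormedSpace ℝ Z]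
    {θ : Z → Z →L[ℝ] ℝ} (hθ : ContDiff ℝ ∞ θ) (hcl : ∀ z u v, fderiv ℝ θ z u v = fderiv ℝ θ z v u)
    (z₀ z : Z) :
    fderiv ℝ (fun z => ∫ t in (0 : ℝ)..1, θ (z₀ + t • (z - z₀)) (z - z₀)) z = θ z := by
  have hf : ContDiff ℝ ∞ fun q : ℝ × Z => θ (z₀ + q.1 • (q.2 - z₀)) (q.2 - z₀) := by
    refine ContDiff.clm_apply (hθ.comp ?_) (contDiff_snd.sub contDiff_const)
    exact contDiff_const.add (contDiff_fst.smul (contDiff_snd.sub contDiff_const))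
  have hθd : Differentiable ℝ θ := hθ.differentiable (by simp)
  have hder (t : ℝ) (v : Z) : fderiv ℝ (fun z => θ (z₀ + t • (z - z₀)) (z - z₀)) z v =
      θ (z₀ + t • (z - z₀)) v + t * fderiv ℝ θ (z₀ + t • (z - z₀)) (z - z₀) v := by
    have h3 : HasFDerivAt (fun z => z₀ + t • (z - z₀)) (t • .id ℝ Z) z := by
      have h0 : HasFDerivAt (fun z => z - z₀) (.id ℝ Z) z := (hasFDerivAt_id z).sub_const z₀
      exact (h0.const_smul t).const_add z₀
    have h4 : HasFDerivAt (fun z => θ (z₀ + t • (z - z₀)) (z - z₀)) _ z :=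
      (HasFDerivAt.comp (g := θ) z (hθd _).hasFDerivAt h3).clm_apply
        ((hasFDerivAt_id z).sub_const z₀)
    rw [h4.fderiv, hcl _ (z - z₀) v, map_sub]
    simp [mul_sub]
  ext v
  rw [(contDiff_hasFDerivAt_integral hf).2]
  simp only [hder]
  have hc : Continuous fun t : ℝ => θ (z₀ + t • (z - z₀)) v +
      t * fderiv ℝ θ (z₀ + t • (z - z₀)) (z - z₀) v := by
    have h1 : Continuous fun t : ℝ => z₀ + t • (z - z₀) := by fun_prop
    exact ((hθ.continuous.comp h1).clm_apply continuous_const).add (continuous_id.mul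
      ((((hθ.continuous_fderiv (by simp)).comp h1).clm_apply continuous_const).clm_apply
        continuous_const))
  have h := intervalIntegral.integral_eq_sub_of_hasDerivAt (a := 0) (b := 1)
    (f := fun t : ℝ => t * θ (z₀ + t • (z - z₀)) v) (fun t _ => ?_)
    (hc.intervalIntegrable _ _)
  · rw [h]
    simp
  · have h1 : HasDerivAt (fun t : ℝ => z₀ + t • (z - z₀)) (z - z₀) t := by
      simpa using ((hasDerivAt_id t).smul_const (z - z₀)).const_add z₀
    have h2 : HasDerivAt (fun t : ℝ => θ (z₀ + t • (z - z₀)) v)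
        (fderiv ℝ θ (z₀ + t • (z - z₀)) (z - z₀) v) t := by
      simpa using ((hθd _).hasFDerivAt.comp_hasDerivAt t h1).clm_apply (hasDerivAt_const t v)
    exact ((hasDerivAt_id t).mul h2).congr_deriv (by simp)

/-- The partial derivatives of a family of functions with supports in a fixed closed set
vanishing at the parameter zero form a family of the same kind. -/
theorem partial_fderiv_family {X Y : Type*} [NormedAddCommGroup X] [NormedSpace ℝ X]
    [NormedAddCommGroup Y] [NormedSpace ℝ Y] {f : ℝ × X → Y} (hf : ContDiff ℝ ∞ f)
    (hf0 : ∀ x, f (0, x) = 0) {C : Set X} (hC : IsClosed C) (hfC : ∀ s, ∀ x ∉ C, f (s, x) = 0) :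
    ContDiff ℝ ∞ (fun q : ℝ × X => fderiv ℝ (fun x => f (q.1, x)) q.2) ∧
      (∀ x, fderiv ℝ (fun x => f (0, x)) x = 0) ∧
      ∀ s, ∀ x ∉ C, fderiv ℝ (fun x => f (s, x)) x = 0 := by
  refine ⟨?_, fun x => ?_, fun s x hx => ?_⟩
  · have h (q : ℝ × X) : fderiv ℝ (fun x => f (q.1, x)) q.2 =
        (fderiv ℝ f q).comp (.inr ℝ ℝ X) :=
      (fderiv_partial (hf.differentiable (by simp) q)).fderiv
    simp only [h]
    exact (hf.fderiv_right (m := ∞) (by simp)).clm_comp contDiff_const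
  · simp [hf0]
  · have h : (fun x => f (s, x)) =ᶠ[𝓝 x] fun _ => 0 := by
      filter_upwards [hC.isOpen_compl.mem_nhds hx] with y hy using hfC s y hy
    rw [h.fderiv_eq]
    simp

variable (F : Type) [NormedAddCommGroup F] [InnerProductSpace ℝ F]

/-- The symplectic form `dq ∧ dp` on `F × F`. -/
noncomputable def areaForm : F × F →L[ℝ] F × F →L[ℝ] ℝ :=
  ((innerSL ℝ (E := F)).bilinearComp (.fst ℝ _ _) (.snd ℝ _ _)) -
    ((innerSL ℝ (E := F)).bilinearComp (.snd ℝ _ _) (.fst ℝ _ _))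

variable {F}

theorem areaForm_apply (u v : F × F) :
    areaForm F u v = inner ℝ u.1 v.2 - inner ℝ u.2 v.1 := rfl

/-- The one-form generated by a symplectic map `z ↦ z + g z`, in the coordinates `w` with
`n w + (0, (g (n w)).2) = w`, is closed. -/
theorem fderiv_areaForm_symm {g n : F × F → F × F} {w : F × F} (hg : DifferentiableAt ℝ g (n w))
    (hn : DifferentiableAt ℝ n w) (hng : ∀ w, n w + (0, (g (n w)).2) = w)
    (hsymp : ∀ u v, areaForm F (u + fderiv ℝ g (n w) u) (v + fderiv ℝ g (n w) v) = areaForm F u v)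
    (u v : F × F) :
    fderiv ℝ (fun w => areaForm F (g (n w))) w u v =
      fderiv ℝ (fun w => areaForm F (g (n w))) w v u := by
  have hgn : HasFDerivAt (fun w => g (n w)) ((fderiv ℝ g (n w)).comp (fderiv ℝ n w)) w :=
    hg.hasFDerivAt.comp w hn.hasFDerivAt
  have h1 : HasFDerivAt (fun w => areaForm F (g (n w))) _ w :=
    (areaForm F).hasFDerivAt.comp w hgn
  have h2 : HasFDerivAt (fun w => n w + (ContinuousLinearMap.inr ℝ F F).comp
      (ContinuousLinearMap.snd ℝ F F) (g (n w))) _ w :=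
    hn.hasFDerivAt.add (((ContinuousLinearMap.inr ℝ F F).comp
      (ContinuousLinearMap.snd ℝ F F)).hasFDerivAt.comp w hgn)
  have h3 : HasFDerivAt (fun w => n w + (ContinuousLinearMap.inr ℝ F F).comp
      (ContinuousLinearMap.snd ℝ F F) (g (n w))) (.id ℝ (F × F)) w :=
    (hasFDerivAt_id w).congr_of_eventuallyEq (Filter.Eventually.of_forall hng)
  have key (u : F × F) : fderiv ℝ n w u + (0, (fderiv ℝ g (n w) (fderiv ℝ n w u)).2) = u := by
    have := congrArg (fun T : F × F →L[ℝ] F × F => T u) (h2.unique h3)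
    simpa using this
  rw [h1.fderiv]
  have hs := hsymp (fderiv ℝ n w u) (fderiv ℝ n w v)
  have hu := key u
  have hv := key v
  simp only [ContinuousLinearMap.comp_apply]
  generalize fderiv ℝ n w u = A at *
  generalize fderiv ℝ n w v = B at *
  generalize fderiv ℝ g (n w) A = C at *
  generalize fderiv ℝ g (n w) B = D at *
  subst hu hv
  simp only [areaForm_apply, Prod.fst_add, Prod.snd_add, inner_add_left, inner_add_right,
    add_zero] at hs ⊢
  rw [real_inner_comm A.1 D.2, real_inner_comm A.2 D.1, real_inner_comm C.2 D.1]
  linear_combination hs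

variable [FiniteDimensional ℝ F]

/-- A generating function for a family of symplectic maps `id + G` which are close to the identity
and have compact supports. -/
theorem exists_generating_function [Nontrivial F] {ρ : ℝ} (hρ : 0 < ρ)
    {G : ℝ × (ℝ × (F × F)) → F × F} (hG : ContDiff ℝ ∞ G) (hG0 : ∀ x, G (0, x) = 0)
    (hGρ : ∀ s x, ρ < ‖x‖ → G (s, x) = 0) :
    ∃ δ > 0, ∃ S : ℝ × (ℝ × (F × F)) → ℝ, ContDiff ℝ ∞ S ∧ (∀ x, S (0, x) = 0) ∧
      (∀ s x, 2 * ρ < ‖x‖ → S (s, x) = 0) ∧ ∀ s, |s| ≤ δ →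
      (∀ h z u v, areaForm F (u + fderiv ℝ (fun z => G (s, (h, z))) z u)
        (v + fderiv ℝ (fun z => G (s, (h, z))) z v) = areaForm F u v) →
      (∀ x, ρ < ‖x‖ → S (s, x) = 0) ∧ ∀ h z, fderiv ℝ (fun z => S (s, (h, z)))
        (z + (0, (G (s, (h, z))).2)) = areaForm F (G (s, (h, z))) := by
  have hC : IsCompact (Metric.closedBall (0 : ℝ × (F × F)) ρ) := isCompact_closedBall _ _
  have hGC (s) (x) (hx : x ∉ Metric.closedBall (0 : ℝ × (F × F)) ρ) : G (s, x) = 0 :=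
    hGρ s x (by simpa using hx)
  obtain ⟨k1, k2, k3⟩ := partial_fderiv_family hG hG0 hC.isClosed hGC
  obtain ⟨δ, hδ, hδG⟩ := exists_forall_norm_le_of_compact (f := fun q : ℝ × (ℝ × (F × F)) =>
    fderiv ℝ (fun x => G (q.1, x)) q.2) k1.continuous k2 hC k3 (ε := 1 / 2) (by norm_num)
  have hGd : Differentiable ℝ G := hG.differentiable (by simp)
  have hGz (s h z) : HasFDerivAt (fun z => G (s, (h, z)))
      ((fderiv ℝ (fun x => G (s, x)) (h, z)).comp (.inr ℝ ℝ (F × F))) z := by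
    have h1 : DifferentiableAt ℝ (fun x => G (s, x)) (h, z) :=
      (fderiv_partial (hGd (s, (h, z)))).differentiableAt
    exact fderiv_partial (Y := fun x => G (s, x)) h1
  -- With the clipped parameter the bound on the derivative of `G` holds for all `s`, so the mixed
  -- coordinates given by `N` exist for all `s`; for `|s| ≤ δ / 2` nothing is altered.
  obtain ⟨κ, hκ, hκ1, hκ2⟩ := exists_contDiff_clip (r := δ / 2) (by positivity)
  have hκ0 : κ 0 = 0 := hκ1 0 (by rw [abs_zero]; positivity)
  obtain ⟨N, hN, hN1, hN2⟩ := exists_contDiff_inverse (P := ℝ × ℝ) (X := F × F)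
    (g := fun q => (0, (G (κ q.1.1, (q.1.2, q.2))).2)) (by fun_prop) fun p z => by
      have h1 : HasFDerivAt (fun z : F × F => ((0 : F), (G (κ p.1, (p.2, z))).2))
          (((ContinuousLinearMap.inr ℝ F F).comp (ContinuousLinearMap.snd ℝ F F)).comp
          ((fderiv ℝ (fun x => G (κ p.1, x)) (p.2, z)).comp (.inr ℝ ℝ (F × F)))) z :=
        ((ContinuousLinearMap.inr ℝ F F).comp
          (ContinuousLinearMap.snd ℝ F F)).hasFDerivAt.comp z (hGz (κ p.1) p.2 z)
      rw [h1.fderiv]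
      refine ContinuousLinearMap.opNorm_le_bound _ (by norm_num) fun v => ?_
      have h2 := (fderiv ℝ (fun x => G (κ p.1, x)) (p.2, z)).le_of_opNorm_le
        (hδG (κ p.1) ((hκ2 _).trans (by linarith)) (p.2, z)) (0, v)
      simp at h2 ⊢
      exact (norm_snd_le _).trans h2
  -- On each slice this is the differential that `S` should have. It is closed for those small `s`
  -- for which the map is symplectic; for other `s` the function `S₀` is merely smooth.
  let θ : ℝ × (ℝ × (F × F)) → F × F →L[ℝ] ℝ := fun q =>
    areaForm F (G (κ q.1, (q.2.1, N ((q.1, q.2.1), q.2.2))))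
  have hθ : ContDiff ℝ ∞ θ := by
    refine (areaForm F).contDiff.comp (hG.comp ?_)
    fun_prop
  obtain ⟨z₀, hz₀⟩ : ∃ z₀ : F × F, ρ < ‖z₀‖ := by
    obtain ⟨z₀, hz₀⟩ := NormedSpace.exists_lt_norm ℝ (F × F) ρ
    exact ⟨z₀, hz₀⟩
  let S₀ : ℝ × (ℝ × (F × F)) → ℝ := fun q =>
    ∫ t in (0 : ℝ)..1, θ (q.1, (q.2.1, z₀ + t • (q.2.2 - z₀))) (q.2.2 - z₀)
  have hS₀ : ContDiff ℝ ∞ S₀ := by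
    refine (contDiff_hasFDerivAt_integral (f := fun q : ℝ × (ℝ × (ℝ × (F × F))) =>
      θ (q.2.1, (q.2.2.1, z₀ + q.1 • (q.2.2.2 - z₀))) (q.2.2.2 - z₀)) ?_).1
    refine ContDiff.clm_apply (hθ.comp ?_) ?_ <;> fun_prop
  -- The bump forces a support bound for every `s`, symplectic or not. For symplectic small `s` it
  -- equals `1` wherever `S₀` is nonzero.
  let b : ContDiffBump (0 : ℝ × (F × F)) := ⟨ρ, 2 * ρ, hρ, by linarith⟩
  have hb : ContDiff ℝ ∞ b := b.contDiff
  refine ⟨δ / 2, by positivity, fun q => b q.2 * S₀ q, (hb.comp contDiff_snd).mul hS₀, fun x => ?_,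
    fun s x hx => ?_, fun s hs hsymp => ?_⟩
  · simp [S₀, θ, hκ0, hG0]
  · simp [b.zero_of_le_dist (x := x) (by simpa using hx.le)]
  have hκs := hκ1 s hs
  have hθ0 (x : ℝ × (F × F)) (hx : ρ < ‖x‖) : θ (s, x) = 0 := by
    have h1 : N ((s, x.1), x.2) = x.2 := by
      have := hN1 (s, x.1) x.2
      simpa [hGρ _ x hx, Prod.mk_zero_zero] using this
    simp [θ, h1, hGρ _ x hx]
  have hder (h : ℝ) (w : F × F) : fderiv ℝ (fun z => S₀ (s, (h, z))) w = θ (s, (h, w)) := by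
    refine fderiv_segment_integral (θ := fun w => θ (s, (h, w)))
      (hθ.comp (by fun_prop)) (fun w u v => ?_) z₀ w
    have h1 : ContDiff ℝ ∞ fun w => N ((s, h), w) := hN.comp (by fun_prop)
    simp only [θ, hκs]
    refine fderiv_areaForm_symm (g := fun z => G (s, (h, z))) (n := fun w => N ((s, h), w))
      (hGz s h _).differentiableAt (h1.differentiable (by simp) w) (fun w => ?_)
      (hsymp h _) u v
    have := hN2 (s, h) w
    simpa [hκs] using this
  have hS₀0 (x : ℝ × (F × F)) (hx : ρ < ‖x‖) : S₀ (s, x) = 0 := by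
    obtain ⟨h, z⟩ := x
    rcases lt_or_ge ρ |h| with hh | hh
    · have (z : F × F) : θ (s, (h, z)) = 0 := hθ0 _ (hh.trans_le (by
        simpa using norm_fst_le (h, z)))
      simp [S₀, this]
    · have hzn (z : F × F) (hz : ρ < ‖z‖) : ρ < ‖(h, z)‖ := hz.trans_le (norm_snd_le (h, z))
      have hz : ρ < ‖z‖ := by
        rw [Prod.norm_def] at hx
        exact (lt_max_iff.1 hx).resolve_left (by simpa using hh)
      have hrank : 1 < Module.rank ℝ (F × F) := by
        have h1 : 0 < Module.finrank ℝ F := Module.finrank_pos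
        rw [← Module.finrank_eq_rank, Module.finrank_prod]
        exact_mod_cast (by omega)
      have hopen : IsOpen {z : F × F | ρ < ‖z‖} := isOpen_lt continuous_const continuous_norm
      -- The differential vanishes on the connected exterior of the ball, which contains the base
      -- point `z₀`, where `S₀` is zero.
      have hconst := hopen.is_const_of_fderiv_eq_zero (𝕜 := ℝ)
        (f := fun z => S₀ (s, (h, z))) (isPreconnected_norm_gt hrank hρ)
        ((hS₀.comp (by fun_prop)).differentiable (by simp)).differentiableOn
        (fun z hz => by
          change fderiv ℝ (fun z => S₀ (s, (h, z))) z = 0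
          rw [hder, hθ0 _ (hzn z hz)])
        hz hz₀
      rw [hconst]
      simp [S₀]
  have hS (x) : b x * S₀ (s, x) = S₀ (s, x) := by
    rcases lt_or_ge ρ ‖x‖ with hx | hx
    · rw [hS₀0 x hx, mul_zero]
    · rw [b.one_of_mem_closedBall (by simpa using hx), one_mul]
  simp only [hS]
  refine ⟨hS₀0, fun h z => ?_⟩
  have h1 := hN1 (s, h) z
  simp only [hκs] at h1
  rw [hder]
  simp only [θ, hκs, h1]

end GeneratingFunction

/-! ### Symplectic maps generated by functions -/

section GeneratedMap

theorem ContDiff.partial_fderiv {X Y : Type*} [NormedAddCommGroup X] [NormedSpace ℝ X]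
    [NormedAddCommGroup Y] [NormedSpace ℝ Y] {f : ℝ × X → Y} (hf : ContDiff ℝ ∞ f) :
    ContDiff ℝ ∞ (fun q : ℝ × X => fderiv ℝ (fun x => f (q.1, x)) q.2) := by
  have h (q : ℝ × X) : fderiv ℝ (fun x => f (q.1, x)) q.2 =
      (fderiv ℝ f q).comp (.inr ℝ ℝ X) :=
    (fderiv_partial (hf.differentiable (by simp) q)).fderiv
  simp only [h]
  exact (hf.fderiv_right (m := ∞) (by simp)).clm_comp contDiff_const

variable (F : Type) [NormedAddCommGroup F] [InnerProductSpace ℝ F] [FiniteDimensional ℝ F]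

/-- The vector representing a linear form with respect to the pairing. -/
noncomputable def posGrad : (Pos F →L[ℝ] ℝ) →L[ℝ] Pos F :=
  ((exists_continuousLinearEquiv_of_nondegenerate (pairing F)
    fun _ h => eq_zero_of_pairing h).choose.symm : (Pos F →L[ℝ] ℝ) →L[ℝ] Pos F)

/-- The gradient in the positions, as a vector of momenta. -/
noncomputable def gradQ : (Phase F →L[ℝ] ℝ) →L[ℝ] Phase F :=
  (ContinuousLinearMap.inr ℝ (Pos F) (Pos F)).comp ((posGrad F).comp
    (ContinuousLinearMap.precomp ℝ (ContinuousLinearMap.inl ℝ (Pos F) (Pos F))))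

/-- The gradient in the momenta, as a vector of positions. -/
noncomputable def gradP : (Phase F →L[ℝ] ℝ) →L[ℝ] Phase F :=
  (ContinuousLinearMap.inl ℝ (Pos F) (Pos F)).comp ((posGrad F).comp
    (ContinuousLinearMap.precomp ℝ (ContinuousLinearMap.inr ℝ (Pos F) (Pos F))))

variable {F}

theorem pairing_posGrad (l : Pos F →L[ℝ] ℝ) (b : Pos F) : pairing F (posGrad F l) b = l b := by
  have h := (exists_continuousLinearEquiv_of_nondegenerate (pairing F)
    fun _ h => eq_zero_of_pairing h).choose_spec
  conv_lhs => enter [1, 1]; rw [← h]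
  simp [posGrad]

theorem gradQ_fst (l : Phase F →L[ℝ] ℝ) : (gradQ F l).1 = 0 := rfl

theorem gradP_snd (l : Phase F →L[ℝ] ℝ) : (gradP F l).2 = 0 := rfl

theorem pairing_gradQ (l : Phase F →L[ℝ] ℝ) (b : Pos F) :
    pairing F (gradQ F l).2 b = l (b, 0) :=
  pairing_posGrad _ b

theorem pairing_gradP (l : Phase F →L[ℝ] ℝ) (b : Pos F) :
    pairing F (gradP F l).1 b = l (0, b) :=
  pairing_posGrad _ b

omit [FiniteDimensional ℝ F] in
theorem pairing_left_injective {a a' : Pos F} (h : ∀ b, pairing F a b = pairing F a' b) :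
    a = a' :=
  sub_eq_zero.1 (eq_zero_of_pairing fun b => by rw [map_sub, sub_apply, h, sub_self])

/-- The symplectic map generated by a function with small second derivatives. -/
theorem exists_generated_symplectic_map : ∃ ε > 0, ∀ T : ℝ × Phase F → ℝ, ContDiff ℝ ∞ T →
    (∀ s z, ‖fderiv ℝ (fun z => fderiv ℝ (fun z => T (s, z)) z) z‖ ≤ ε) →
    ∃ Φ A B : ℝ × Phase F → Phase F, ContDiff ℝ ∞ Φ ∧ ContDiff ℝ ∞ B ∧
      (∀ s z, Φ (s, z + gradQ F (fderiv ℝ (fun z => T (s, z)) z)) =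
        z + gradP F (fderiv ℝ (fun z => T (s, z)) z)) ∧
      (∀ s w, A (s, w) + gradQ F (fderiv ℝ (fun z => T (s, z)) (A (s, w))) = w) ∧
      (∀ s w, B (s, w) + gradP F (fderiv ℝ (fun z => T (s, z)) (B (s, w))) = w) ∧
      (∀ s z, B (s, z + gradP F (fderiv ℝ (fun z => T (s, z)) z)) = z) ∧
      (∀ s w u v, stdForm F (fderiv ℝ (fun w => Φ (s, w)) w u)
        (fderiv ℝ (fun w => Φ (s, w)) w v) = stdForm F u v) ∧
      ∀ s w, Function.Surjective (fderiv ℝ (fun w => Φ (s, w)) w) := by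
  -- The bound `1 / (2 C)` on second derivatives makes both `id + gradQ dT` and `id + gradP dT`
  -- perturbations of the identity with derivative at most `1/2`, whatever `T` is.
  set C := ‖gradQ F‖ + ‖gradP F‖ + 1 with hC
  have hC0 : 0 < C := by positivity
  refine ⟨1 / (2 * C), by positivity, fun T hT hTε => ?_⟩
  have hdT : ContDiff ℝ ∞ fun q : ℝ × Phase F => fderiv ℝ (fun z => T (q.1, z)) q.2 :=
    hT.partial_fderiv
  have hdTs (s : ℝ) : ContDiff ℝ ∞ fun z => fderiv ℝ (fun z => T (s, z)) z :=
    hdT.comp (contDiff_const.prodMk contDiff_id)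
  have hd (Λ : (Phase F →L[ℝ] ℝ) →L[ℝ] Phase F) (s : ℝ) (z : Phase F) :
      HasFDerivAt (fun z => Λ (fderiv ℝ (fun z => T (s, z)) z))
        (Λ.comp (fderiv ℝ (fun z => fderiv ℝ (fun z => T (s, z)) z) z)) z :=
    Λ.hasFDerivAt.comp z ((hdTs s).differentiable (by simp) z).hasFDerivAt
  have hbound (Λ : (Phase F →L[ℝ] ℝ) →L[ℝ] Phase F) (hΛ : ‖Λ‖ ≤ C) (s : ℝ) (z : Phase F) :
      ‖fderiv ℝ (fun z => Λ (fderiv ℝ (fun z => T (s, z)) z)) z‖ ≤ 1 / 2 := by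
    rw [(hd Λ s z).fderiv]
    refine (ContinuousLinearMap.opNorm_comp_le _ _).trans ?_
    calc ‖Λ‖ * _ ≤ C * (1 / (2 * C)) := by gcongr; exact hTε s z
      _ = 1 / 2 := by field_simp
  obtain ⟨A, hA, hA1, hA2⟩ := exists_contDiff_inverse
    (g := fun q : ℝ × Phase F => gradQ F (fderiv ℝ (fun z => T (q.1, z)) q.2))
    ((gradQ F).contDiff.comp hdT)
    (hbound _ (by rw [hC]; linarith [norm_nonneg (gradP F)]))
  obtain ⟨B, hB, hB1, hB2⟩ := exists_contDiff_inverse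
    (g := fun q : ℝ × Phase F => gradP F (fderiv ℝ (fun z => T (q.1, z)) q.2))
    ((gradP F).contDiff.comp hdT)
    (hbound _ (by rw [hC]; linarith [norm_nonneg (gradQ F)]))
  -- A generating function of mixed type: `(q, p + ∂T/∂q)` goes to `(q + ∂T/∂p, p)`, with the
  -- derivatives taken at `(q, p)`, old positions with new momenta. The symmetry of the second
  -- derivative of `T` makes this symplectic.
  let Φ : ℝ × Phase F → Phase F := fun q =>
    A q + gradP F (fderiv ℝ (fun z => T (q.1, z)) (A q))
  have hΦ : ContDiff ℝ ∞ Φ :=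
    hA.add ((gradP F).contDiff.comp (hdT.comp (contDiff_fst.prodMk hA)))
  have hAs (s : ℝ) (w : Phase F) : HasFDerivAt (fun w => A (s, w))
      (fderiv ℝ (fun w => A (s, w)) w) w :=
    (fderiv_partial (hA.differentiable (by simp) (s, w))).differentiableAt.hasFDerivAt
  have hsymp (s : ℝ) (w u v : Phase F) : stdForm F (fderiv ℝ (fun w => Φ (s, w)) w u)
      (fderiv ℝ (fun w => Φ (s, w)) w v) = stdForm F u v := by
    have hAΛ (Λ : (Phase F →L[ℝ] ℝ) →L[ℝ] Phase F) := (hAs s w).add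
      (HasFDerivAt.comp (g := fun z => Λ (fderiv ℝ (fun z => T (s, z)) z)) w
        (hd Λ s (A (s, w))) (hAs s w))
    have h1 : HasFDerivAt (fun w => Φ (s, w)) _ w := hAΛ (gradP F)
    have h2 : HasFDerivAt (fun w : Phase F => w) _ w :=
      (hAΛ (gradQ F)).congr_of_eventuallyEq
        (Filter.Eventually.of_forall fun w => (hA2 s w).symm)
    have h3 := h2.unique (hasFDerivAt_id w)
    have hu := congrArg (fun T : Phase F →L[ℝ] Phase F => T u) h3
    have hv := congrArg (fun T : Phase F →L[ℝ] Phase F => T v) h3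
    have hTs : ContDiff ℝ ∞ fun z => T (s, z) := hT.comp (contDiff_const.prodMk contDiff_id)
    have hsym := (hTs.contDiffAt (x := A (s, w))).isSymmSndFDerivAt (by
      simpa using (show ((2 : ℕ∞) : WithTop ℕ∞) ≤ ∞ from WithTop.coe_le_coe.2 le_top))
    have hsymm : ∀ a b, fderiv ℝ (fun z => fderiv ℝ (fun z => T (s, z)) z) (A (s, w)) a b =
      fderiv ℝ (fun z => fderiv ℝ (fun z => T (s, z)) z) (A (s, w)) b a := fun a b => hsym.eq a b
    rw [h1.fderiv]
    simp only [add_apply, ContinuousLinearMap.comp_apply, ContinuousLinearMap.id_apply] at hu hv ⊢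
    generalize fderiv ℝ (fun z => fderiv ℝ (fun z => T (s, z)) z) (A (s, w)) = Q at *
    generalize fderiv ℝ (fun w => A (s, w)) w u = a at *
    generalize fderiv ℝ (fun w => A (s, w)) w v = b at *
    subst hu hv
    have hQP (l : Phase F →L[ℝ] ℝ) (c : Phase F) : stdForm F (gradP F l) c = l (0, c.2) := by
      rw [stdForm_apply, gradP_snd, pairing_gradP]; simp
    have hQQ (l : Phase F →L[ℝ] ℝ) (c : Phase F) : stdForm F (gradQ F l) c = -l (c.1, 0) := by
      rw [stdForm_apply, gradQ_fst, pairing_gradQ]; simp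
    have hsk (c d : Phase F) : stdForm F c d = -stdForm F d c := by
      rw [stdForm_apply, stdForm_apply, pairing_comm c.1, pairing_comm c.2]; ring
    simp only [map_add, add_apply]
    rw [hsk a (gradP F _), hsk a (gradQ F _)]
    simp only [hQP, hQQ, gradP_snd, gradQ_fst, Prod.mk_zero_zero, map_zero]
    have e1 : Q a b = Q a (b.1, 0) + Q a (0, b.2) := by rw [← map_add]; simp
    have e2 : Q b a = Q b (a.1, 0) + Q b (0, a.2) := by rw [← map_add]; simp
    linarith [hsymm a b]
  refine ⟨Φ, A, B, hΦ, hB, fun s z => ?_, hA2, hB2, hB1, hsymp, fun s w => ?_⟩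
  · simp only [Φ, hA1]
  · refine LinearMap.injective_iff_surjective.1
      ((injective_iff_map_eq_zero (fderiv ℝ (fun w => Φ (s, w)) w)).2 fun u hu => ?_)
    refine eq_zero_of_stdForm fun v => ?_
    rw [← hsymp s w, hu, map_zero, zero_apply]

end GeneratedMap

/-! ### The Hamiltonian perturbation in the model box -/

section Perturbation

/-- A cutoff function `χ`, with `ν = χ'` on `(-∞, 2 a)`. -/
theorem exists_step {a : ℝ} (ha : 0 < a) : ∃ χ ν : ℝ → ℝ, ContDiff ℝ ∞ χ ∧ ContDiff ℝ ∞ ν ∧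
    (∀ t ≤ -(a / 4), χ t = 0) ∧ (∀ t, a / 4 ≤ t → t ≤ 2 * a → χ t = 1) ∧
    (∀ t, 3 * a ≤ t → χ t = 0) ∧ (∀ t, a / 4 < |t| → ν t = 0) ∧
    ∀ t < 2 * a, deriv χ t = ν t := by
  let χ₁ : ℝ → ℝ := fun t => Real.smoothTransition ((t + a / 4) * (2 / a))
  let b : ℝ → ℝ := fun t => Real.smoothTransition (3 - t / a)
  have hχ₁ : ContDiff ℝ ∞ χ₁ := Real.smoothTransition.contDiff.comp (by fun_prop)
  have hb : ContDiff ℝ ∞ b := Real.smoothTransition.contDiff.comp (by fun_prop)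
  have h0 (t : ℝ) (ht : t ≤ -(a / 4)) : χ₁ t = 0 :=
    Real.smoothTransition.zero_of_nonpos
      (mul_nonpos_of_nonpos_of_nonneg (by linarith) (by positivity))
  have h1 (t : ℝ) (ht : a / 4 ≤ t) : χ₁ t = 1 := by
    refine Real.smoothTransition.one_of_one_le ?_
    rw [mul_div_assoc', le_div_iff₀ ha]
    linarith
  have hb1 (t : ℝ) (ht : t ≤ 2 * a) : b t = 1 := by
    refine Real.smoothTransition.one_of_one_le ?_
    have : t / a ≤ 2 := by rw [div_le_iff₀ ha]; exact ht
    linarith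
  refine ⟨fun t => χ₁ t * b t, deriv χ₁, hχ₁.mul hb, ?_, fun t ht => by simp [h0 t ht],
    fun t ht ht' => by simp [h1 t ht, hb1 t ht'], fun t ht => ?_, fun t ht => ?_, fun t ht => ?_⟩
  · exact (contDiff_infty_iff_deriv.1 hχ₁).2
  · have : b t = 0 := by
      refine Real.smoothTransition.zero_of_nonpos ?_
      have : 3 ≤ t / a := by rw [le_div_iff₀ ha]; exact ht
      linarith
    simp [this]
  · rcases lt_abs.1 ht with h | h
    · have : χ₁ =ᶠ[𝓝 t] fun _ => 1 := by
        filter_upwards [lt_mem_nhds h] with s hs using h1 s hs.le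
      simp [this.deriv_eq]
    · have : χ₁ =ᶠ[𝓝 t] fun _ => 0 := by
        filter_upwards [gt_mem_nhds (show t < -(a / 4) by linarith)] with s hs using h0 s hs.le
      simp [this.deriv_eq]
  · refine Filter.EventuallyEq.deriv_eq ?_
    filter_upwards [gt_mem_nhds ht] with s hs
    simp [hb1 s hs.le]

variable (F : Type) [NormedAddCommGroup F] [InnerProductSpace ℝ F]

/-- The coordinates transverse to `flowDir`. -/
noncomputable def transversal : Phase F →L[ℝ] ℝ × (F × F) :=
  ((ContinuousLinearMap.fst ℝ ℝ F).comp (.snd ℝ (Pos F) (Pos F))).prod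
    (((ContinuousLinearMap.snd ℝ ℝ F).comp (.fst ℝ (Pos F) (Pos F))).prod
      ((ContinuousLinearMap.snd ℝ ℝ F).comp (.snd ℝ (Pos F) (Pos F))))

variable {F}

theorem transversal_apply (z : Phase F) : transversal F z = (z.2.1, (z.1.2, z.2.2)) := rfl

theorem norm_transversal_le (z : Phase F) : ‖transversal F z‖ ≤ ‖z‖ := by
  rw [transversal_apply]
  refine max_le ((norm_fst_le z.2).trans (norm_snd_le z)) (max_le ?_ ?_)
  · exact (norm_snd_le z.1).trans (norm_fst_le z)
  · exact (norm_snd_le z.2).trans (norm_snd_le z)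

theorem norm_le_of_transversal (z : Phase F) {r ρ : ℝ} (h1 : |z.1.1| ≤ r)
    (h2 : ‖transversal F z‖ ≤ ρ) : ‖z‖ ≤ max r ρ := by
  rw [transversal_apply] at h2
  have h3 := (norm_fst_le _).trans h2
  have h4 := (norm_snd_le _).trans h2
  have h5 := (norm_fst_le _).trans h4
  have h6 := (norm_snd_le _).trans h4
  exact max_le (max_le (h1.trans (le_max_left _ _)) (h5.trans (le_max_right _ _)))
    (max_le (h3.trans (le_max_right _ _)) (h6.trans (le_max_right _ _)))

variable [FiniteDimensional ℝ F]

/-- A perturbation of the Hamiltonian `p₁`, supported in the region `|q₁| ≤ a`, whose flow realizes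
the family of maps `id + G`, for those parameters for which they are symplectic. -/
theorem exists_hamiltonian_perturbation [Nontrivial F] {ρ a ε : ℝ} (hρ : 0 < ρ) (ha : 0 < a)
    (hε : 0 < ε) {G : ℝ × (ℝ × (F × F)) → F × F} (hG : ContDiff ℝ ∞ G) (hG0 : ∀ x, G (0, x) = 0)
    (hGρ : ∀ s x, ρ < ‖x‖ → G (s, x) = 0) :
    ∃ δ > 0, ∃ (D : ℝ × Phase F → ℝ) (c : ℝ × Phase F → Phase F), ContDiff ℝ ∞ D ∧
      ContDiff ℝ ∞ c ∧ (∀ z, D (0, z) = 0) ∧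
      (∀ s z, a < |z.1.1| ∨ 3 * ρ < ‖transversal F z‖ → D (s, z) = 0) ∧
      (∀ s z, ‖c (s, z) - z‖ ≤ ε) ∧ (∀ s z, z.1.1 < -(a / 4) → c (s, z) = z) ∧
      (∀ s z, z.1.1 < 2 * a → ∀ v, stdForm F (fderiv ℝ (fun z => c (s, z)) z (flowDir F)) v =
        v.2.1 + fderiv ℝ (fun z => D (s, z)) (c (s, z)) v) ∧
      ∀ s, |s| ≤ δ →
        (∀ h z u v, areaForm F (u + fderiv ℝ (fun z => G (s, (h, z))) z u)
          (v + fderiv ℝ (fun z => G (s, (h, z))) z v) = areaForm F u v) →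
        (∀ z, ρ < ‖transversal F z‖ → c (s, z) = z) ∧
        ∃ f : ℝ × (F × F) → ℝ, Continuous f ∧ (∀ x, |f x| ≤ ε) ∧ (∀ x, ρ < ‖x‖ → f x = 0) ∧
          ∀ z, a / 4 < z.1.1 → z.1.1 < 2 * a → c (s, z) =
            ((z.1.1 + f (transversal F z), z.1.2 + (G (s, transversal F z)).1),
              (z.2.1, z.2.2 + (G (s, transversal F z)).2)) := by
  obtain ⟨δ, hδ, S, hS, hS0, hSρ, hSG⟩ := exists_generating_function hρ hG hG0 hGρ
  obtain ⟨χ, ν, hχ, hν, hχ0, hχ1, hχ3, hν0, hχν⟩ := exists_step ha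
  obtain ⟨ε₀, hε₀, hgen⟩ := exists_generated_symplectic_map (F := F)
  -- The function is switched on around `q₁ = 0` and off again between `2 a` and `3 a`. The second
  -- switch only secures compact support; the region beyond `2 a` is never used.
  let T₀ : ℝ × Phase F → ℝ := fun q => χ q.2.1.1 * S (q.1, transversal F q.2)
  have hT₀ : ContDiff ℝ ∞ T₀ := by
    refine ContDiff.mul (hχ.comp (by fun_prop)) (hS.comp ?_)
    exact contDiff_fst.prodMk ((transversal F).contDiff.comp contDiff_snd)
  have hT₀0 (z) : T₀ (0, z) = 0 := by simp [T₀, hS0]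
  set C := Metric.closedBall (0 : Phase F) (max (3 * a) (2 * ρ)) with hCdef
  have hC : IsCompact C := isCompact_closedBall _ _
  have hT₀C (s : ℝ) (z) (hz : z ∉ C) : T₀ (s, z) = 0 := by
    by_contra H
    refine hz (by
      rw [hCdef, mem_closedBall_zero_iff]
      refine norm_le_of_transversal z ?_ ?_
      · rw [abs_le]
        constructor
        · by_contra! h
          exact H (by simp [T₀, hχ0 z.1.1 (by linarith)])
        · by_contra! h
          exact H (by simp [T₀, hχ3 z.1.1 h.le])
      · by_contra! h
        exact H (by simp [T₀, hSρ _ _ h]))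
  obtain ⟨k1, k2, k3⟩ := partial_fderiv_family hT₀ hT₀0 hC.isClosed hT₀C
  obtain ⟨l1, l2, l3⟩ := partial_fderiv_family (f := fun q : ℝ × Phase F =>
    fderiv ℝ (fun z => T₀ (q.1, z)) q.2) k1 k2 hC.isClosed k3
  set M := ‖gradQ F‖ + ‖gradP F‖ + 1 with hM
  have hM0 : 0 < M := by positivity
  -- Half of `ε`, because `Φ - id` is a difference of two gradient terms; `a / 4` and `ρ` limit how
  -- far the support of `D` is displaced.
  set ε₁ := min (ε / 2) (min (a / 4) ρ) with hε₁
  have hε₁0 : 0 < ε₁ := by positivity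
  obtain ⟨δ₁, hδ₁, hT₀1⟩ := exists_forall_norm_le_of_compact (f := fun q : ℝ × Phase F =>
    fderiv ℝ (fun z => T₀ (q.1, z)) q.2) k1.continuous k2 hC k3 (ε := ε₁ / M) (by positivity)
  obtain ⟨δ₂, hδ₂, hT₀2⟩ := exists_forall_norm_le_of_compact (f := fun q : ℝ × Phase F =>
    fderiv ℝ (fun z => fderiv ℝ (fun z => T₀ (q.1, z)) z) q.2) l1.continuous l2 hC l3 hε₀
  set δ₃ := min δ (min (δ₁ / 2) (δ₂ / 2)) with hδ₃
  have hδ₃0 : 0 < δ₃ := by positivity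
  have hδ₃1 : 2 * δ₃ ≤ δ₁ := by
    have : δ₃ ≤ δ₁ / 2 := (min_le_right _ _).trans (min_le_left _ _)
    linarith
  have hδ₃2 : 2 * δ₃ ≤ δ₂ := by
    have : δ₃ ≤ δ₂ / 2 := (min_le_right _ _).trans (min_le_right _ _)
    linarith
  obtain ⟨κ, hκ, hκ1, hκ2⟩ := exists_contDiff_clip hδ₃0
  have hκ0 : κ 0 = 0 := hκ1 0 (by rw [abs_zero]; positivity)
  let T : ℝ × Phase F → ℝ := fun q => T₀ (κ q.1, q.2)
  have hT : ContDiff ℝ ∞ T := hT₀.comp (by fun_prop)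
  obtain ⟨Φ, A, B, hΦ, hB, hΦA, hA, hB1, hB2, hsymp, hsurj⟩ := hgen T hT
    fun s z => hT₀2 (κ s) ((hκ2 s).trans hδ₃2) z
  have hdT (s z) : ‖fderiv ℝ (fun z => T (s, z)) z‖ ≤ ε₁ / M :=
    hT₀1 (κ s) ((hκ2 s).trans hδ₃1) z
  have hQ (s z) : ‖gradQ F (fderiv ℝ (fun z => T (s, z)) z)‖ ≤ ε₁ := by
    refine ((gradQ F).le_opNorm _).trans ?_
    calc ‖gradQ F‖ * _ ≤ M * (ε₁ / M) := by
          gcongr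
          · rw [hM]; linarith [norm_nonneg (gradP F)]
          · exact hdT s z
      _ = ε₁ := by field_simp
  have hP (s z) : ‖gradP F (fderiv ℝ (fun z => T (s, z)) z)‖ ≤ ε₁ := by
    refine ((gradP F).le_opNorm _).trans ?_
    calc ‖gradP F‖ * _ ≤ M * (ε₁ / M) := by
          gcongr
          · rw [hM]; linarith [norm_nonneg (gradQ F)]
          · exact hdT s z
      _ = ε₁ := by field_simp
  have hΦd (s z) : HasFDerivAt (fun z => Φ (s, z)) (fderiv ℝ (fun z => Φ (s, z)) z) z :=
    (fderiv_partial (hΦ.differentiable (by simp) (s, z))).differentiableAt.hasFDerivAt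
  -- The map `B` recovers from `Φ w` the mixed point at which `T` was differentiated, and `D` is
  -- `∂T/∂q₁` there. Using `ν` instead of `χ'` discards the contribution of the second switch.
  let D : ℝ × Phase F → ℝ := fun q => ν (B q).1.1 * S (κ q.1, transversal F (B q))
  have hD : ContDiff ℝ ∞ D := by
    refine ContDiff.mul (hν.comp (by fun_prop)) (hS.comp ?_)
    exact (hκ.comp contDiff_fst).prodMk ((transversal F).contDiff.comp hB)
  have hΦid (s z) (hz : fderiv ℝ (fun z => T (s, z)) z = 0) : Φ (s, z) = z := by
    simpa [hz] using hΦA s z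
  have hTzero (s z) (h : ∀ᶠ w in 𝓝 z, T (s, w) = 0) : fderiv ℝ (fun z => T (s, z)) z = 0 := by
    have : (fun z => T (s, z)) =ᶠ[𝓝 z] fun _ => 0 := h
    simp [this.fderiv_eq]
  have hcoord (z : Phase F) : |z.1.1| ≤ ‖z‖ := (norm_fst_le z.1).trans (norm_fst_le z)
  have hc11 : Continuous fun z : Phase F => z.1.1 := by fun_prop
  have hTe (s z) : fderiv ℝ (fun z => T (s, z)) z (flowDir F) =
      deriv χ z.1.1 * S (κ s, transversal F z) := by
    have h1 : HasDerivAt (fun t : ℝ => z + t • flowDir F) (flowDir F) 0 := by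
      simpa using ((hasDerivAt_id (0 : ℝ)).smul_const (flowDir F)).const_add z
    have h2 : HasFDerivAt (fun z => T (s, z)) (fderiv ℝ (fun z => T (s, z)) z)
        (z + (0 : ℝ) • flowDir F) := by
      rw [zero_smul, add_zero]
      exact (fderiv_partial (hT.differentiable (by simp) (s, z))).differentiableAt.hasFDerivAt
    have h3 := h2.comp_hasDerivAt (0 : ℝ) h1
    have h4 : HasDerivAt (fun t : ℝ => χ (z.1.1 + t)) (deriv χ z.1.1) 0 := by
      have : HasDerivAt χ (deriv χ z.1.1) (z.1.1 + 0) := by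
        rw [add_zero]
        exact (hχ.differentiable (by simp) _).hasDerivAt
      simpa using this.comp_const_add z.1.1 0
    refine h3.unique ((h4.mul_const (S (κ s, transversal F z))).congr_of_eventuallyEq
      (Filter.Eventually.of_forall fun t => ?_))
    simp [T, T₀, flowDir, transversal_apply]
  have hQ21 (l : Phase F →L[ℝ] ℝ) : (gradQ F l).2.1 = l (flowDir F) := by
    have := pairing_gradQ l (1, 0)
    rw [pairing_apply] at this
    simpa [flowDir] using this
  -- So `p₁ + D` is `p₁ ∘ Φ⁻¹` on the image of `q₁ < 2 a`. Since `Φ` is symplectic, it sends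
  -- coordinate lines to orbits of `p₁ + D`.
  have hK (s w) (hw : w.1.1 < 2 * a) : (Φ (s, w)).2.1 + D (s, Φ (s, w)) = w.2.1 := by
    have h1 := hA s w
    set z := A (s, w)
    have hz1 : z.1 = w.1 := by rw [← h1]; simp [gradQ_fst]
    have h2 := hΦA s z
    rw [h1] at h2
    have h3 : D (s, Φ (s, w)) = ν z.1.1 * S (κ s, transversal F z) := by
      simp only [D, h2, hB2]
    have h4 := hQ21 (fderiv ℝ (fun z => T (s, z)) z)
    rw [hTe, hχν _ (hz1 ▸ hw)] at h4
    rw [h3, h2, ← h4]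
    conv_rhs => rw [← h1]
    simp [gradP_snd]
  have hbd (s w) : ‖Φ (s, w) - w‖ ≤ ε := by
    have h1 := hA s w
    have h2 := hΦA s (A (s, w))
    rw [h1] at h2
    have h3 := hP s (A (s, w))
    have h4 := hQ s (A (s, w))
    have h5 : Φ (s, w) - w = gradP F (fderiv ℝ (fun z => T (s, z)) (A (s, w))) -
        gradQ F (fderiv ℝ (fun z => T (s, z)) (A (s, w))) := by
      rw [h2]
      nth_rw 3 [← h1]
      abel
    rw [h5]
    refine (norm_sub_le _ _).trans ?_
    have : ε₁ ≤ ε / 2 := min_le_left _ _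
    linarith
  refine ⟨δ₃, hδ₃0, D, Φ, hD, hΦ, fun z => by simp [D, hκ0, hS0], fun s z hz => ?_,
    hbd, fun s z hz => ?_, fun s w hw v => ?_, fun s hs hsympG => ?_⟩
  · by_contra H
    have h1 : |(B (s, z)).1.1| ≤ a / 4 := by
      by_contra! h
      exact H (by simp [D, hν0 _ h])
    have h2 : ‖transversal F (B (s, z))‖ ≤ 2 * ρ := by
      by_contra! h
      exact H (by simp [D, hSρ _ _ h])
    have h3 := hB1 s z
    have h4 := hP s (B (s, z))
    set p := gradP F (fderiv ℝ (fun z => T (s, z)) (B (s, z)))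
    have h5 := (hcoord p).trans (h4.trans ((min_le_right _ _).trans (min_le_left _ _)))
    have h6 := (norm_transversal_le p).trans (h4.trans ((min_le_right _ _).trans (min_le_right _ _)))
    rw [← h3] at hz
    rcases hz with hz | hz
    · have : |(B (s, z) + p).1.1| ≤ |(B (s, z)).1.1| + |p.1.1| := abs_add_le _ _
      linarith
    · rw [map_add] at hz
      linarith [norm_add_le (transversal F (B (s, z))) (transversal F p)]
  · refine hΦid s z (hTzero s z ?_)
    filter_upwards [hc11.continuousAt.eventually_lt continuousAt_const hz] with w hw
    simp [T, T₀, hχ0 _ hw.le]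
  · obtain ⟨u, rfl⟩ := hsurj s w v
    rw [hsymp, stdForm_flowDir]
    have hDd : HasFDerivAt (fun z => D (s, z)) (fderiv ℝ (fun z => D (s, z)) (Φ (s, w)))
        (Φ (s, w)) :=
      (fderiv_partial (hD.differentiable (by simp) _)).differentiableAt.hasFDerivAt
    have h1 : HasFDerivAt (fun w => stdForm F (flowDir F) (Φ (s, w)) + D (s, Φ (s, w))) _ w :=
      ((stdForm F (flowDir F)).hasFDerivAt.comp w (hΦd s w)).add
        (HasFDerivAt.comp (g := fun z => D (s, z)) w hDd (hΦd s w))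
    have h2 : HasFDerivAt (fun w => stdForm F (flowDir F) (Φ (s, w)) + D (s, Φ (s, w)))
        (stdForm F (flowDir F)) w := by
      refine (stdForm F (flowDir F)).hasFDerivAt.congr_of_eventuallyEq ?_
      filter_upwards [hc11.continuousAt.eventually_lt continuousAt_const hw] with w' hw'
      rw [stdForm_flowDir, stdForm_flowDir, hK s w' hw']
    have h3 := congrArg (fun T : Phase F →L[ℝ] ℝ => T u) (h1.unique h2)
    simp only [add_apply, ContinuousLinearMap.comp_apply, stdForm_flowDir] at h3
    exact h3.symm
  · have hκs := hκ1 s hs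
    obtain ⟨hSs, hSd⟩ := hSG s (hs.trans (min_le_left _ _)) hsympG
    have hcT : Continuous fun z : Phase F => ‖transversal F z‖ :=
      (transversal F).continuous.norm
    have hout (z : Phase F) (hz : ρ < ‖transversal F z‖) : Φ (s, z) = z := by
      refine hΦid s z (hTzero s z ?_)
      filter_upwards [continuousAt_const.eventually_lt hcT.continuousAt hz] with w hw
      simp [T, T₀, hκs, hSs _ hw]
    -- The shift of `q₁` is `∂S/∂p₁`, evaluated at the mixed point with the new momentum.
    refine ⟨hout, fun x => fderiv ℝ (fun x => S (s, x)) (x + (0, (0, (G (s, x)).2))) (1, 0),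
      ?_, ?_⟩
    · have h1 : Continuous fun x : ℝ × (F × F) => fderiv ℝ (fun x => S (s, x)) x :=
        hS.partial_fderiv.continuous.comp (continuous_const.prodMk continuous_id)
      have h2 := hG.continuous
      exact (h1.comp (by fun_prop)).clm_apply continuous_const
    set f : ℝ × (F × F) → ℝ :=
      fun x => fderiv ℝ (fun x => S (s, x)) (x + (0, (0, (G (s, x)).2))) (1, 0) with hf
    have hmain (z : Phase F) (hz1 : a / 4 < z.1.1) (hz2 : z.1.1 < 2 * a) : Φ (s, z) =
            ((z.1.1 + f (transversal F z), z.1.2 + (G (s, transversal F z)).1),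
              (z.2.1, z.2.2 + (G (s, transversal F z)).2)) := by
      set m := G (s, transversal F z) with hm
      -- The mixed point belonging to `z`. Near it `χ = 1`, so `T` is `S` and its derivatives are
      -- known from `G`.
      let ζ : Phase F := z + (0, (0, m.2))
      have hζT : (fun w => T (s, w)) =ᶠ[𝓝 ζ] fun w => S (s, transversal F w) := by
        have e1 : a / 4 < ζ.1.1 := by simpa [ζ] using hz1
        have e2 : ζ.1.1 < 2 * a := by simpa [ζ] using hz2
        filter_upwards [hc11.continuousAt.eventually_lt continuousAt_const e2,
          continuousAt_const.eventually_lt hc11.continuousAt e1] with w hw1 hw2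
        simp [T, T₀, hκs, hχ1 _ hw2.le hw1.le]
      have hSdiff (x) : DifferentiableAt ℝ (fun x => S (s, x)) x :=
        (fderiv_partial (hS.differentiable (by simp) (s, x))).differentiableAt
      have hζd : fderiv ℝ (fun w => T (s, w)) ζ =
          (fderiv ℝ (fun x => S (s, x)) (transversal F ζ)).comp (transversal F) := by
        rw [hζT.fderiv_eq]
        exact ((hSdiff _).hasFDerivAt.comp ζ (transversal F).hasFDerivAt).fderiv
      have hζt : transversal F ζ = transversal F z + (0, (0, m.2)) := by
        simp [ζ, transversal_apply]
      have hSz (b : F × F) : fderiv ℝ (fun x => S (s, x)) (transversal F ζ) (0, b) =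
          areaForm F m b := by
        have e1 := fderiv_partial (Y := fun x : ℝ × (F × F) => S (s, x)) (p := z.2.1)
          (x := (z.1.2, z.2.2) + (0, m.2)) (hSdiff _)
        have e2 := hSd z.2.1 (z.1.2, z.2.2)
        have e3 : G (s, (z.2.1, (z.1.2, z.2.2))) = m := rfl
        have e4 : transversal F ζ = (z.2.1, (z.1.2, z.2.2) + (0, m.2)) := by
          rw [hζt, transversal_apply]; simp
        rw [e3, e1.fderiv, ← e4] at e2
        exact congrArg (fun T : F × F →L[ℝ] ℝ => T b) e2
      have hl (v : Phase F) : fderiv ℝ (fun w => T (s, w)) ζ v =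
          fderiv ℝ (fun x => S (s, x)) (transversal F ζ) (v.2.1, (v.1.2, v.2.2)) := by
        rw [hζd]; rfl
      have hgQ : (gradQ F (fderiv ℝ (fun w => T (s, w)) ζ)).2 = (0, -m.2) := by
        refine pairing_left_injective fun b => ?_
        rw [pairing_gradQ, hl]
        simp only [Prod.fst_zero, Prod.snd_zero]
        rw [hSz, areaForm_apply, pairing_apply]
        simp
      have hgP : (gradP F (fderiv ℝ (fun w => T (s, w)) ζ)).1 = (f (transversal F z), m.1) := by
        refine pairing_left_injective fun b => ?_
        rw [pairing_gradP, hl]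
        have e1 : ((b.1, ((0 : Pos F).2, b.2)) : ℝ × (F × F)) =
            b.1 • (1, 0) + (0, (0, b.2)) := by simp
        simp only [e1, map_add, map_smul, hSz]
        rw [areaForm_apply, pairing_apply, hf]
        simp only [hζt, smul_eq_mul, ← hm]
        simp
        ring
      have hζz : ζ + gradQ F (fderiv ℝ (fun w => T (s, w)) ζ) = z := by
        refine Prod.ext (by simp [ζ, gradQ_fst]) ?_
        rw [Prod.snd_add, hgQ]
        refine Prod.ext ?_ ?_ <;> simp [ζ]
      have := hΦA s ζ
      rw [hζz] at this
      rw [this]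
      refine Prod.ext ?_ ?_
      · rw [Prod.fst_add, hgP]; refine Prod.ext ?_ ?_ <;> simp [ζ]
      · rw [Prod.snd_add, gradP_snd]; refine Prod.ext ?_ ?_ <;> simp [ζ]
    -- The bound and the support of the shift are read off from those of `Φ - id` at the point with
    -- `q₁ = a`, where the formula for `Φ` applies.
    refine ⟨fun x => ?_, fun x hx => ?_, hmain⟩
    · have h1 := hmain ((a, x.2.1), (x.1, x.2.2)) (by simp; linarith) (by simp; linarith)
      have h2 := (hcoord _).trans (hbd s ((a, x.2.1), (x.1, x.2.2)))
      rw [h1] at h2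
      simpa [transversal_apply] using h2
    · have h1 := hmain ((a, x.2.1), (x.1, x.2.2)) (by simp; linarith) (by simp; linarith)
      rw [hout _ (by simpa [transversal_apply] using hx)] at h1
      have h2 := congrArg (fun z : Phase F => z.1.1) h1
      simpa [transversal_apply] using h2
end Perturbation

/-! ### Interpolating a fast converging sequence by a smooth curve -/

section SpecialCurve

theorem norm_iteratedFDeriv_comp_clm_le {E E' Y : Type*} [NormedAddCommGroup E] [NormedSpace ℝ E]
    [NormedAddCommGroup E'] [NormedSpace ℝ E'] [NormedAddCommGroup Y] [NormedSpace ℝ Y]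
    {f : E → Y} (hf : ContDiff ℝ ∞ f) (L : E' →L[ℝ] E) (hL : ‖L‖ ≤ 1) (j : ℕ) (x : E') :
    ‖iteratedFDeriv ℝ j (fun x => f (L x)) x‖ ≤ ‖iteratedFDeriv ℝ j f (L x)‖ := by
  have h : iteratedFDeriv ℝ j (f ∘ L) x =
      (iteratedFDeriv ℝ j f (L x)).compContinuousLinearMap fun _ => L :=
    L.iteratedFDeriv_comp_right hf x (by exact_mod_cast le_top)
  change ‖iteratedFDeriv ℝ j (f ∘ L) x‖ ≤ _
  rw [h]
  refine (ContinuousMultilinearMap.norm_compContinuousLinearMap_le _ _).trans ?_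
  refine mul_le_of_le_one_right (norm_nonneg _) ?_
  exact Finset.prod_le_one (fun _ _ => norm_nonneg _) fun _ _ => hL

/-- A sequence of functions which converges to zero sufficiently fast is interpolated by a smooth
family. -/
theorem exists_special_curve : ∃ δ : ℕ → ℝ, (∀ k, 0 < δ k) ∧
    ∀ {E Y : Type} [NormedAddCommGroup E] [NormedSpace ℝ E] [NormedAddCommGroup Y]
    [NormedSpace ℝ Y] [CompleteSpace Y] (g : ℕ → E → Y), (∀ k, ContDiff ℝ ∞ (g k)) →
    (∀ k, ∀ j ≤ k, ∀ x, ‖iteratedFDeriv ℝ j (g k) x‖ ≤ δ k) →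
    ∃ G : ℝ × E → Y, ContDiff ℝ ∞ G ∧ (∀ x, G (0, x) = 0) ∧ (∀ k x, G ((1 / 2) ^ k, x) = g k x) ∧
      ∀ s x, (∀ k, g k x = 0) → G (s, x) = 0 := by
  have hpos (k : ℕ) : (0 : ℝ) < (1 / 2) ^ k := by positivity
  -- The outer radius, a quarter of the centre, makes `b k` vanish at `0` and at every other power
  -- of `1/2`.
  let b (k : ℕ) : ContDiffBump ((1 / 2 : ℝ) ^ k) :=
    ⟨(1 / 2) ^ k / 8, (1 / 2) ^ k / 4, by have := hpos k; positivity, by linarith [hpos k]⟩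
  have hb (k) : ContDiff ℝ ∞ (b k) := (b k).contDiff
  have hbd (k i : ℕ) : ∃ C, ∀ t, ‖iteratedFDeriv ℝ i (b k) t‖ ≤ C :=
    ((hb k).continuous_iteratedFDeriv (by exact_mod_cast le_top)).bounded_above_of_compact_support
      ((b k).hasCompactSupport.iteratedFDeriv i)
  choose C hC using hbd
  have hC0 (k i) : 0 ≤ C k i := (norm_nonneg _).trans (hC k i 0)
  let A (k : ℕ) : ℝ := 1 + ∑ i ∈ Finset.range (k + 1), C k i
  have hA (k) : 0 < A k := by
    have : 0 ≤ ∑ i ∈ Finset.range (k + 1), C k i := Finset.sum_nonneg fun i _ => hC0 k i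
    simp only [A]; linarith
  have hb0 (k : ℕ) : b k 0 = 0 := (b k).zero_of_le_dist (by
    rw [Real.dist_eq, zero_sub, abs_neg, abs_of_pos (hpos k)]
    change _ / 4 ≤ _
    linarith [hpos k])
  have hbkj (k j : ℕ) (h : j ≠ k) : b k ((1 / 2) ^ j) = 0 := by
    refine (b k).zero_of_le_dist ?_
    change (1 / 2) ^ k / 4 ≤ _
    rw [Real.dist_eq]
    rcases lt_or_gt_of_ne h with h | h
    · have : ((1 : ℝ) / 2) ^ k ≤ (1 / 2) ^ (j + 1) :=
        pow_le_pow_of_le_one (by norm_num) (by norm_num) h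
      rw [pow_succ] at this
      rw [abs_of_nonneg] <;> linarith [hpos j]
    · have : ((1 : ℝ) / 2) ^ j ≤ (1 / 2) ^ (k + 1) :=
        pow_le_pow_of_le_one (by norm_num) (by norm_num) h
      rw [pow_succ] at this
      rw [abs_of_nonpos] <;> linarith [hpos k]
  have hbk (k : ℕ) : b k ((1 / 2) ^ k) = 1 := (b k).one_of_mem_closedBall (by
    rw [Metric.mem_closedBall, dist_self]
    exact (b k).rIn_pos.le)
  -- The constant `A k` dominates the derivatives of `b k` up to order `k`, and binomial
  -- coefficients are at most `2 ^ k`, so for `j ≤ k` the derivative of order `j` of summand `k` is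
  -- at most `2 ^ k · 4 ^ (-k) = 2 ^ (-k)`. This sequence involves neither the spaces nor the
  -- functions: it has to be fixed before the functions are known.
  refine ⟨fun k => (1 / 4) ^ k / A k, fun k => by have := hA k; positivity, ?_⟩
  intro E Y _ _ _ _ _ g hg hgδ
  let f : ℕ → ℝ × E → Y := fun k q => b k q.1 • g k q.2
  have hf (k) : ContDiff ℝ ∞ (f k) := ((hb k).comp contDiff_fst).smul ((hg k).comp contDiff_snd)
  have hfbound (j k : ℕ) (hjk : j ≤ k) (q : ℝ × E) :
      ‖iteratedFDeriv ℝ j (f k) q‖ ≤ (1 / 2) ^ k := by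
    have h1 := norm_iteratedFDeriv_smul_le (𝕜 := ℝ) ((hb k).comp (contDiff_fst (E := ℝ) (F := E)))
      ((hg k).comp (contDiff_snd (E := ℝ) (F := E))) q (n := j) (by exact_mod_cast le_top)
    refine h1.trans ?_
    calc _ ≤ ∑ i ∈ Finset.range (j + 1), (2 : ℝ) ^ k * C k i * ((1 / 4) ^ k / A k) := by
          refine Finset.sum_le_sum fun i hi => ?_
          have hi' : i ≤ j := Nat.lt_succ_iff.1 (Finset.mem_range.1 hi)
          have e1 : (j.choose i : ℝ) ≤ 2 ^ k := by
            have := (Nat.choose_le_two_pow j i).trans (Nat.pow_le_pow_right two_pos hjk)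
            exact_mod_cast this
          have e2 : ‖iteratedFDeriv ℝ i (b k ∘ Prod.fst) q‖ ≤ C k i :=
            (norm_iteratedFDeriv_comp_clm_le (hb k) (.fst ℝ ℝ E)
              (ContinuousLinearMap.norm_fst_le _ _ _) i q).trans (hC _ _ _)
          have e3 : ‖iteratedFDeriv ℝ (j - i) (g k ∘ Prod.snd) q‖ ≤ (1 / 4) ^ k / A k :=
            (norm_iteratedFDeriv_comp_clm_le (hg k) (.snd ℝ ℝ E)
              (ContinuousLinearMap.norm_snd_le _ _ _) (j - i) q).trans (hgδ k _ (by omega) _)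
          have := hC0 k i
          gcongr
      _ = 2 ^ k * ((1 / 4) ^ k / A k) * ∑ i ∈ Finset.range (j + 1), C k i := by
          rw [Finset.mul_sum]
          exact Finset.sum_congr rfl fun i _ => by ring
      _ ≤ 2 ^ k * ((1 / 4) ^ k / A k) * A k := by
          have := hA k
          gcongr
          refine (Finset.sum_le_sum_of_subset_of_nonneg
            (Finset.range_mono (Nat.succ_le_succ hjk)) fun i _ _ => hC0 k i).trans ?_
          simp only [A]; linarith
      _ = (1 / 2) ^ k := by
          rw [mul_assoc, div_mul_cancel₀ _ (hA k).ne', ← mul_pow]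
          norm_num
  refine ⟨fun q => ∑' k, f k q, ?_, fun x => ?_, fun k x => ?_, fun s x hx => ?_⟩
  · refine contDiff_tsum_of_eventually (v := fun _ k => (1 / 2) ^ k) hf
      (fun j _ => summable_geometric_two) fun j _ => ?_
    rw [Nat.cofinite_eq_atTop]
    filter_upwards [Filter.eventually_ge_atTop j] with k hk
    exact hfbound j k hk
  · simp [f, hb0]
  · change ∑' j, f j ((1 / 2) ^ k, x) = g k x
    rw [tsum_eq_single k fun j hj => by simp only [f, hbkj j k hj.symm, zero_smul]]
    simp only [f, hbk, one_smul]
  · simp [f, hx]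

end SpecialCurve

/-! ### Alternating two-forms as bilinear maps -/

section CurryTwo

variable {E : Type*} [NormedAddCommGroup E] [NormedSpace ℝ E]

/-- Currying of alternating two-forms. -/
noncomputable def curryTwo : (E [⋀^Fin 2]→L[ℝ] ℝ) →L[ℝ] E →L[ℝ] E →L[ℝ] ℝ :=
  (ContinuousLinearMap.compL ℝ E (E [⋀^Fin 1]→L[ℝ] ℝ) (E →L[ℝ] ℝ)
    ((ContinuousAlternatingMap.ofSubsingletonLIE (𝕜 := ℝ) (E := E) (F := ℝ)
      (0 : Fin 1)).symm.toContinuousLinearEquiv : _ →L[ℝ] _)).comp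
    (ContinuousAlternatingMap.curryLeftLI (𝕜 := ℝ) (E := E) (F := ℝ)
      (n := 1)).toContinuousLinearMap

theorem curryTwo_apply (a : E [⋀^Fin 2]→L[ℝ] ℝ) (v w : E) : curryTwo a v w = a ![v, w] := by
  change a (Matrix.vecCons v fun _ => w) = _
  congr 1
  funext i
  fin_cases i <;> rfl

theorem curryTwo_self (a : E [⋀^Fin 2]→L[ℝ] ℝ) (v : E) : curryTwo a v v = 0 := by
  rw [curryTwo_apply]
  exact a.map_eq_zero_of_eq _ (i := 0) (j := 1) rfl (by simp)

/-- On three vectors the exterior derivative is the alternating sum over the removed vector;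
skewness turns it into the cyclic sum. -/
theorem cyclic_of_extDeriv_eq_zero {τ : E → E [⋀^Fin 2]→L[ℝ] ℝ} {x : E}
    (hτ : DifferentiableAt ℝ τ x) (h : extDeriv τ x = 0) (u v w : E) :
    fderiv ℝ (fun x => curryTwo (τ x)) x u v w + fderiv ℝ (fun x => curryTwo (τ x)) x v w u +
      fderiv ℝ (fun x => curryTwo (τ x)) x w u v = 0 := by
  have h1 : fderiv ℝ (fun x => curryTwo (τ x)) x = curryTwo.comp (fderiv ℝ τ x) :=
    (curryTwo.hasFDerivAt.comp x hτ.hasFDerivAt).fderiv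
  simp only [h1, ContinuousLinearMap.comp_apply, curryTwo_apply]
  rw [show extDeriv τ x = .alternatizeUncurryFin (fderiv ℝ τ x) from rfl] at h
  have h2 : ContinuousAlternatingMap.alternatizeUncurryFin (fderiv ℝ τ x) ![u, v, w] = 0 := by
    rw [h]; rfl
  rw [ContinuousAlternatingMap.alternatizeUncurryFin_apply] at h2
  change ∑ i : Fin 3, (-1) ^ (i : ℕ) • fderiv ℝ τ x (![u, v, w] i)
    (Fin.removeNth i ![u, v, w]) = 0 at h2
  rw [Fin.sum_univ_three] at h2
  have e0 : Fin.removeNth 0 ![u, v, w] = ![v, w] := by funext i; fin_cases i <;> rfl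
  have e1 : Fin.removeNth 1 ![u, v, w] = ![u, w] := by funext i; fin_cases i <;> rfl
  have e2 : Fin.removeNth 2 ![u, v, w] = ![u, v] := by funext i; fin_cases i <;> rfl
  rw [e0, e1, e2] at h2
  have h3 (a : E [⋀^Fin 2]→L[ℝ] ℝ) (v w : E) : a ![v, w] = -a ![w, v] := by
    have := curryTwo_self a (v + w)
    simp only [map_add, add_apply, curryTwo_self] at this
    rw [curryTwo_apply, curryTwo_apply] at this
    linarith
  simp at h2
  rw [h3 _ w u]
  linarith

end CurryTwo

/-! ### Derivatives and velocities on manifolds, with values in the model spaces -/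

section Tangent

variable {V V' V'' A A' A'' M M' M'' : Type*} [NormedAddCommGroup V] [NormedSpace ℝ V]
  [NormedAddCommGroup V'] [NormedSpace ℝ V'] [NormedAddCommGroup V''] [NormedSpace ℝ V'']
  [TopologicalSpace A] [TopologicalSpace A'] [TopologicalSpace A'']
  (I : ModelWithCorners ℝ V A) (J : ModelWithCorners ℝ V' A') (K : ModelWithCorners ℝ V'' A'')
  [TopologicalSpace M] [ChartedSpace A M] [TopologicalSpace M'] [ChartedSpace A' M']
  [TopologicalSpace M''] [ChartedSpace A'' M'']

/-- The derivative of a map between manifolds, as a map between the model spaces. -/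
noncomputable def tderiv (f : M → M') (x : M) : V →L[ℝ] V' := mfderiv I J f x

/-- The curve `γ` has the velocity `v` at the time `t`. -/
def HasVelocity (γ : ℝ → M) (v : V) (s : Set ℝ) (t : ℝ) : Prop :=
  HasMFDerivWithinAt 𝓘(ℝ, ℝ) I γ s t
    ((1 : ℝ →L[ℝ] ℝ).smulRight (show TangentSpace I (γ t) from v))

variable {I J K}

theorem tderiv_comp {g : M' → M''} {f : M → M'} {x : M} (hg : MDifferentiableAt J K g (f x))
    (hf : MDifferentiableAt I J f x) :
    tderiv I K (g ∘ f) x = (tderiv J K g (f x)).comp (tderiv I J f x) :=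
  mfderiv_comp x hg hf

theorem tderiv_eq_fderiv (f : V → V') (x : V) : tderiv 𝓘(ℝ, V) 𝓘(ℝ, V') f x = fderiv ℝ f x :=
  mfderiv_eq_fderiv

theorem Filter.EventuallyEq.tderiv_eq {f g : M → M'} {x : M} (h : f =ᶠ[𝓝 x] g) :
    tderiv I J f x = tderiv I J g x :=
  h.mfderiv_eq

theorem tderiv_id (x : M) : tderiv I I (id : M → M) x = .id ℝ V := mfderiv_id

theorem hasVelocity_iff {u : ℝ → V} {v : V} {s : Set ℝ} {t : ℝ} :
    HasVelocity 𝓘(ℝ, V) u v s t ↔ HasDerivWithinAt u v s t := by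
  have h : (1 : ℝ →L[ℝ] ℝ).smulRight v = ContinuousLinearMap.toSpanSingleton ℝ v :=
    ContinuousLinearMap.ext fun _ => rfl
  rw [hasDerivWithinAt_iff_hasFDerivWithinAt, ← h]
  exact hasMFDerivWithinAt_iff_hasFDerivWithinAt

theorem HasVelocity.comp {γ : ℝ → M} {v : V} {s : Set ℝ} {t : ℝ} (h : HasVelocity I γ v s t)
    {f : M → M'} (hf : MDifferentiableAt I J f (γ t)) :
    HasVelocity J (f ∘ γ) (tderiv I J f (γ t) v) s t := by
  refine (hf.hasMFDerivAt.comp_hasMFDerivWithinAt t h).congr_mfderiv ?_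
  refine ContinuousLinearMap.ext fun a => ?_
  exact (tderiv I J f (γ t)).map_smul a v

theorem HasVelocity.mono {γ : ℝ → M} {v : V} {s s' : Set ℝ} {t : ℝ} (h : HasVelocity I γ v s t)
    (hs : s' ⊆ s) : HasVelocity I γ v s' t :=
  HasMFDerivWithinAt.mono h hs

theorem HasVelocity.congr {γ γ' : ℝ → M} {v : V} {s : Set ℝ} {t : ℝ} (h : HasVelocity I γ v s t)
    (hγ : ∀ t ∈ s, γ' t = γ t) (ht : t ∈ s) : HasVelocity I γ' v s t := by
  unfold HasVelocity at h ⊢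
  have := HasMFDerivWithinAt.congr_of_eventuallyEq h
    (Filter.eventually_of_mem self_mem_nhdsWithin hγ) (hγ t ht)
  exact this

theorem HasVelocity.continuousWithinAt {γ : ℝ → M} {v : V} {s : Set ℝ} {t : ℝ}
    (h : HasVelocity I γ v s t) : ContinuousWithinAt γ s t :=
  HasMFDerivWithinAt.continuousWithinAt h

theorem HasVelocity.union {γ : ℝ → M} {v : V} {s s' : Set ℝ} {t : ℝ}
    (h : HasVelocity I γ v s t) (h' : HasVelocity I γ v s' t) : HasVelocity I γ v (s ∪ s') t :=
  HasMFDerivWithinAt.union h h'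

theorem HasVelocity.mono_of_mem_nhdsWithin {γ : ℝ → M} {v : V} {s s' : Set ℝ} {t : ℝ}
    (h : HasVelocity I γ v s t) (hs : s ∈ 𝓝[s'] t) : HasVelocity I γ v s' t :=
  HasMFDerivWithinAt.mono_of_mem_nhdsWithin h hs

/-- Reparametrization by a translation. -/
theorem HasVelocity.comp_add {γ : ℝ → M} {v : V} {s : Set ℝ} {t c : ℝ}
    (h : HasVelocity I γ v s (t + c)) :
    HasVelocity I (fun t => γ (t + c)) v ((fun t => t + c) ⁻¹' s) t := by
  have h1 : HasMFDerivWithinAt 𝓘(ℝ, ℝ) 𝓘(ℝ, ℝ) (fun t : ℝ => t + c) ((fun t => t + c) ⁻¹' s) t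
      (.id ℝ ℝ) := by
    refine HasFDerivWithinAt.hasMFDerivWithinAt ?_
    exact (hasFDerivAt_id t).add_const c |>.hasFDerivWithinAt
  exact HasMFDerivWithinAt.comp (I' := 𝓘(ℝ, ℝ)) (g := γ) (f := fun t : ℝ => t + c) t h h1
    fun _ h => h

end Tangent

/-! ### Smooth coordinates with values in an arbitrary normed space -/

section SmoothCharts

variable {V H' M : Type*} [NormedAddCommGroup V] [NormedSpace ℝ V] [TopologicalSpace H']
  (I : ModelWithCorners ℝ V H') [TopologicalSpace M] [ChartedSpace H' M]
  {E : Type*} [NormedAddCommGroup E] [NormedSpace ℝ E]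

/-- Smooth local coordinates with values in a normed space. -/
structure IsSmoothChart (Ψ : OpenPartialHomeomorph M E) : Prop where
  contMDiffOn : ContMDiffOn I 𝓘(ℝ, E) ∞ Ψ Ψ.source
  contMDiffOn_symm : ContMDiffOn 𝓘(ℝ, E) I ∞ Ψ.symm Ψ.target

variable {I}

namespace IsSmoothChart

variable {Ψ : OpenPartialHomeomorph M E} (hΨ : IsSmoothChart I Ψ)

section
include hΨ

theorem contMDiffAt {x : M} (hx : x ∈ Ψ.source) : ContMDiffAt I 𝓘(ℝ, E) ∞ Ψ x :=
  (hΨ.contMDiffOn x hx).contMDiffAt (Ψ.open_source.mem_nhds hx)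

theorem contMDiffAt_symm {u : E} (hu : u ∈ Ψ.target) : ContMDiffAt 𝓘(ℝ, E) I ∞ Ψ.symm u :=
  (hΨ.contMDiffOn_symm u hu).contMDiffAt (Ψ.open_target.mem_nhds hu)

theorem mdifferentiableAt {x : M} (hx : x ∈ Ψ.source) : MDifferentiableAt I 𝓘(ℝ, E) Ψ x :=
  (hΨ.contMDiffAt hx).mdifferentiableAt (by simp)

theorem mdifferentiableAt_symm {u : E} (hu : u ∈ Ψ.target) :
    MDifferentiableAt 𝓘(ℝ, E) I Ψ.symm u :=
  (hΨ.contMDiffAt_symm hu).mdifferentiableAt (by simp)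

theorem hasDerivWithinAt {γ : ℝ → M} {s : Set ℝ} {t : ℝ} {v : V} (h : HasVelocity I γ v s t)
    (ht : γ t ∈ Ψ.source) : HasDerivWithinAt (Ψ ∘ γ) (tderiv I 𝓘(ℝ, E) Ψ (γ t) v) s t :=
  hasVelocity_iff.1 (h.comp (hΨ.mdifferentiableAt ht))

theorem hasVelocity_symm {u : ℝ → E} {s : Set ℝ} {t : ℝ} {u' : E}
    (h : HasDerivWithinAt u u' s t) (ht : u t ∈ Ψ.target) :
    HasVelocity I (Ψ.symm ∘ u) (tderiv 𝓘(ℝ, E) I Ψ.symm (u t) u') s t :=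
  (hasVelocity_iff.2 h).comp (hΨ.mdifferentiableAt_symm ht)

theorem tderiv_symm_comp {x : M} (hx : x ∈ Ψ.source) :
    (tderiv 𝓘(ℝ, E) I Ψ.symm (Ψ x)).comp (tderiv I 𝓘(ℝ, E) Ψ x) = .id ℝ V := by
  rw [← tderiv_comp (hΨ.mdifferentiableAt_symm (Ψ.map_source hx)) (hΨ.mdifferentiableAt hx),
    ← tderiv_id (I := I) x]
  refine Filter.EventuallyEq.tderiv_eq ?_
  filter_upwards [Ψ.open_source.mem_nhds hx] with y hy using Ψ.left_inv hy

theorem tderiv_comp_symm {u : E} (hu : u ∈ Ψ.target) :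
    (tderiv I 𝓘(ℝ, E) Ψ (Ψ.symm u)).comp (tderiv 𝓘(ℝ, E) I Ψ.symm u) = .id ℝ E := by
  rw [← tderiv_comp (hΨ.mdifferentiableAt (Ψ.map_target hu)) (hΨ.mdifferentiableAt_symm hu),
    ← tderiv_id (I := 𝓘(ℝ, E)) u]
  refine Filter.EventuallyEq.tderiv_eq ?_
  filter_upwards [Ψ.open_target.mem_nhds hu] with y hy using Ψ.right_inv hy

theorem tderiv_symm_tderiv {x : M} (hx : x ∈ Ψ.source) (v : V) :
    tderiv 𝓘(ℝ, E) I Ψ.symm (Ψ x) (tderiv I 𝓘(ℝ, E) Ψ x v) = v :=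
  congrArg (fun T : V →L[ℝ] V => T v) (hΨ.tderiv_symm_comp hx)

theorem tderiv_tderiv_symm {u : E} (hu : u ∈ Ψ.target) (v : E) :
    tderiv I 𝓘(ℝ, E) Ψ (Ψ.symm u) (tderiv 𝓘(ℝ, E) I Ψ.symm u v) = v :=
  congrArg (fun T : E →L[ℝ] E => T v) (hΨ.tderiv_comp_symm hu)

theorem tderiv_symm_tderiv' {u : E} (hu : u ∈ Ψ.target) (v : V) :
    tderiv 𝓘(ℝ, E) I Ψ.symm u (tderiv I 𝓘(ℝ, E) Ψ (Ψ.symm u) v) = v := by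
  have := hΨ.tderiv_symm_tderiv (Ψ.map_target hu) v
  rwa [Ψ.right_inv hu] at this

theorem fderiv_comp_symm {h : M → ℝ} {u : E} (hu : u ∈ Ψ.target)
    (hh : MDifferentiableAt I 𝓘(ℝ, ℝ) h (Ψ.symm u)) (w : E) :
    fderiv ℝ (h ∘ Ψ.symm) u w =
      tderiv I 𝓘(ℝ, ℝ) h (Ψ.symm u) (tderiv 𝓘(ℝ, E) I Ψ.symm u w) := by
  rw [← tderiv_eq_fderiv, tderiv_comp hh (hΨ.mdifferentiableAt_symm hu)]
  rfl

end

end IsSmoothChart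

theorem IsManifold.isSmoothChart_of_mem_maximalAtlas {m : ℕ} {M : Type*} [TopologicalSpace M]
    [ChartedSpace (EuclideanSpace ℝ (Fin m)) M]
    {φ : OpenPartialHomeomorph M (EuclideanSpace ℝ (Fin m))}
    (hφ : φ ∈ IsManifold.maximalAtlas (𝓡 m) ∞ M) : IsSmoothChart (𝓡 m) φ :=
  ⟨contMDiffOn_of_mem_maximalAtlas hφ, contMDiffOn_symm_of_mem_maximalAtlas hφ⟩

end SmoothCharts

/-! ### The symplectic form and Hamilton's equations in coordinates -/

namespace SymplecticForm

variable {m : ℕ} {Ω : Type*} [TopologicalSpace Ω]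
  [ChartedSpace (EuclideanSpace ℝ (Fin m)) Ω] [IsManifold (𝓡 m) ∞ Ω]
  (σ : SymplecticForm m Ω) {H : Ω → ℝ}

/-- The symplectic form as a bilinear form. -/
noncomputable def bilin (x : Ω) :
    EuclideanSpace ℝ (Fin m) →L[ℝ] EuclideanSpace ℝ (Fin m) →L[ℝ] ℝ :=
  curryTwo (E := EuclideanSpace ℝ (Fin m)) (σ.form x)

/-- The Hamiltonian vector field, with values in the model space. -/
noncomputable def field (H : Ω → ℝ) (x : Ω) : EuclideanSpace ℝ (Fin m) :=
  σ.hamiltonianField H x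

theorem bilin_eq_form (x : Ω) (v w : TangentSpace (𝓡 m) x) :
    σ.bilin x v w = σ.form x ![v, w] :=
  curryTwo_apply (E := EuclideanSpace ℝ (Fin m)) _ _ _

theorem bilin_self (x : Ω) (v : EuclideanSpace ℝ (Fin m)) : σ.bilin x v v = 0 :=
  curryTwo_self _ _

theorem bilin_skew (x : Ω) (v w : EuclideanSpace ℝ (Fin m)) :
    σ.bilin x v w = -σ.bilin x w v := by
  have := σ.bilin_self x (v + w)
  simp only [map_add, add_apply, bilin_self] at this
  linarith

theorem eq_zero_of_bilin {x : Ω} {v : EuclideanSpace ℝ (Fin m)} (h : ∀ w, σ.bilin x v w = 0) :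
    v = 0 :=
  σ.nondegenerate x v fun w => (σ.bilin_eq_form x v w).symm.trans (h w)

theorem bilin_field (H : Ω → ℝ) (x : Ω) (w : EuclideanSpace ℝ (Fin m)) :
    σ.bilin x (σ.field H x) w = tderiv (𝓡 m) 𝓘(ℝ, ℝ) H x w :=
  (σ.bilin_eq_form x _ _).trans (σ.form_hamiltonianField H x w)

theorem eq_field {x : Ω} {v : EuclideanSpace ℝ (Fin m)}
    (h : ∀ w, σ.bilin x v w = tderiv (𝓡 m) 𝓘(ℝ, ℝ) H x w) : v = σ.field H x := by
  refine sub_eq_zero.1 (σ.eq_zero_of_bilin (x := x) fun w => ?_)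
  rw [map_sub, sub_apply, h, bilin_field, sub_self]

variable {E : Type*} [NormedAddCommGroup E] [NormedSpace ℝ E]

/-- The symplectic form in local coordinates. -/
noncomputable def formIn (Ψ : OpenPartialHomeomorph Ω E) (u : E) : E →L[ℝ] E →L[ℝ] ℝ :=
  (σ.bilin (Ψ.symm u)).bilinearComp (tderiv 𝓘(ℝ, E) (𝓡 m) Ψ.symm u)
    (tderiv 𝓘(ℝ, E) (𝓡 m) Ψ.symm u)

theorem formIn_apply (Ψ : OpenPartialHomeomorph Ω E) (u v w : E) : σ.formIn Ψ u v w =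
    σ.bilin (Ψ.symm u) (tderiv 𝓘(ℝ, E) (𝓡 m) Ψ.symm u v)
      (tderiv 𝓘(ℝ, E) (𝓡 m) Ψ.symm u w) := rfl

/-- Hamilton's equations in local coordinates. -/
theorem formIn_tderiv_field {Ψ : OpenPartialHomeomorph Ω E}
    (hΨ : IsSmoothChart (𝓡 m) Ψ) {x : Ω} (hx : x ∈ Ψ.source)
    (hH : MDifferentiableAt (𝓡 m) 𝓘(ℝ, ℝ) H x) (w : E) :
    σ.formIn Ψ (Ψ x) (tderiv (𝓡 m) 𝓘(ℝ, E) Ψ x (σ.field H x)) w =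
      fderiv ℝ (H ∘ Ψ.symm) (Ψ x) w := by
  rw [hΨ.fderiv_comp_symm (Ψ.map_source hx) (by rwa [Ψ.left_inv hx]), formIn_apply,
    hΨ.tderiv_symm_tderiv hx, Ψ.left_inv hx, bilin_field]

theorem tderiv_symm_eq_field {Ψ : OpenPartialHomeomorph Ω E}
    (hΨ : IsSmoothChart (𝓡 m) Ψ) {u : E} (hu : u ∈ Ψ.target)
    (hH : MDifferentiableAt (𝓡 m) 𝓘(ℝ, ℝ) H (Ψ.symm u)) {v : E}
    (hv : ∀ w, σ.formIn Ψ u v w = fderiv ℝ (H ∘ Ψ.symm) u w) :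
    tderiv 𝓘(ℝ, E) (𝓡 m) Ψ.symm u v = σ.field H (Ψ.symm u) := by
  refine σ.eq_field fun w => ?_
  have h1 := hv (tderiv (𝓡 m) 𝓘(ℝ, E) Ψ (Ψ.symm u) w)
  rwa [hΨ.fderiv_comp_symm hu hH, formIn_apply, hΨ.tderiv_symm_tderiv' hu] at h1

/-- A solution of Hamilton's equations in local coordinates is an integral curve. -/
theorem hasVelocity_of_formIn {Ψ : OpenPartialHomeomorph Ω E}
    (hΨ : IsSmoothChart (𝓡 m) Ψ) {u : ℝ → E} {s : Set ℝ} {t : ℝ} {u' : E}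
    (hu : HasDerivWithinAt u u' s t) (ht : u t ∈ Ψ.target)
    (hH : MDifferentiableAt (𝓡 m) 𝓘(ℝ, ℝ) H (Ψ.symm (u t)))
    (hv : ∀ w, σ.formIn Ψ (u t) u' w = fderiv ℝ (H ∘ Ψ.symm) (u t) w) :
    HasVelocity (𝓡 m) (Ψ.symm ∘ u) (σ.field H (Ψ.symm (u t))) s t := by
  rw [← σ.tderiv_symm_eq_field hΨ ht hH hv]
  exact hΨ.hasVelocity_symm hu ht

theorem formIn_self (Ψ : OpenPartialHomeomorph Ω E) (u v : E) : σ.formIn Ψ u v v = 0 :=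
  σ.bilin_self _ _

theorem eq_zero_of_formIn {Ψ : OpenPartialHomeomorph Ω E} (hΨ : IsSmoothChart (𝓡 m) Ψ) {u : E}
    (hu : u ∈ Ψ.target) {v : E} (h : ∀ w, σ.formIn Ψ u v w = 0) : v = 0 := by
  have h1 : tderiv 𝓘(ℝ, E) (𝓡 m) Ψ.symm u v = 0 := by
    refine σ.eq_zero_of_bilin (x := Ψ.symm u) fun w => ?_
    have h2 := h (tderiv (𝓡 m) 𝓘(ℝ, E) Ψ (Ψ.symm u) w)
    rwa [formIn_apply, hΨ.tderiv_symm_tderiv' hu] at h2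
  rw [← hΨ.tderiv_tderiv_symm hu v, h1, map_zero]

variable {φ : OpenPartialHomeomorph Ω (EuclideanSpace ℝ (Fin m))}

theorem formIn_eq_curryTwo (u : EuclideanSpace ℝ (Fin m)) : σ.formIn φ u =
    curryTwo ((σ.form (φ.symm u)).compContinuousLinearMap (mfderiv (𝓡 m) (𝓡 m) φ.symm u) :
          EuclideanSpace ℝ (Fin m) [⋀^Fin 2]→L[ℝ] ℝ) := by
  refine ContinuousLinearMap.ext fun v => ContinuousLinearMap.ext fun w => ?_
  rw [curryTwo_apply]
  refine (σ.bilin_eq_form _ _ _).trans ?_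
  change _ = σ.form (φ.symm u) (mfderiv (𝓡 m) (𝓡 m) φ.symm u ∘ ![v, w])
  congr 1
  funext i
  fin_cases i <;> rfl

theorem contDiffOn_formIn (hφ : φ ∈ IsManifold.maximalAtlas (𝓡 m) ∞ Ω) :
    ContDiffOn ℝ ∞ (σ.formIn φ) φ.target := by
  rw [show σ.formIn φ = _ from funext σ.formIn_eq_curryTwo]
  exact curryTwo.contDiff.comp_contDiffOn (σ.smooth φ hφ)

theorem formIn_cyclic (hφ : φ ∈ IsManifold.maximalAtlas (𝓡 m) ∞ Ω)
    {x : EuclideanSpace ℝ (Fin m)} (hx : x ∈ φ.target) (u v w : EuclideanSpace ℝ (Fin m)) :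
    fderiv ℝ (σ.formIn φ) x u v w + fderiv ℝ (σ.formIn φ) x v w u +
      fderiv ℝ (σ.formIn φ) x w u v = 0 := by
  rw [show σ.formIn φ = _ from funext σ.formIn_eq_curryTwo]
  exact cyclic_of_extDeriv_eq_zero (((σ.smooth φ hφ).contDiffAt
    (φ.open_target.mem_nhds hx)).differentiableAt (by simp)) (σ.closed φ hφ x hx) u v w

omit [IsManifold (𝓡 m) ∞ Ω] in
theorem contDiffOn_comp_symm (hφ : φ ∈ IsManifold.maximalAtlas (𝓡 m) ∞ Ω)
    (hH : ContMDiff (𝓡 m) 𝓘(ℝ, ℝ) ∞ H) : ContDiffOn ℝ ∞ (H ∘ φ.symm) φ.target := by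
  rw [← contMDiffOn_iff_contDiffOn]
  exact hH.comp_contMDiffOn (contMDiffOn_symm_of_mem_maximalAtlas hφ)

end SymplecticForm

/-! ### Orbits: energy and uniqueness -/

namespace SymplecticForm

section Orbits

variable {m : ℕ} {Ω : Type*} [TopologicalSpace Ω]
  [ChartedSpace (EuclideanSpace ℝ (Fin m)) Ω] [IsManifold (𝓡 m) ∞ Ω]
  (σ : SymplecticForm m Ω) {H : Ω → ℝ}

/-- The curve `γ` follows the Hamiltonian flow of `H` during the times in `s`. -/
def IsOrbit (H : Ω → ℝ) (γ : ℝ → Ω) (s : Set ℝ) : Prop :=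
  ∀ t ∈ s, HasVelocity (𝓡 m) γ (σ.field H (γ t)) s t

variable {σ}

theorem IsOrbit.mono {γ : ℝ → Ω} {s s' : Set ℝ} (h : σ.IsOrbit H γ s) (hs : s' ⊆ s) :
    σ.IsOrbit H γ s' :=
  fun t ht => (h t (hs ht)).mono hs

theorem IsOrbit.continuousOn {γ : ℝ → Ω} {s : Set ℝ} (h : σ.IsOrbit H γ s) : ContinuousOn γ s :=
  fun t ht => (h t ht).continuousWithinAt

theorem IsOrbit.congr {γ γ' : ℝ → Ω} {s : Set ℝ} (h : σ.IsOrbit H γ s) (hγ : EqOn γ' γ s) :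
    σ.IsOrbit H γ' s := fun t ht => by
  rw [hγ ht]
  exact (h t ht).congr hγ ht

theorem IsOrbit.comp_add {γ : ℝ → Ω} {a b : ℝ} (h : σ.IsOrbit H γ (Icc a b)) (c : ℝ) :
    σ.IsOrbit H (fun t => γ (t + c)) (Icc (a - c) (b - c)) := fun t ht => by
  have h1 := (h (t + c) ⟨by linarith [ht.1], by linarith [ht.2]⟩).comp_add
  refine h1.mono fun t ht => ⟨by linarith [ht.1], by linarith [ht.2]⟩

theorem IsOrbit.union {γ : ℝ → Ω} {a b c : ℝ} (hab : a ≤ b) (hbc : b ≤ c)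
    (h : σ.IsOrbit H γ (Icc a b)) (h' : σ.IsOrbit H γ (Icc b c)) : σ.IsOrbit H γ (Icc a c) := by
  intro t ht
  rw [← Icc_union_Icc_eq_Icc hab hbc] at ht ⊢
  rcases lt_trichotomy t b with htb | rfl | htb
  · refine (h t ⟨?_, htb.le⟩).mono_of_mem_nhdsWithin ?_
    · rcases ht with ht | ht
      exacts [ht.1, hab.trans ht.1]
    · refine mem_nhdsWithin.2 ⟨Iio b, isOpen_Iio, htb, fun s hs => ?_⟩
      rcases hs.2 with h1 | h1
      exacts [h1, absurd hs.1 (not_lt.2 h1.1)]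
  · exact (h t ⟨hab, le_rfl⟩).union (h' t ⟨le_rfl, hbc⟩)
  · refine (h' t ⟨htb.le, ?_⟩).mono_of_mem_nhdsWithin ?_
    · rcases ht with ht | ht
      exacts [ht.2.trans hbc, ht.2]
    · refine mem_nhdsWithin.2 ⟨Ioi b, isOpen_Ioi, htb, fun s hs => ?_⟩
      rcases hs.2 with h1 | h1
      exacts [absurd hs.1 (not_lt.2 h1.2), h1]

omit [IsManifold (𝓡 m) ∞ Ω] in
theorem mdifferentiable_of_contMDiff (hH : ContMDiff (𝓡 m) 𝓘(ℝ, ℝ) ∞ H) (x : Ω) :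
    MDifferentiableAt (𝓡 m) 𝓘(ℝ, ℝ) H x :=
  hH.mdifferentiable (by simp) x

/-- Conservation of energy. -/
theorem IsOrbit.energy_eq (hH : ContMDiff (𝓡 m) 𝓘(ℝ, ℝ) ∞ H) {γ : ℝ → Ω} {a b : ℝ}
    (h : σ.IsOrbit H γ (Icc a b)) {t : ℝ} (ht : t ∈ Icc a b) : H (γ t) = H (γ a) := by
  have h1 (t) (ht : t ∈ Icc a b) : HasDerivWithinAt (H ∘ γ) 0 (Icc a b) t := by
    have := hasVelocity_iff.1 ((h t ht).comp (mdifferentiable_of_contMDiff hH (γ t)))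
    rwa [← σ.bilin_field, σ.bilin_self] at this
  exact constant_of_has_deriv_right_zero (f := H ∘ γ) (fun t ht => (h1 t ht).continuousWithinAt)
    (fun t ht => (h1 t (Ico_subset_Icc_self ht)).mono_of_mem_nhdsWithin
      (mem_nhdsWithin.2 ⟨Iio b, isOpen_Iio, ht.2, fun s hs => ⟨ht.1.trans hs.2, hs.1.le⟩⟩)) t ht

/-- In a chart the Hamiltonian field is the inverse of the form applied to `dH`, hence smooth and
locally Lipschitz. Agreement at either end is allowed because uniqueness will be continued in both
time directions. -/
theorem exists_nhds_orbit_unique (σ : SymplecticForm m Ω)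
    (hH : ContMDiff (𝓡 m) 𝓘(ℝ, ℝ) ∞ H) (x : Ω) :
    ∃ N ∈ 𝓝 x, ∀ (a b : ℝ) (γ γ' : ℝ → Ω), σ.IsOrbit H γ (Icc a b) → σ.IsOrbit H γ' (Icc a b) →
      (∀ t ∈ Icc a b, γ t ∈ N ∧ γ' t ∈ N) → (γ a = γ' a ∨ γ b = γ' b) → EqOn γ γ' (Icc a b) := by
  have hφ := IsManifold.chart_mem_maximalAtlas (I := 𝓡 m) (n := ∞) x
  have hx : x ∈ (chartAt (EuclideanSpace ℝ (Fin m)) x).source := mem_chart_source _ x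
  generalize chartAt (EuclideanSpace ℝ (Fin m)) x = φ at hφ hx
  have hΨ := IsManifold.isSmoothChart_of_mem_maximalAtlas hφ
  let X : EuclideanSpace ℝ (Fin m) → EuclideanSpace ℝ (Fin m) := fun u =>
    ContinuousLinearMap.inverse (σ.formIn φ u) (fderiv ℝ (H ∘ φ.symm) u)
  have hinv (u) (hu : u ∈ φ.target) :=
    exists_continuousLinearEquiv_of_nondegenerate (σ.formIn φ u)
      fun v hv => σ.eq_zero_of_formIn hΨ hu hv
  have hXx (u) (hu : u ∈ φ.target) (v) (hv : ∀ w, σ.formIn φ u v w = fderiv ℝ (H ∘ φ.symm) u w) :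
      v = X u := by
    obtain ⟨e, he⟩ := hinv u hu
    have : fderiv ℝ (H ∘ φ.symm) u = e v := ContinuousLinearMap.ext fun w => by
      rw [← hv, ← he]; rfl
    simp only [X, this]
    rw [← he, ContinuousLinearMap.inverse_equiv]
    simp
  have hX : ContDiffAt ℝ 1 X (φ x) := by
    have hux := φ.map_source hx
    obtain ⟨e, he⟩ := hinv (φ x) hux
    have h1 : ContDiffAt ℝ ∞ (fun u => ContinuousLinearMap.inverse (σ.formIn φ u)) (φ x) :=
      ContDiffAt.comp (g := ContinuousLinearMap.inverse) (φ x) (he ▸ contDiffAt_map_inverse e)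
        ((σ.contDiffOn_formIn hφ).contDiffAt (φ.open_target.mem_nhds hux))
    refine (h1.clm_apply ((((contDiffOn_comp_symm hφ hH).contDiffAt
      (φ.open_target.mem_nhds hux))).fderiv_right (m := ∞) (by simp))).of_le ?_
    exact_mod_cast le_top
  obtain ⟨K, s, hs, hK⟩ := hX.exists_lipschitzOnWith
  refine ⟨φ.source ∩ φ ⁻¹' s, Filter.inter_mem (φ.open_source.mem_nhds hx)
    ((φ.continuousAt hx).preimage_mem_nhds hs), fun a b γ γ' hγ hγ' hN hab => ?_⟩
  have hder (γ : ℝ → Ω) (hγ : σ.IsOrbit H γ (Icc a b))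
      (hN : ∀ t ∈ Icc a b, γ t ∈ φ.source) (t) (ht : t ∈ Icc a b) :
      HasDerivWithinAt (φ ∘ γ) (X ((φ ∘ γ) t)) (Icc a b) t := by
    have h1 := hΨ.hasDerivWithinAt (hγ t ht) (hN t ht)
    rwa [hXx (φ (γ t)) (φ.map_source (hN t ht)) _ fun w =>
      σ.formIn_tderiv_field hΨ (hN t ht) (mdifferentiable_of_contMDiff hH _) w] at h1
  have d1 := hder γ hγ fun t ht => (hN t ht).1.1
  have d2 := hder γ' hγ' fun t ht => (hN t ht).2.1
  have hEq : EqOn (φ ∘ γ) (φ ∘ γ') (Icc a b) := by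
    rcases hab with hab | hab
    · refine ODE_solution_unique_of_mem_Icc_right (v := fun _ => X) (s := fun _ => s) (K := K)
        (fun t _ => hK) (fun t ht => (d1 t ht).continuousWithinAt) (fun t ht => ?_)
        (fun t ht => (hN t (Ico_subset_Icc_self ht)).1.2)
        (fun t ht => (d2 t ht).continuousWithinAt) (fun t ht => ?_)
        (fun t ht => (hN t (Ico_subset_Icc_self ht)).2.2) (congrArg φ hab)
      · exact (d1 t (Ico_subset_Icc_self ht)).mono_of_mem_nhdsWithin
          (mem_nhdsWithin.2 ⟨Iio b, isOpen_Iio, ht.2, fun s hs => ⟨ht.1.trans hs.2, hs.1.le⟩⟩)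
      · exact (d2 t (Ico_subset_Icc_self ht)).mono_of_mem_nhdsWithin
          (mem_nhdsWithin.2 ⟨Iio b, isOpen_Iio, ht.2, fun s hs => ⟨ht.1.trans hs.2, hs.1.le⟩⟩)
    · refine ODE_solution_unique_of_mem_Icc_left (v := fun _ => X) (s := fun _ => s) (K := K)
        (fun t _ => hK) (fun t ht => (d1 t ht).continuousWithinAt) (fun t ht => ?_)
        (fun t ht => (hN t (Ioc_subset_Icc_self ht)).1.2)
        (fun t ht => (d2 t ht).continuousWithinAt) (fun t ht => ?_)
        (fun t ht => (hN t (Ioc_subset_Icc_self ht)).2.2) (congrArg φ hab)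
      · exact (d1 t (Ioc_subset_Icc_self ht)).mono_of_mem_nhdsWithin
          (mem_nhdsWithin.2 ⟨Ioi a, isOpen_Ioi, ht.1, fun s hs => ⟨hs.1.le, hs.2.trans ht.2⟩⟩)
      · exact (d2 t (Ioc_subset_Icc_self ht)).mono_of_mem_nhdsWithin
          (mem_nhdsWithin.2 ⟨Ioi a, isOpen_Ioi, ht.1, fun s hs => ⟨hs.1.le, hs.2.trans ht.2⟩⟩)
  exact fun t ht => φ.injOn (hN t ht).1.1 (hN t ht).2.1 (hEq ht)

variable [T2Space Ω]

/-- Orbits which agree at one time agree. -/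
theorem IsOrbit.eqOn (hH : ContMDiff (𝓡 m) 𝓘(ℝ, ℝ) ∞ H) {γ γ' : ℝ → Ω} {a b : ℝ}
    (hγ : σ.IsOrbit H γ (Icc a b)) (hγ' : σ.IsOrbit H γ' (Icc a b)) {t₀ : ℝ} (ht₀ : t₀ ∈ Icc a b)
    (h : γ t₀ = γ' t₀) : EqOn γ γ' (Icc a b) := by
  intro t ht
  -- Agreement is locally constant in time: where the orbits agree by local uniqueness, where they
  -- differ by the Hausdorff property.
  have key := (isPreconnected_Icc (a := a) (b := b)).induction₂
    (fun s t => γ s = γ' s ↔ γ t = γ' t) (fun s hs => ?_) (fun _ _ _ _ _ _ h1 h2 => h1.trans h2)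
    (fun _ _ _ _ h => h.symm) ht₀ ht
  · exact key.1 h
  by_cases hss : γ s = γ' s
  · obtain ⟨N, hN, hNu⟩ := σ.exists_nhds_orbit_unique hH (γ s)
    have h1 := (hγ.continuousOn s hs).preimage_mem_nhdsWithin hN
    have h2 := (hγ'.continuousOn s hs).preimage_mem_nhdsWithin (hss ▸ hN)
    obtain ⟨ε, hε, hεN⟩ := Metric.mem_nhdsWithin_iff.1 (Filter.inter_mem h1 h2)
    have h3 : Metric.ball s ε ∩ Icc a b ∈ 𝓝[Icc a b] s :=
      Filter.inter_mem (mem_nhdsWithin_of_mem_nhds (Metric.ball_mem_nhds s hε)) self_mem_nhdsWithin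
    filter_upwards [h3] with t ht
    simp only [hss, true_iff]
    have hsub (r) (hr : r ∈ uIcc s t) : r ∈ Metric.ball s ε ∩ Icc a b := by
      refine ⟨?_, uIcc_subset_Icc hs ht.2 hr⟩
      exact (convex_ball s ε).ordConnected.uIcc_subset (Metric.mem_ball_self hε) ht.1 hr
    rcases le_total s t with hst | hst
    · rw [uIcc_of_le hst] at hsub
      exact hNu s t γ γ' (hγ.mono fun r hr => (hsub r hr).2) (hγ'.mono fun r hr => (hsub r hr).2)
        (fun r hr => hεN (hsub r hr)) (Or.inl hss) ⟨hst, le_rfl⟩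
    · rw [uIcc_of_ge hst] at hsub
      exact hNu t s γ γ' (hγ.mono fun r hr => (hsub r hr).2) (hγ'.mono fun r hr => (hsub r hr).2)
        (fun r hr => hεN (hsub r hr)) (Or.inr hss) ⟨le_rfl, hst⟩
  · have h1 : ∀ᶠ t in 𝓝[Icc a b] s, γ t ≠ γ' t :=
      ((hγ.continuousOn s hs).prodMk_nhds (hγ'.continuousOn s hs)).eventually
        (isClosed_diagonal.isOpen_compl.mem_nhds hss)
    filter_upwards [h1] with t ht
    simp only [hss, ht]

/-- An orbit through an equilibrium coincides with the constant orbit. -/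
theorem IsOrbit.field_ne_zero (hH : ContMDiff (𝓡 m) 𝓘(ℝ, ℝ) ∞ H) {γ : ℝ → Ω} {a b : ℝ}
    (hγ : σ.IsOrbit H γ (Icc a b)) {s t : ℝ} (hs : s ∈ Icc a b) (ht : t ∈ Icc a b)
    (h : σ.field H (γ s) ≠ 0) : σ.field H (γ t) ≠ 0 := by
  intro h0
  have hc : σ.IsOrbit H (fun _ => γ t) (Icc a b) := fun r _ => by
    rw [h0]
    refine HasMFDerivWithinAt.congr_mfderiv
      (hasMFDerivWithinAt_const (I := 𝓘(ℝ, ℝ)) (I' := 𝓡 m) (γ t) (Icc a b) r) ?_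
    refine ContinuousLinearMap.ext fun c => ?_
    exact (smul_zero (A := EuclideanSpace ℝ (Fin m)) (show ℝ from c)).symm
  exact h (hγ.eqOn hH hc ht rfl hs ▸ h0)

end Orbits

end SymplecticForm

/-! ### Local inverses -/

section LocalInverse

variable {E E' : Type*} [NormedAddCommGroup E] [NormedSpace ℝ E] [FiniteDimensional ℝ E]
  [NormedAddCommGroup E'] [NormedSpace ℝ E'] [FiniteDimensional ℝ E']

/-- The inverse function theorem for smooth maps between spaces of the same dimension. -/
theorem exists_openPartialHomeomorph_of_injective_fderiv
    (hEE' : Module.finrank ℝ E = Module.finrank ℝ E') {g : E → E'} {O : Set E} (hO : IsOpen O)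
    (hg : ContDiffOn ℝ ∞ g O) (hinj : ∀ z ∈ O, Function.Injective (fderiv ℝ g z)) {z₀ : E}
    (hz₀ : z₀ ∈ O) :
    ∃ e : OpenPartialHomeomorph E E', z₀ ∈ e.source ∧ e.source ⊆ O ∧ (∀ z, e z = g z) ∧
      ContDiffOn ℝ ∞ e.symm e.target := by
  have hequiv (z) (hz : z ∈ O) : ∃ T : E ≃L[ℝ] E', (T : E →L[ℝ] E') = fderiv ℝ g z :=
    ⟨(LinearEquiv.ofInjectiveOfFinrankEq (fderiv ℝ g z : E →ₗ[ℝ] E') (hinj z hz)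
      hEE').toContinuousLinearEquiv, ContinuousLinearMap.ext fun _ => rfl⟩
  have : CompleteSpace E := FiniteDimensional.complete ℝ E
  obtain ⟨T, hT⟩ := hequiv z₀ hz₀
  have hgz (z) (hz : z ∈ O) : ContDiffAt ℝ ∞ g z := hg.contDiffAt (hO.mem_nhds hz)
  have hd : HasFDerivAt g (T : E →L[ℝ] E') z₀ := by
    rw [hT]; exact ((hgz z₀ hz₀).differentiableAt (by simp)).hasFDerivAt
  let e₀ := (hgz z₀ hz₀).toOpenPartialHomeomorph g hd (by simp)
  have he₀ (z) : e₀ z = g z := rfl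
  refine ⟨e₀.restrOpen O hO, ?_, fun z hz => ?_, fun z => rfl, fun w hw => ?_⟩
  · rw [OpenPartialHomeomorph.restrOpen_source]
    exact ⟨(hgz z₀ hz₀).mem_toOpenPartialHomeomorph_source hd (by simp), hz₀⟩
  · rw [OpenPartialHomeomorph.restrOpen_source] at hz
    exact hz.2
  · have hz := (e₀.restrOpen O hO).map_target hw
    set z := (e₀.restrOpen O hO).symm w with hzw
    rw [OpenPartialHomeomorph.restrOpen_source] at hz
    obtain ⟨T', hT'⟩ := hequiv z hz.2
    refine ((e₀.restrOpen O hO).contDiffAt_symm (f₀' := T') hw ?_ ?_).contDiffWithinAt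
    · rw [hT']; exact ((hgz z hz.2).differentiableAt (by simp)).hasFDerivAt
    · exact hgz z hz.2

end LocalInverse

/-! ### Darboux charts on the manifold -/

namespace SymplecticForm

variable {m : ℕ} {Ω : Type*} [TopologicalSpace Ω]
  [ChartedSpace (EuclideanSpace ℝ (Fin m)) Ω] [IsManifold (𝓡 m) ∞ Ω]
  (σ : SymplecticForm m Ω) {H : Ω → ℝ}

/-- Symplectic coordinates near `x` in which the Hamiltonian `H` is `p₁`, up to a constant. -/
structure IsDarbouxChart (F : Type) [NormedAddCommGroup F] [InnerProductSpace ℝ F] (H : Ω → ℝ)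
    (x : Ω) (B : OpenPartialHomeomorph Ω (Phase F)) : Prop where
  isSmoothChart : IsSmoothChart (𝓡 m) B
  mem_source : x ∈ B.source
  apply_eq : B x = 0
  energy : ∀ z ∈ B.target, H (B.symm z) = H x + z.2.1
  formIn_eq : ∀ z ∈ B.target, σ.formIn B z = stdForm F

/-- A nonzero Hamiltonian field means `dH ≠ 0`, so `exists_local_darboux` applies in a chart. The
map it yields has injective derivative because it pulls a form back to the nondegenerate standard
one; as the dimensions agree it is a local diffeomorphism, whose inverse is the required chart. -/
theorem exists_isDarbouxChart {k : ℕ} (hm : m = 2 * (k + 1))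
    (hH : ContMDiff (𝓡 m) 𝓘(ℝ, ℝ) ∞ H) {x : Ω} (hx : σ.field H x ≠ 0) :
    ∃ B, σ.IsDarbouxChart (EuclideanSpace ℝ (Fin k)) H x B := by
  have hφ := IsManifold.chart_mem_maximalAtlas (I := 𝓡 m) (n := ∞) x
  have hxφ : x ∈ (chartAt (EuclideanSpace ℝ (Fin m)) x).source := mem_chart_source _ x
  generalize chartAt (EuclideanSpace ℝ (Fin m)) x = φ at hφ hxφ
  have hΨ := IsManifold.isSmoothChart_of_mem_maximalAtlas hφ
  have hE : Module.finrank ℝ (EuclideanSpace ℝ (Fin m)) = 2 * (k + 1) := by simp [hm]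
  have hh0 : fderiv ℝ (H ∘ φ.symm) (φ x) ≠ 0 := by
    intro h0
    have h1 : tderiv (𝓡 m) 𝓘(ℝ, EuclideanSpace ℝ (Fin m)) φ x (σ.field H x) = 0 :=
      σ.eq_zero_of_formIn hΨ (φ.map_source hxφ) fun w => by
        rw [σ.formIn_tderiv_field hΨ hxφ (mdifferentiable_of_contMDiff hH x), h0]; rfl
    have h2 := hΨ.tderiv_symm_tderiv hxφ (σ.field H x)
    rw [h1, map_zero] at h2
    exact hx h2.symm
  obtain ⟨g, hg, hg0, hgev⟩ := exists_local_darboux hE φ.open_target (φ.map_source hxφ)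
    (contDiffOn_comp_symm hφ hH) hh0 (σ.contDiffOn_formIn hφ) (fun u _ => σ.formIn_self φ u)
    (fun u hu v hv => σ.eq_zero_of_formIn hΨ hu hv) (fun u hu => σ.formIn_cyclic hφ hu)
  obtain ⟨O, hOsub, hO, hO0⟩ := eventually_nhds_iff.1 hgev
  have hinj (z) (hz : z ∈ O) : Function.Injective (fderiv ℝ g z) := by
    refine (injective_iff_map_eq_zero _).2 fun v hv => eq_zero_of_stdForm fun w => ?_
    rw [← (hOsub z hz).2.2, hv, map_zero, zero_apply]
  have hfr : Module.finrank ℝ (Phase (EuclideanSpace ℝ (Fin k))) =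
      Module.finrank ℝ (EuclideanSpace ℝ (Fin m)) := by
    rw [hE]; simp; ring
  obtain ⟨e, he0, heO, heg, hes⟩ := exists_openPartialHomeomorph_of_injective_fderiv hfr hO
    hg.contDiffOn hinj hO0
  let B := φ.trans e.symm
  have hBsymm (z) : B.symm z = φ.symm (g z) := by
    change φ.symm (e z) = _
    rw [heg]
  have hsrc (y) (hy : y ∈ B.source) : y ∈ φ.source ∧ φ y ∈ e.target := by
    simpa [B] using hy
  have htgt (z) (hz : z ∈ B.target) : z ∈ e.source ∧ g z ∈ φ.target := by
    have := hz
    simp only [B, OpenPartialHomeomorph.trans_target, OpenPartialHomeomorph.symm_target,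
      OpenPartialHomeomorph.symm_symm, mem_inter_iff, mem_preimage] at this
    rwa [heg] at this
  have hB : IsSmoothChart (𝓡 m) B := by
    refine ⟨?_, ?_⟩
    · have h1 : ContMDiffOn (𝓡 m) 𝓘(ℝ, EuclideanSpace ℝ (Fin m)) ∞ φ B.source :=
        hΨ.contMDiffOn.mono fun y hy => (hsrc y hy).1
      exact (contMDiffOn_iff_contDiffOn.2 hes).comp h1 fun y hy => (hsrc y hy).2
    · have h1 : ContMDiffOn 𝓘(ℝ, Phase (EuclideanSpace ℝ (Fin k)))
          𝓘(ℝ, EuclideanSpace ℝ (Fin m)) ∞ g B.target := hg.contDiffOn.contMDiffOn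
      refine (hΨ.contMDiffOn_symm.comp h1 fun z hz => (htgt z hz).2).congr fun z _ => hBsymm z
  have hBx : B x = 0 := by
    change e.symm (φ x) = 0
    rw [← hg0, ← heg, e.left_inv he0]
  refine ⟨B, hB, ?_, hBx, fun z hz => ?_, fun z hz => ?_⟩
  · have : φ x ∈ e.target := by
      rw [← hg0, ← heg]; exact e.map_source he0
    simpa [B] using ⟨hxφ, this⟩
  · rw [hBsymm]
    have := (hOsub z (heO (htgt z hz).1)).2.1
    simpa [φ.left_inv hxφ] using this
  · refine ContinuousLinearMap.ext fun v => ContinuousLinearMap.ext fun w => ?_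
    rw [← (hOsub z (heO (htgt z hz).1)).2.2 v w, formIn_apply, formIn_apply]
    have h1 : tderiv 𝓘(ℝ, Phase (EuclideanSpace ℝ (Fin k))) (𝓡 m) B.symm z =
        (tderiv 𝓘(ℝ, EuclideanSpace ℝ (Fin m)) (𝓡 m) φ.symm (g z)).comp (fderiv ℝ g z) := by
      rw [← tderiv_eq_fderiv, ← tderiv_comp (hΨ.mdifferentiableAt_symm (htgt z hz).2)
        (hg.differentiable (by simp) z).mdifferentiableAt]
      exact Filter.EventuallyEq.tderiv_eq (Filter.Eventually.of_forall hBsymm)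
    rw [h1, hBsymm]
    rfl

end SymplecticForm

/-! ### Transport of a section by the flow -/

namespace SymplecticForm

section Transport

variable {m : ℕ} {Ω : Type*} [TopologicalSpace Ω]
  [ChartedSpace (EuclideanSpace ℝ (Fin m)) Ω] [IsManifold (𝓡 m) ∞ Ω]
  {σ : SymplecticForm m Ω} {H : Ω → ℝ}
  {F : Type} [NormedAddCommGroup F] [InnerProductSpace ℝ F]
  {x : Ω} {B : OpenPartialHomeomorph Ω (Phase F)}

omit [InnerProductSpace ℝ F] in
theorem norm_flowDir : ‖flowDir F‖ = 1 := by
  simp [flowDir, Prod.norm_def]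

theorem norm_add_smul_flowDir_le (z : Phase F) (r : ℝ) : ‖z + r • flowDir F‖ ≤ ‖z‖ + |r| := by
  refine (norm_add_le _ _).trans ?_
  rw [norm_smul, norm_flowDir, mul_one, Real.norm_eq_abs]

namespace IsDarbouxChart

variable (hB : σ.IsDarbouxChart F H x B)
include hB

theorem fderiv_energy {z : Phase F} (hz : z ∈ B.target) :
    fderiv ℝ (H ∘ B.symm) z = stdForm F (flowDir F) := by
  refine HasFDerivAt.fderiv ?_
  refine ((stdForm F (flowDir F)).hasFDerivAt.const_add (H x)).congr_of_eventuallyEq ?_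
  filter_upwards [B.open_target.mem_nhds hz] with w hw
  rw [Function.comp_apply, hB.energy w hw, stdForm_flowDir]

theorem energy_apply {y : Ω} (hy : y ∈ B.source) : H y = H x + (B y).2.1 := by
  rw [← hB.energy _ (B.map_source hy), B.left_inv hy]

theorem exists_ball : ∃ a > 0, Metric.ball 0 a ⊆ B.target := by
  refine Metric.isOpen_iff.1 B.open_target 0 ?_
  rw [← hB.apply_eq]
  exact B.map_source hB.mem_source

theorem bilin_eq {y : Ω} (hy : y ∈ B.source) (v w : EuclideanSpace ℝ (Fin m)) :
    σ.bilin y v w = stdForm F (tderiv (𝓡 m) 𝓘(ℝ, Phase F) B y v)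
      (tderiv (𝓡 m) 𝓘(ℝ, Phase F) B y w) := by
  rw [← hB.formIn_eq _ (B.map_source hy), formIn_apply, hB.isSmoothChart.tderiv_symm_tderiv hy,
    hB.isSmoothChart.tderiv_symm_tderiv hy, B.left_inv hy]

theorem isOrbit_line (hH : ContMDiff (𝓡 m) 𝓘(ℝ, ℝ) ∞ H) {z : Phase F} {s : Set ℝ} {c : ℝ}
    (hz : ∀ r ∈ s, z + (r - c) • flowDir F ∈ B.target) :
    σ.IsOrbit H (fun r => B.symm (z + (r - c) • flowDir F)) s := fun r hr => by
  have h1 : HasDerivWithinAt (fun r : ℝ => z + (r - c) • flowDir F) (flowDir F) s r := by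
    have := (((hasDerivAt_id r).sub_const c).smul_const (flowDir F)).const_add z
    simpa using this.hasDerivWithinAt
  refine σ.hasVelocity_of_formIn hB.isSmoothChart h1 (hz r hr)
    (mdifferentiable_of_contMDiff hH _) fun w => ?_
  rw [hB.formIn_eq _ (hz r hr), hB.fderiv_energy (hz r hr)]

/-- The norm bound keeps the coordinate line inside the ball up to time `t`; the line is an orbit
there, and orbits are unique. -/
theorem orbit_eq_line [T2Space Ω] (hH : ContMDiff (𝓡 m) 𝓘(ℝ, ℝ) ∞ H) {γ : ℝ → Ω} {s : Set ℝ}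
    (hs : s.OrdConnected) (hγ : σ.IsOrbit H γ s) {t₀ t : ℝ} (ht₀ : t₀ ∈ s) (ht : t ∈ s)
    (hsrc : γ t₀ ∈ B.source) {a : ℝ} (ha : Metric.ball 0 a ⊆ B.target)
    (hta : ‖B (γ t₀)‖ + |t - t₀| < a) :
    γ t = B.symm (B (γ t₀) + (t - t₀) • flowDir F) := by
  have hline : σ.IsOrbit H (fun r => B.symm (B (γ t₀) + (r - t₀) • flowDir F)) (uIcc t₀ t) := by
    refine hB.isOrbit_line hH fun r hr => ha ?_
    rw [mem_ball_zero_iff]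
    refine (norm_add_smul_flowDir_le _ _).trans_lt (lt_of_le_of_lt ?_ hta)
    gcongr 1
    exact abs_sub_left_of_mem_uIcc hr
  exact (hγ.mono (hs.uIcc_subset ht₀ ht)).eqOn hH hline left_mem_uIcc (by simp [B.left_inv hsrc])
    right_mem_uIcc

end IsDarbouxChart

variable {d : ℕ} {S : Type*} [TopologicalSpace S] [ChartedSpace (EuclideanSpace ℝ (Fin d)) S]
  {ι : S → Ω} {Γ : S → ℝ → Ω} {τ : S → ℝ} {y₀ : S}

variable (σ d) in
/-- Two maps to the symplectic manifold pull back the symplectic form to the same form near `y₀`. -/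
def SmoothTransport (ι : S → Ω) (f : S → Ω) (y₀ : S) : Prop :=
  ∀ᶠ y in 𝓝 y₀, ContMDiffAt (𝓡 d) (𝓡 m) ∞ f y ∧
    ∀ v w, σ.bilin (f y) (tderiv (𝓡 d) (𝓡 m) f y v) (tderiv (𝓡 d) (𝓡 m) f y w) =
      σ.bilin (ι y) (tderiv (𝓡 d) (𝓡 m) ι y v) (tderiv (𝓡 d) (𝓡 m) ι y w)

/-- The form is constant in a Darboux chart, so translations do not change pullbacks. -/
theorem SmoothTransport.translate (hB : σ.IsDarbouxChart F H x B) {f f' : S → Ω}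
    (hf : σ.SmoothTransport d ι f y₀) (hsrc : f y₀ ∈ B.source) {r : ℝ}
    (hr : B (f y₀) + r • flowDir F ∈ B.target)
    (hff' : ∀ᶠ y in 𝓝 y₀, f' y = B.symm (B (f y) + r • flowDir F)) :
    σ.SmoothTransport d ι f' y₀ := by
  have hΨ := hB.isSmoothChart
  have hf0 : ContinuousAt f y₀ := hf.self_of_nhds.1.continuousAt
  have h1 : ∀ᶠ y in 𝓝 y₀, f y ∈ B.source := hf0.eventually (B.open_source.mem_nhds hsrc)
  have h2 : ∀ᶠ y in 𝓝 y₀, B (f y) + r • flowDir F ∈ B.target := by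
    have : ContinuousAt (fun y => B (f y) + r • flowDir F) y₀ :=
      (ContinuousAt.comp (f := f) (x := y₀) (B.continuousAt hsrc) hf0).add continuousAt_const
    exact this.eventually (B.open_target.mem_nhds hr)
  filter_upwards [hf, h1, h2, hff'.eventually_nhds] with y hy1 hy2 hy3 hy4
  have hfd : MDifferentiableAt (𝓡 d) (𝓡 m) f y := hy1.1.mdifferentiableAt (by simp)
  have hBf : ContMDiffAt (𝓡 d) 𝓘(ℝ, Phase F) ∞ (fun y => B (f y) + r • flowDir F) y :=
    ((hΨ.contMDiffAt hy2).comp y hy1.1).add contMDiffAt_const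
  have hsm : ContMDiffAt (𝓡 d) (𝓡 m) ∞ (fun y => B.symm (B (f y) + r • flowDir F)) y :=
    (hΨ.contMDiffAt_symm hy3).comp y hBf
  refine ⟨hsm.congr_of_eventuallyEq hy4, fun v w => ?_⟩
  have hd : tderiv (𝓡 d) 𝓘(ℝ, Phase F) (fun y => B (f y) + r • flowDir F) y =
      (tderiv (𝓡 m) 𝓘(ℝ, Phase F) B (f y)).comp (tderiv (𝓡 d) (𝓡 m) f y) := by
    have e1 : MDifferentiableAt 𝓘(ℝ, Phase F) 𝓘(ℝ, Phase F) (fun z => z + r • flowDir F)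
        (B (f y)) := (differentiableAt_id.add_const _).mdifferentiableAt
    have e2 := tderiv_comp (I := 𝓡 d) (f := B ∘ f) (x := y) e1
      ((hΨ.mdifferentiableAt hy2).comp y hfd)
    rw [tderiv_eq_fderiv, tderiv_comp (hΨ.mdifferentiableAt hy2) hfd] at e2
    refine e2.trans ?_
    rw [fderiv_add_const, fderiv_fun_id]
    exact ContinuousLinearMap.id_comp _
  have hd' : tderiv (𝓡 d) (𝓡 m) f' y =
      (tderiv 𝓘(ℝ, Phase F) (𝓡 m) B.symm (B (f y) + r • flowDir F)).comp
        ((tderiv (𝓡 m) 𝓘(ℝ, Phase F) B (f y)).comp (tderiv (𝓡 d) (𝓡 m) f y)) := by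
    rw [← hd, Filter.EventuallyEq.tderiv_eq hy4]
    exact tderiv_comp (g := B.symm) (hΨ.mdifferentiableAt_symm hy3)
      (hBf.mdifferentiableAt (by simp))
  rw [← hy1.2 v w, hd', hy4.self_of_nhds, hB.bilin_eq hy2]
  have e := congrArg (fun T : Phase F →L[ℝ] Phase F →L[ℝ] ℝ =>
    T (tderiv (𝓡 m) 𝓘(ℝ, Phase F) B (f y) (tderiv (𝓡 d) (𝓡 m) f y v))
      (tderiv (𝓡 m) 𝓘(ℝ, Phase F) B (f y) (tderiv (𝓡 d) (𝓡 m) f y w))) (hB.formIn_eq _ hy3)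
  simp only [formIn_apply] at e
  exact e

/-- The flow is smooth and symplectic. -/
theorem smoothTransport_flow [T2Space Ω] {k : ℕ} (hm : m = 2 * (k + 1))
    (hH : ContMDiff (𝓡 m) 𝓘(ℝ, ℝ) ∞ H) (hι : ContMDiff (𝓡 d) (𝓡 m) ∞ ι) (hτ : Continuous τ)
    (hΓ : ∀ y, σ.IsOrbit H (Γ y) (Icc 0 (τ y))) (hΓ0 : ∀ y, Γ y 0 = ι y)
    (hfield : σ.field H (ι y₀) ≠ 0) {t : ℝ} (ht : t ∈ Ico 0 (τ y₀)) :
    σ.SmoothTransport d ι (fun y => Γ y t) y₀ := by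
  -- The property is locally constant in time: near time `s`, maps at two times differ by a
  -- translation in a Darboux chart at `Γ y₀ s`. The final time is excluded so that the orbits of
  -- points near `y₀` are still defined.
  have key := (isPreconnected_Ico (a := 0) (b := τ y₀)).induction₂
    (fun s t => σ.SmoothTransport d ι (fun y => Γ y s) y₀ ↔ σ.SmoothTransport d ι (fun y => Γ y t) y₀)
    (fun s hs => ?_) (fun _ _ _ _ _ _ h1 h2 => h1.trans h2)
    (fun _ _ _ _ h => h.symm) (x := 0) ⟨le_rfl, ht.1.trans_lt ht.2⟩ ht
  · refine key.1 (Filter.Eventually.of_forall fun y => ⟨?_, fun v w => ?_⟩)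
    · simp only [hΓ0]
      exact hι y
    · simp only [hΓ0]
  have hs' : s ∈ Icc 0 (τ y₀) := ⟨hs.1, hs.2.le⟩
  have hne : σ.field H (Γ y₀ s) ≠ 0 :=
    (hΓ y₀).field_ne_zero hH ⟨le_rfl, hs.1.trans hs.2.le⟩ hs' (by rwa [hΓ0])
  obtain ⟨B, hB⟩ := σ.exists_isDarbouxChart hm hH hne
  obtain ⟨a, ha, haB⟩ := hB.exists_ball
  have hmove (r r' : ℝ) (hr : r ∈ Ico 0 (τ y₀)) (hr' : r' ∈ Ico 0 (τ y₀)) (hra : |r - s| < a / 4)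
      (hra' : |r' - s| < a / 4) (h : σ.SmoothTransport d ι (fun y => Γ y r) y₀) :
      σ.SmoothTransport d ι (fun y => Γ y r') y₀ := by
    have hrr' : |r' - r| < a / 2 := by
      have := abs_sub_le r' s r
      rw [abs_sub_comm s r] at this
      linarith
    have h1 : Γ y₀ r = B.symm (B (Γ y₀ s) + (r - s) • flowDir _) :=
      hB.orbit_eq_line hH ordConnected_Icc (hΓ y₀) hs' ⟨hr.1, hr.2.le⟩ hB.mem_source haB (by
        rw [hB.apply_eq, norm_zero]; linarith)
    have h2 : B (Γ y₀ s) + (r - s) • flowDir _ ∈ B.target := haB (by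
      rw [mem_ball_zero_iff]
      refine (norm_add_smul_flowDir_le _ _).trans_lt ?_
      rw [hB.apply_eq, norm_zero]; linarith)
    have hsrc : Γ y₀ r ∈ B.source := by rw [h1]; exact B.map_target h2
    have hBr : ‖B (Γ y₀ r)‖ < a / 4 := by
      rw [h1, B.right_inv h2, hB.apply_eq, zero_add, norm_smul, norm_flowDir, mul_one]
      exact hra
    have hcont : ContinuousAt (fun y => Γ y r) y₀ := h.self_of_nhds.1.continuousAt
    refine h.translate hB hsrc (r := r' - r) (haB ?_) ?_
    · rw [mem_ball_zero_iff]
      refine (norm_add_smul_flowDir_le _ _).trans_lt ?_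
      linarith
    · have e1 : ∀ᶠ y in 𝓝 y₀, Γ y r ∈ B.source := hcont.eventually (B.open_source.mem_nhds hsrc)
      have e2 : ∀ᶠ y in 𝓝 y₀, ‖B (Γ y r)‖ < a / 4 :=
        (ContinuousAt.comp (g := B) (f := fun y => Γ y r) (x := y₀) (B.continuousAt hsrc)
          hcont).norm.eventually_lt continuousAt_const hBr
      have e3 : ∀ᶠ y in 𝓝 y₀, r < τ y := continuousAt_const.eventually_lt hτ.continuousAt hr.2
      have e4 : ∀ᶠ y in 𝓝 y₀, r' < τ y := continuousAt_const.eventually_lt hτ.continuousAt hr'.2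
      filter_upwards [e1, e2, e3, e4] with y hy1 hy2 hy3 hy4
      exact hB.orbit_eq_line hH ordConnected_Icc (hΓ y) ⟨hr.1, hy3.le⟩ ⟨hr'.1, hy4.le⟩ hy1 haB
        (by linarith)
  have hball : ∀ᶠ r in 𝓝[Ico 0 (τ y₀)] s, |r - s| < a / 4 := by
    filter_upwards [mem_nhdsWithin_of_mem_nhds (Metric.ball_mem_nhds s (ε := a / 4)
      (by positivity))] with r hr
    simpa [Real.dist_eq] using hr
  filter_upwards [hball, self_mem_nhdsWithin] with r hr1 hr2
  exact ⟨hmove s r hs hr2 (by simpa using ha) hr1, hmove r s hr2 hs hr1 (by simpa using ha)⟩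

end Transport

end SymplecticForm

/-- In the charts of an immersion the map is `u ↦ (u, 0)` followed by a linear isomorphism. -/
theorem Manifold.IsImmersionAt.eq_zero_of_tderiv {d m : ℕ} {S Ω : Type*} [TopologicalSpace S]
    [ChartedSpace (EuclideanSpace ℝ (Fin d)) S] [TopologicalSpace Ω]
    [ChartedSpace (EuclideanSpace ℝ (Fin m)) Ω] [IsManifold (𝓡 m) ∞ Ω]
    [IsManifold (𝓡 d) ∞ S] {ι : S → Ω} {y : S}
    (h : IsImmersionAt (𝓡 d) (𝓡 m) ∞ ι y) {v : EuclideanSpace ℝ (Fin d)}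
    (hv : tderiv (𝓡 d) (𝓡 m) ι y v = 0) : v = 0 := by
  have hφ := IsManifold.isSmoothChart_of_mem_maximalAtlas h.domChart_mem_maximalAtlas
  have hψ := IsManifold.isSmoothChart_of_mem_maximalAtlas h.codChart_mem_maximalAtlas
  have hy := h.mem_domChart_source
  have hιy := h.mem_codChart_source
  have hw : EqOn (h.codChart ∘ ι ∘ h.domChart.symm) (h.equiv ∘ fun u => (u, 0))
      h.domChart.target := fun u hu => by
    simpa using h.writtenInCharts (show u ∈ (h.domChart.extend (𝓡 d)).target by simpa using hu)
  have hyt := h.domChart.map_source hy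
  have d1 : MDifferentiableAt (𝓡 d) (𝓡 m) ι (h.domChart.symm (h.domChart y)) := by
    rw [h.domChart.left_inv hy]
    exact h.contMDiffAt.mdifferentiableAt (by simp)
  have d2 : MDifferentiableAt (𝓡 m) 𝓘(ℝ, EuclideanSpace ℝ (Fin m)) h.codChart
      ((ι ∘ h.domChart.symm) (h.domChart y)) := by
    rw [Function.comp_apply, h.domChart.left_inv hy]
    exact hψ.mdifferentiableAt hιy
  have e1 := tderiv_comp d2 (d1.comp _ (hφ.mdifferentiableAt_symm hyt))
  rw [tderiv_comp d1 (hφ.mdifferentiableAt_symm hyt), tderiv_eq_fderiv,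
    (hw.eventuallyEq_of_mem (h.domChart.open_target.mem_nhds hyt)).fderiv_eq] at e1
  have e2 : HasFDerivAt (h.equiv ∘ fun u => (u, 0))
      (h.equiv.toContinuousLinearMap.comp (.inl ℝ _ _)) (h.domChart y) :=
    (h.equiv.toContinuousLinearMap.comp
      (.inl ℝ (EuclideanSpace ℝ (Fin d)) h.complement)).hasFDerivAt
  rw [e2.fderiv] at e1
  have e3 := congrArg (fun T : EuclideanSpace ℝ (Fin d) →L[ℝ] EuclideanSpace ℝ (Fin m) =>
    T (tderiv (𝓡 d) 𝓘(ℝ, EuclideanSpace ℝ (Fin d)) h.domChart y v)) e1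
  simp only [ContinuousLinearMap.comp_apply, hφ.tderiv_symm_tderiv hy, h.domChart.left_inv hy, hv,
    map_zero] at e3
  have e4 : h.equiv (tderiv (𝓡 d) 𝓘(ℝ, EuclideanSpace ℝ (Fin d)) h.domChart y v, 0) = 0 := e3
  have e5 := congrArg Prod.fst (h.equiv.map_eq_zero_iff.1 e4)
  rw [← hφ.tderiv_symm_tderiv hy v, show tderiv (𝓡 d) 𝓘(ℝ, EuclideanSpace ℝ (Fin d)) h.domChart y v
    = 0 from e5, map_zero]

/-! ### Passages between sections, and transversality -/

namespace SymplecticForm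

variable {m : ℕ} {Ω : Type*} [TopologicalSpace Ω]
  [ChartedSpace (EuclideanSpace ℝ (Fin m)) Ω] [IsManifold (𝓡 m) ∞ Ω]
  {σ : SymplecticForm m Ω} {H : Ω → ℝ}

section Sets

variable {S₀ S₁ : Type*}

variable (σ) in
/-- `Γ y`, `y ∈ S₀`, are the orbits from `S₀` to `S₁` defining the Poincaré map `R`, and `τ y` are the
passage times. -/
structure IsPassage (H : Ω → ℝ) (ι₀ : S₀ → Ω) (ι₁ : S₁ → Ω) (R : S₀ → S₁) (Γ : S₀ → ℝ → Ω)
    (τ : S₀ → ℝ) : Prop where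
  pos : ∀ y, 0 < τ y
  orbit : ∀ y, σ.IsOrbit H (Γ y) (Icc 0 (τ y))
  start : ∀ y, Γ y 0 = ι₀ y
  finish : ∀ y, Γ y (τ y) = ι₁ (R y)
  first : ∀ y, ∀ t ∈ Ioo 0 (τ y), Γ y t ∉ range ι₁

variable {ι₀ : S₀ → Ω} {ι₁ : S₁ → Ω} {R : S₀ → S₁} {Γ : S₀ → ℝ → Ω} {τ : S₀ → ℝ}

theorem IsPassage.energy_eq (h : σ.IsPassage H ι₀ ι₁ R Γ τ) (hH : ContMDiff (𝓡 m) 𝓘(ℝ, ℝ) ∞ H)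
    {y : S₀} {t : ℝ} (ht : t ∈ Icc 0 (τ y)) : H (Γ y t) = H (ι₀ y) := by
  rw [(h.orbit y).energy_eq hH ht, h.start]

variable [T2Space Ω]

/-- If one passage were shorter, the longer orbit would meet `S₁` too early. This allows a given
passage to be replaced by a member of a chosen family. -/
theorem IsFirstPassage.eqOn {x : Ω} {T T' : ℝ} {γ γ' : ℝ → Ω} {z z' : S₁}
    (hH : ContMDiff (𝓡 m) 𝓘(ℝ, ℝ) ∞ H) (h : σ.IsFirstPassage H ι₁ x T γ z)
    (h' : σ.IsFirstPassage H ι₁ x T' γ' z') : T = T' ∧ EqOn γ γ' (Icc 0 T) := by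
  have o : σ.IsOrbit H γ (Icc 0 T) := h.integralCurve
  have o' : σ.IsOrbit H γ' (Icc 0 T') := h'.integralCurve
  have hs : γ 0 = γ' 0 := h.start.trans h'.start.symm
  rcases lt_trichotomy T T' with hT | rfl | hT
  · refine absurd ⟨z, ?_⟩ (h'.first T ⟨h.pos, hT⟩)
    rw [← h.finish]
    exact o.eqOn hH (o'.mono (Icc_subset_Icc_right hT.le)) ⟨le_rfl, h.pos.le⟩ hs ⟨h.pos.le, le_rfl⟩
  · exact ⟨rfl, o.eqOn hH o' ⟨le_rfl, h.pos.le⟩ hs⟩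
  · refine absurd ⟨z', ?_⟩ (h.first T' ⟨h'.pos, hT⟩)
    rw [← h'.finish]
    exact (o'.eqOn hH (o.mono (Icc_subset_Icc_right hT.le)) ⟨le_rfl, h'.pos.le⟩ hs.symm
      ⟨h'.pos.le, le_rfl⟩)

/-- Distinct orbits do not meet before they have reached `S₁`. -/
theorem IsPassage.injective (h : σ.IsPassage H ι₀ ι₁ R Γ τ) (hH : ContMDiff (𝓡 m) 𝓘(ℝ, ℝ) ∞ H)
    (hι₁ : Function.Injective ι₁) (hR : Function.Injective R) {y y' : S₀} {t t' : ℝ}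
    (ht : t ∈ Icc 0 (τ y)) (ht' : t' ∈ Ioo 0 (τ y')) (heq : Γ y t = Γ y' t') : y = y' ∧ t = t' := by
  have htτ : t < τ y := by
    refine lt_of_le_of_ne ht.2 fun h0 => h.first y' t' ht' ⟨R y, ?_⟩
    rw [← h.finish, ← heq, h0]
  have hagree (r : ℝ) (hr : 0 ≤ r) (hr1 : r ≤ τ y - t) (hr2 : r ≤ τ y' - t') :
      Γ y (t + r) = Γ y' (t' + r) := by
    have o1 := ((h.orbit y).mono (Icc_subset_Icc ht.1 (by linarith : t + r ≤ _))).comp_add t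
    have o2 := ((h.orbit y').mono (Icc_subset_Icc ht'.1.le (by linarith : t' + r ≤ _))).comp_add t'
    rw [sub_self, add_sub_cancel_left] at o1 o2
    have := o1.eqOn hH o2 ⟨le_rfl, hr⟩ (by simpa using heq) ⟨hr, le_rfl⟩
    simpa [add_comm] using this
  -- From the common point on the orbits coincide, so they reach `S₁` simultaneously, for otherwise
  -- the later one would meet it before its first passage. Then they end at the same point and
  -- injectivity of `R` identifies the starts.
  have hrem : τ y - t = τ y' - t' := by
    rcases lt_trichotomy (τ y - t) (τ y' - t') with hlt | h0 | hlt
    · have h1 := hagree (τ y - t) (by linarith) le_rfl hlt.le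
      refine absurd ⟨R y, ?_⟩ (h.first y' (t' + (τ y - t)) ⟨by linarith [ht'.1], by linarith⟩)
      rw [← h1, add_sub_cancel, h.finish]
    · exact h0
    · have h1 := hagree (τ y' - t') (by linarith [ht'.2]) hlt.le le_rfl
      refine absurd ⟨R y', ?_⟩ (h.first y (t + (τ y' - t')) ⟨by linarith [ht.1, ht'.2], by linarith⟩)
      rw [h1, add_sub_cancel, h.finish]
  have h1 := hagree (τ y - t) (by linarith) le_rfl hrem.le
  nth_rw 2 [hrem] at h1
  rw [add_sub_cancel, add_sub_cancel, h.finish, h.finish] at h1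
  obtain rfl := hR (hι₁ h1)
  exact ⟨rfl, by linarith⟩

end Sets

section Sections

variable {d : ℕ} {S : Type*} [TopologicalSpace S] [ChartedSpace (EuclideanSpace ℝ (Fin d)) S]
  {ι : S → Ω} {y : S}

/-- A vector tangent to a transverse hypersurface which is orthogonal to the hypersurface and to the
Hamiltonian vector field vanishes. -/
theorem tderiv_eq_zero_of_transverse (hd : d + 1 = m)
    (hinj : ∀ v, tderiv (𝓡 d) (𝓡 m) ι y v = 0 → v = 0)
    (htr : σ.field H (ι y) ∉ range (tderiv (𝓡 d) (𝓡 m) ι y)) {v : EuclideanSpace ℝ (Fin m)}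
    (h : ∀ v', σ.bilin (ι y) v (tderiv (𝓡 d) (𝓡 m) ι y v') = 0)
    (hX : tderiv (𝓡 m) 𝓘(ℝ, ℝ) H (ι y) v = 0) : v = 0 := by
  -- By transversality and a dimension count the hypersurface and the field together span the
  -- tangent space.
  let T : (EuclideanSpace ℝ (Fin d) × ℝ) →ₗ[ℝ] EuclideanSpace ℝ (Fin m) :=
    (tderiv (𝓡 d) (𝓡 m) ι y : EuclideanSpace ℝ (Fin d) →ₗ[ℝ] EuclideanSpace ℝ (Fin m)).coprod
      (LinearMap.toSpanSingleton ℝ _ (σ.field H (ι y)))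
  have hT (p) : T p = tderiv (𝓡 d) (𝓡 m) ι y p.1 + p.2 • σ.field H (ι y) := rfl
  have hTinj : Function.Injective T := by
    rw [injective_iff_map_eq_zero]
    rintro ⟨u, c⟩ hp
    rw [hT] at hp
    have hc : c = 0 := by
      by_contra hc
      refine htr ⟨-c⁻¹ • u, ?_⟩
      rw [map_smul, eq_neg_of_add_eq_zero_left hp, smul_neg, neg_smul, neg_neg, smul_smul,
        inv_mul_cancel₀ hc, one_smul]
    subst hc
    rw [zero_smul, add_zero] at hp
    rw [hinj u hp]
    rfl
  have hTsurj := (LinearMap.injective_iff_surjective_of_finrank_eq_finrank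
    (by simp [← hd])).1 hTinj
  refine σ.eq_zero_of_bilin (x := ι y) fun w => ?_
  obtain ⟨p, rfl⟩ := hTsurj w
  rw [hT, map_add, h, map_smul, σ.bilin_skew, bilin_field, hX]
  simp

end Sections

end SymplecticForm

section Forms

variable {F : Type} [NormedAddCommGroup F] [InnerProductSpace ℝ F]

theorem stdForm_eq_areaForm {u v : Phase F} (hu : u.2.1 = 0) (hv : v.2.1 = 0) :
    stdForm F u v = areaForm F (transversal F u).2 (transversal F v).2 := by
  rw [stdForm_apply, areaForm_apply, transversal_apply, transversal_apply]
  simp [pairing, hu, hv]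

theorem transversal_flowDir : transversal F (flowDir F) = 0 := rfl

end Forms

theorem ContinuousLinearMap.tderiv_comp {V A M E E' : Type*} [NormedAddCommGroup V]
    [NormedSpace ℝ V] [TopologicalSpace A] {I : ModelWithCorners ℝ V A} [TopologicalSpace M]
    [ChartedSpace A M] [NormedAddCommGroup E] [NormedSpace ℝ E] [NormedAddCommGroup E']
    [NormedSpace ℝ E'] (L : E →L[ℝ] E') {b : M → E} {y : M}
    (hb : MDifferentiableAt I 𝓘(ℝ, E) b y) :
    tderiv I 𝓘(ℝ, E') (L ∘ b) y = L.comp (tderiv I 𝓘(ℝ, E) b y) := by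
  rw [_root_.tderiv_comp (J := 𝓘(ℝ, E)) L.differentiableAt.mdifferentiableAt hb, tderiv_eq_fderiv,
    L.fderiv]

namespace SymplecticForm

variable {m : ℕ} {Ω : Type*} [TopologicalSpace Ω]
  [ChartedSpace (EuclideanSpace ℝ (Fin m)) Ω] [IsManifold (𝓡 m) ∞ Ω]
  {σ : SymplecticForm m Ω} {H : Ω → ℝ}
  {F : Type} [NormedAddCommGroup F] [InnerProductSpace ℝ F]
  {x : Ω} {B : OpenPartialHomeomorph Ω (Phase F)}
  {d : ℕ} {S : Type*} [TopologicalSpace S] [ChartedSpace (EuclideanSpace ℝ (Fin d)) S]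
  {ι f : S → Ω} {y₀ : S}

/-- Conservation of energy makes the coordinate `p₁` of `f y` a function of the starting point
alone, namely `H (ι y) - H x`; differentiating gives the last clause. -/
theorem SmoothTransport.eventually_chart (hf : σ.SmoothTransport d ι f y₀)
    (hB : σ.IsDarbouxChart F H x B) (hsrc : f y₀ ∈ B.source)
    (hE : ∀ᶠ y in 𝓝 y₀, H (f y) = H (ι y)) :
    ∀ᶠ y in 𝓝 y₀, f y ∈ B.source ∧ ContMDiffAt (𝓡 d) 𝓘(ℝ, Phase F) ∞ (B ∘ f) y ∧
      (∀ v w, stdForm F (tderiv (𝓡 d) 𝓘(ℝ, Phase F) (B ∘ f) y v)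
        (tderiv (𝓡 d) 𝓘(ℝ, Phase F) (B ∘ f) y w) =
        σ.bilin (ι y) (tderiv (𝓡 d) (𝓡 m) ι y v) (tderiv (𝓡 d) (𝓡 m) ι y w)) ∧
      (B (f y)).2.1 = H (ι y) - H x ∧
      ∀ v, (tderiv (𝓡 d) 𝓘(ℝ, Phase F) (B ∘ f) y v).2.1 =
        tderiv (𝓡 d) 𝓘(ℝ, ℝ) (H ∘ ι) y v := by
  have h1 : ∀ᶠ y in 𝓝 y₀, f y ∈ B.source :=
    hf.self_of_nhds.1.continuousAt.eventually (B.open_source.mem_nhds hsrc)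
  have h2 : ∀ᶠ y in 𝓝 y₀, (B (f y)).2.1 = H (ι y) - H x := by
    filter_upwards [h1, hE] with y hy1 hy2
    rw [← hy2, hB.energy_apply hy1]
    ring
  filter_upwards [hf, h1, h2, h2.eventually_nhds] with y hy hy1 hy2 hy3
  have hΨ := hB.isSmoothChart
  have hsm : ContMDiffAt (𝓡 d) 𝓘(ℝ, Phase F) ∞ (B ∘ f) y := (hΨ.contMDiffAt hy1).comp y hy.1
  refine ⟨hy1, hsm, fun v w => ?_, hy2, fun v => ?_⟩
  · rw [tderiv_comp (hΨ.mdifferentiableAt hy1) (hy.1.mdifferentiableAt (by simp)),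
      ContinuousLinearMap.comp_apply, ContinuousLinearMap.comp_apply, ← hB.bilin_eq hy1, hy.2]
  · let P : Phase F →L[ℝ] ℝ :=
      (ContinuousLinearMap.fst ℝ ℝ F).comp (ContinuousLinearMap.snd ℝ (Pos F) (Pos F))
    have e1 := P.tderiv_comp (hsm.mdifferentiableAt (by simp))
    have e2 : H ∘ ι =ᶠ[𝓝 y] (fun r : ℝ => r + H x) ∘ (P ∘ (B ∘ f)) := by
      filter_upwards [hy3] with z hz
      change H (ι z) = (B (f z)).2.1 + H x
      rw [hz, sub_add_cancel]
    have e3 : MDifferentiableAt (𝓡 d) 𝓘(ℝ, ℝ) (P ∘ (B ∘ f)) y :=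
      P.differentiableAt.mdifferentiableAt.comp (I' := 𝓘(ℝ, Phase F)) y
        (hsm.mdifferentiableAt (by simp))
    rw [e2.tderiv_eq, tderiv_comp (J := 𝓘(ℝ, ℝ)) (g := fun r : ℝ => r + H x)
      (differentiableAt_id.add_const _).mdifferentiableAt e3, tderiv_eq_fderiv, fderiv_add_const,
      fderiv_fun_id, e1]
    rfl

end SymplecticForm

section Lift

variable {F : Type}

/-- The point of the phase space with the first position `r` and the remaining coordinates `x`. -/
def liftPhase (r : ℝ) (x : ℝ × (F × F)) : Phase F := ((r, x.2.1), (x.1, x.2.2))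

variable [NormedAddCommGroup F] [InnerProductSpace ℝ F]

theorem transversal_liftPhase (r : ℝ) (x : ℝ × (F × F)) : transversal F (liftPhase r x) = x := rfl

theorem liftPhase_transversal (z : Phase F) : liftPhase z.1.1 (transversal F z) = z := rfl

theorem liftPhase_add_smul (r s : ℝ) (x : ℝ × (F × F)) :
    liftPhase r x + s • flowDir F = liftPhase (r + s) x := by
  simp [liftPhase, flowDir]

end Lift

namespace SymplecticForm

variable {m : ℕ} {Ω : Type*} [TopologicalSpace Ω] [T2Space Ω]
  [ChartedSpace (EuclideanSpace ℝ (Fin m)) Ω] [IsManifold (𝓡 m) ∞ Ω]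
  {σ : SymplecticForm m Ω} {H : Ω → ℝ}
  {d : ℕ} {S₀ S₁ : Type*} [TopologicalSpace S₀] [ChartedSpace (EuclideanSpace ℝ (Fin d)) S₀]
  [TopologicalSpace S₁] [ChartedSpace (EuclideanSpace ℝ (Fin d)) S₁]
  {ι₀ : S₀ → Ω} {ι₁ : S₁ → Ω} {R : S₀ → S₁} {Γ : S₀ → ℝ → Ω} {τ : S₀ → ℝ}

/-- The Poincaré map preserves the symplectic form on the level sets of the Hamiltonian. -/
theorem IsPassage.bilin_eq (h : σ.IsPassage H ι₀ ι₁ R Γ τ) {k : ℕ} (hm : m = 2 * (k + 1))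
    (hH : ContMDiff (𝓡 m) 𝓘(ℝ, ℝ) ∞ H) (hτ : Continuous τ)
    (hι₀ : ContMDiff (𝓡 d) (𝓡 m) ∞ ι₀) (hι₁ : ContMDiff (𝓡 d) (𝓡 m) ∞ ι₁)
    (hR : ContMDiff (𝓡 d) (𝓡 d) ∞ R) {y₀ : S₀} (hfield : σ.field H (ι₀ y₀) ≠ 0)
    {v w : EuclideanSpace ℝ (Fin d)} (hv : tderiv (𝓡 d) 𝓘(ℝ, ℝ) (H ∘ ι₀) y₀ v = 0)
    (hw : tderiv (𝓡 d) 𝓘(ℝ, ℝ) (H ∘ ι₀) y₀ w = 0) :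
    σ.bilin (ι₁ (R y₀)) (tderiv (𝓡 d) (𝓡 m) ι₁ (R y₀) (tderiv (𝓡 d) (𝓡 d) R y₀ v))
        (tderiv (𝓡 d) (𝓡 m) ι₁ (R y₀) (tderiv (𝓡 d) (𝓡 d) R y₀ w)) =
      σ.bilin (ι₀ y₀) (tderiv (𝓡 d) (𝓡 m) ι₀ y₀ v) (tderiv (𝓡 d) (𝓡 m) ι₀ y₀ w) := by
  have hT : τ y₀ ∈ Icc 0 (τ y₀) := ⟨(h.pos y₀).le, le_rfl⟩
  have hne : σ.field H (Γ y₀ (τ y₀)) ≠ 0 :=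
    (h.orbit y₀).field_ne_zero hH ⟨le_rfl, hT.1⟩ hT (by rwa [h.start])
  obtain ⟨B, hB⟩ := σ.exists_isDarbouxChart hm hH hne
  obtain ⟨a, ha, haB⟩ := hB.exists_ball
  obtain ⟨s, hs, hsT⟩ : ∃ s ∈ Ico 0 (τ y₀), τ y₀ - s < a / 4 := by
    refine ⟨max 0 (τ y₀ - a / 8), ⟨le_max_left _ _, max_lt (h.pos y₀) (by linarith)⟩, ?_⟩
    have := le_max_right 0 (τ y₀ - a / 8)
    linarith
  have hs' : s ∈ Icc 0 (τ y₀) := ⟨hs.1, hs.2.le⟩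
  have habs : |s - τ y₀| < a / 4 := by rwa [abs_sub_comm, abs_of_nonneg (by linarith [hs.2])]
  have hf := smoothTransport_flow hm hH hι₀ hτ h.orbit h.start hfield hs
  have h1 : Γ y₀ s = B.symm (B (Γ y₀ (τ y₀)) + (s - τ y₀) • flowDir _) :=
    hB.orbit_eq_line hH ordConnected_Icc (h.orbit y₀) hT hs' hB.mem_source haB (by
      rw [hB.apply_eq, norm_zero]; linarith)
  have h2 : B (Γ y₀ (τ y₀)) + (s - τ y₀) • flowDir _ ∈ B.target := haB (by
    rw [mem_ball_zero_iff]
    refine (norm_add_smul_flowDir_le _ _).trans_lt ?_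
    rw [hB.apply_eq, norm_zero]; linarith)
  have hsrc : Γ y₀ s ∈ B.source := by rw [h1]; exact B.map_target h2
  have hBs : ‖B (Γ y₀ s)‖ < a / 4 := by
    rw [h1, B.right_inv h2, hB.apply_eq, zero_add, norm_smul, norm_flowDir, mul_one]
    exact habs
  have hcont : ContinuousAt (fun y => Γ y s) y₀ := hf.self_of_nhds.1.continuousAt
  have e1 : ∀ᶠ y in 𝓝 y₀, s < τ y := continuousAt_const.eventually_lt hτ.continuousAt hs.2
  have e2 := hf.eventually_chart hB hsrc (by
    filter_upwards [e1] with y hy using h.energy_eq hH ⟨hs.1, hy.le⟩)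
  have e3 : ∀ᶠ y in 𝓝 y₀, ‖B (Γ y s)‖ < a / 4 :=
    (ContinuousAt.comp (g := B) (f := fun y => Γ y s) (x := y₀) (B.continuousAt hsrc)
      hcont).norm.eventually_lt continuousAt_const hBs
  have e4 : ∀ᶠ y in 𝓝 y₀, |τ y - s| < a / 4 :=
    ((hτ.continuousAt (x := y₀)).sub continuousAt_const).abs.eventually_lt continuousAt_const
      ((abs_sub_comm _ _).trans_lt habs)
  obtain ⟨-, hsm, hform, -, hen⟩ := e2.self_of_nhds
  -- The points `ι₁ (R y)` and `Γ y s` lie on one coordinate line, at a distance `τ y - s` depending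
  -- on `y`, so only their transversal coordinates agree. On vectors tangent to energy levels the
  -- standard form sees nothing else.
  have e5 : transversal _ ∘ (B ∘ (ι₁ ∘ R)) =ᶠ[𝓝 y₀] transversal _ ∘ (B ∘ fun y => Γ y s) := by
    filter_upwards [e1, e2, e3, e4] with y hy1 hy2 hy3 hy4
    have l1 := hB.orbit_eq_line hH ordConnected_Icc (h.orbit y) ⟨hs.1, hy1.le⟩
      ⟨(h.pos y).le, le_rfl⟩ hy2.1 haB (by linarith)
    have l2 : B (Γ y s) + (τ y - s) • flowDir _ ∈ B.target := haB (by
      rw [mem_ball_zero_iff]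
      refine (norm_add_smul_flowDir_le _ _).trans_lt ?_
      linarith)
    simp only [Function.comp_apply]
    rw [← h.finish, l1, B.right_inv l2, map_add, map_smul, transversal_flowDir, smul_zero, add_zero]
  have hsrc1 : ι₁ (R y₀) ∈ B.source := by rw [← h.finish]; exact hB.mem_source
  have d1 : MDifferentiableAt (𝓡 d) (𝓡 m) ι₁ (R y₀) := (hι₁ _).mdifferentiableAt (by simp)
  have d2 : MDifferentiableAt (𝓡 d) (𝓡 d) R y₀ := (hR _).mdifferentiableAt (by simp)
  have d3 := hB.isSmoothChart.mdifferentiableAt hsrc1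
  have e6 : tderiv (𝓡 d) 𝓘(ℝ, Phase (EuclideanSpace ℝ (Fin k))) (B ∘ (ι₁ ∘ R)) y₀ = _ :=
    tderiv_comp (f := ι₁ ∘ R) d3 (d1.comp y₀ d2)
  rw [tderiv_comp d1 d2] at e6
  have e7 := e5.tderiv_eq (I := 𝓡 d) 
    (J := 𝓘(ℝ, ℝ × (EuclideanSpace ℝ (Fin k) × EuclideanSpace ℝ (Fin k))))
  rw [ContinuousLinearMap.tderiv_comp _ (d3.comp y₀ (d1.comp y₀ d2)),
    ContinuousLinearMap.tderiv_comp _ (hsm.mdifferentiableAt (by simp))] at e7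
  have e8 (v) : transversal _ (tderiv (𝓡 d) 𝓘(ℝ, Phase (EuclideanSpace ℝ (Fin k))) (B ∘ (ι₁ ∘ R)) y₀ v) =
      transversal _ (tderiv (𝓡 d) 𝓘(ℝ, Phase (EuclideanSpace ℝ (Fin k))) (B ∘ fun y => Γ y s) y₀ v) :=
    congrArg (fun T : EuclideanSpace ℝ (Fin d) →L[ℝ] _ => T v) e7
  have e9 (v) (hv : tderiv (𝓡 d) 𝓘(ℝ, ℝ) (H ∘ ι₀) y₀ v = 0) :
      (tderiv (𝓡 d) 𝓘(ℝ, Phase (EuclideanSpace ℝ (Fin k))) (B ∘ (ι₁ ∘ R)) y₀ v).2.1 = 0 :=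
    (congrArg Prod.fst (e8 v)).trans ((hen v).trans hv)
  rw [hB.bilin_eq hsrc1]
  rw [← hform, stdForm_eq_areaForm ((hen v).trans hv) ((hen w).trans hw), ← e8, ← e8,
    ← stdForm_eq_areaForm (e9 v hv) (e9 w hw), e6]
  rfl

end SymplecticForm

/-! ### Flow boxes -/

namespace SymplecticForm

variable {m : ℕ} {Ω : Type*} [TopologicalSpace Ω]
  [ChartedSpace (EuclideanSpace ℝ (Fin m)) Ω] [IsManifold (𝓡 m) ∞ Ω]
  {d : ℕ} {S₀ S₁ : Type*} [TopologicalSpace S₀] [ChartedSpace (EuclideanSpace ℝ (Fin d)) S₀]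

variable (d) in
/-- Symplectic coordinates `B` in a box around `Γ y₀ t₁` and coordinates `W` of `y ∈ S₀` such that
the orbit `Γ y` crosses the box along the coordinate line given by `W y`. The time is measured from
`t₁ - θ y`. -/
structure IsFlowBox (σ : SymplecticForm m Ω) (H : Ω → ℝ) (ι₀ : S₀ → Ω) (Γ : S₀ → ℝ → Ω)
    (τ : S₀ → ℝ) (y₀ : S₀) (t₁ : ℝ) {F : Type} [NormedAddCommGroup F] [InnerProductSpace ℝ F]
    (B : OpenPartialHomeomorph Ω (Phase F)) (W : OpenPartialHomeomorph S₀ (ℝ × (F × F)))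
    (θ : S₀ → ℝ) (a : ℝ) : Prop where
  darboux : σ.IsDarbouxChart F H (Γ y₀ t₁) B
  ball : Metric.ball 0 a ⊆ B.target
  chart : IsSmoothChart (𝓡 d) W
  mem : y₀ ∈ W.source
  apply_eq : W y₀ = 0
  cont : ContinuousOn θ W.source
  time : ∀ y ∈ W.source, ∀ r, |r| < a → t₁ - θ y + r ∈ Ioo 0 (τ y)
  orbit : ∀ y ∈ W.source, ∀ r, |r| < a → Γ y (t₁ - θ y + r) = B.symm (liftPhase r (W y))
  energy : ∀ y ∈ W.source, H (ι₀ y) = H (ι₀ y₀) + (W y).1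
  tderiv_fst : ∀ y ∈ W.source, ∀ v, (tderiv (𝓡 d) 𝓘(ℝ, ℝ × (F × F)) W y v).1 =
    tderiv (𝓡 d) 𝓘(ℝ, ℝ) (H ∘ ι₀) y v
  form : ∀ y ∈ W.source, ∀ v w, tderiv (𝓡 d) 𝓘(ℝ, ℝ) (H ∘ ι₀) y v = 0 →
    tderiv (𝓡 d) 𝓘(ℝ, ℝ) (H ∘ ι₀) y w = 0 →
    areaForm F (tderiv (𝓡 d) 𝓘(ℝ, ℝ × (F × F)) W y v).2
      (tderiv (𝓡 d) 𝓘(ℝ, ℝ × (F × F)) W y w).2 =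
      σ.bilin (ι₀ y) (tderiv (𝓡 d) (𝓡 m) ι₀ y v) (tderiv (𝓡 d) (𝓡 m) ι₀ y w)

variable [T2Space Ω] [IsManifold (𝓡 d) ∞ S₀]
  {σ : SymplecticForm m Ω} {H : Ω → ℝ}
  {ι₀ : S₀ → Ω} {ι₁ : S₁ → Ω} {R : S₀ → S₁} {Γ : S₀ → ℝ → Ω} {τ : S₀ → ℝ}

/-- The coordinates `W y` are the transversal coordinates of `Γ y t₁`, and `θ y` is its coordinate
`q₁`, so that time `t₁ - θ y` corresponds to `q₁ = 0`. The box is shrunk until the times lie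
strictly before the passage. -/
theorem IsPassage.exists_isFlowBox (h : σ.IsPassage H ι₀ ι₁ R Γ τ) {k : ℕ} (hm : m = 2 * (k + 1))
    (hd : d + 1 = m) (hH : ContMDiff (𝓡 m) 𝓘(ℝ, ℝ) ∞ H) (hτ : Continuous τ)
    (hι₀ : ContMDiff (𝓡 d) (𝓡 m) ∞ ι₀)
    (hinj : ∀ y v, tderiv (𝓡 d) (𝓡 m) ι₀ y v = 0 → v = 0)
    (htr : ∀ y, σ.field H (ι₀ y) ∉ range (tderiv (𝓡 d) (𝓡 m) ι₀ y)) {y₀ : S₀} {t₁ : ℝ}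
    (ht₁ : t₁ ∈ Ioo 0 (τ y₀)) {U : Set Ω} (hU : U ∈ 𝓝 (Γ y₀ t₁)) :
    ∃ (B : OpenPartialHomeomorph Ω (Phase (EuclideanSpace ℝ (Fin k))))
      (W : OpenPartialHomeomorph S₀ (ℝ × (EuclideanSpace ℝ (Fin k) × EuclideanSpace ℝ (Fin k))))
      (θ : S₀ → ℝ) (a : ℝ), 0 < a ∧ σ.IsFlowBox d H ι₀ Γ τ y₀ t₁ B W θ a ∧
        ∀ z ∈ Metric.ball 0 a, B.symm z ∈ U := by
  have hfield (y) : σ.field H (ι₀ y) ≠ 0 := fun h0 => htr y (by rw [h0]; exact ⟨0, map_zero _⟩)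
  have ht₁' : t₁ ∈ Icc 0 (τ y₀) := Ioo_subset_Icc_self ht₁
  have hne : σ.field H (Γ y₀ t₁) ≠ 0 :=
    (h.orbit y₀).field_ne_zero hH ⟨le_rfl, (h.pos y₀).le⟩ ht₁' (by rw [h.start]; exact hfield y₀)
  obtain ⟨B, hB⟩ := σ.exists_isDarbouxChart hm hH hne
  have hB0 : Γ y₀ t₁ = B.symm 0 := by rw [← hB.apply_eq, B.left_inv hB.mem_source]
  have h0 : (0 : Phase (EuclideanSpace ℝ (Fin k))) ∈ B.target := by
    rw [← hB.apply_eq]; exact B.map_source hB.mem_source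
  obtain ⟨a', ha', haB'⟩ : ∃ a > 0, Metric.ball 0 a ⊆ B.target ∩ B.symm ⁻¹' U :=
    Metric.mem_nhds_iff.1 (Filter.inter_mem (B.open_target.mem_nhds h0)
      ((B.symm.continuousAt h0).preimage_mem_nhds (hB0 ▸ hU)))
  obtain ⟨a, ha, haa', ha1, ha2⟩ : ∃ a > 0, a ≤ a' ∧ a ≤ t₁ ∧ a ≤ τ y₀ - t₁ :=
    ⟨min a' (min t₁ (τ y₀ - t₁)), lt_min ha' (lt_min ht₁.1 (by linarith [ht₁.2])), min_le_left _ _,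
      (min_le_right _ _).trans (min_le_left _ _), (min_le_right _ _).trans (min_le_right _ _)⟩
  have haB : Metric.ball 0 a ⊆ B.target ∩ B.symm ⁻¹' U := (Metric.ball_subset_ball haa').trans haB'
  have hf := smoothTransport_flow hm hH hι₀ hτ h.orbit h.start (hfield y₀) ⟨ht₁.1.le, ht₁.2⟩
  set f : S₀ → Ω := fun y => Γ y t₁ with hfdef
  have e1 : ∀ᶠ y in 𝓝 y₀, t₁ < τ y := continuousAt_const.eventually_lt hτ.continuousAt ht₁.2
  have e2 := hf.eventually_chart hB hB.mem_source (by
    filter_upwards [e1] with y hy using h.energy_eq hH ⟨ht₁.1.le, hy.le⟩)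
  have e3 : ∀ᶠ y in 𝓝 y₀, ‖B (f y)‖ < a / 4 :=
    (ContinuousAt.comp (g := B) (f := f) (x := y₀) (B.continuousAt hB.mem_source)
      hf.self_of_nhds.1.continuousAt).norm.eventually_lt continuousAt_const
      (by change ‖B (Γ y₀ t₁)‖ < _; rw [hB.apply_eq, norm_zero]; linarith)
  have e4 : ∀ᶠ y in 𝓝 y₀, τ y₀ - a / 4 < τ y :=
    continuousAt_const.eventually_lt hτ.continuousAt (by linarith)
  obtain ⟨N, hN, hNo, hy₀N⟩ := eventually_nhds_iff.1 (e1.and (e2.and (e3.and e4)))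
  have hφ := IsManifold.isSmoothChart_of_mem_maximalAtlas
    (IsManifold.chart_mem_maximalAtlas (I := 𝓡 d) (n := ∞) y₀)
  have hy₀φ : y₀ ∈ (chartAt (EuclideanSpace ℝ (Fin d)) y₀).source := mem_chart_source _ y₀
  generalize chartAt (EuclideanSpace ℝ (Fin d)) y₀ = φ at hφ hy₀φ
  set b := transversal (EuclideanSpace ℝ (Fin k)) ∘ (B ∘ f) with hb
  have hbsm (y) (hy : y ∈ N) : ContMDiffAt (𝓡 d)
      𝓘(ℝ, ℝ × (EuclideanSpace ℝ (Fin k) × EuclideanSpace ℝ (Fin k))) ∞ b y :=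
    (transversal _).contDiff.contMDiff.contMDiffAt.comp y (hN y hy).2.1.2.1
  have hbd (y) (hy : y ∈ N) (v) : tderiv (𝓡 d)
      𝓘(ℝ, ℝ × (EuclideanSpace ℝ (Fin k) × EuclideanSpace ℝ (Fin k))) b y v =
      transversal _ (tderiv (𝓡 d) 𝓘(ℝ, Phase (EuclideanSpace ℝ (Fin k))) (B ∘ f) y v) := by
    rw [hb, ContinuousLinearMap.tderiv_comp _ ((hN y hy).2.1.2.1.mdifferentiableAt (by simp))]
    rfl
  -- If the transversal part vanishes, the image of `v` is `c • flowDir`. Then `dι₀ v - c X_H` is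
  -- orthogonal to the section and killed by `dH`, hence zero, and transversality forces `c = 0`.
  have hbinj (y) (hy : y ∈ N) (v) (hv : tderiv (𝓡 d)
      𝓘(ℝ, ℝ × (EuclideanSpace ℝ (Fin k) × EuclideanSpace ℝ (Fin k))) b y v = 0) : v = 0 := by
    obtain ⟨-, -, hform, -, hen⟩ := (hN y hy).2.1
    rw [hbd y hy] at hv
    have hv1 : tderiv (𝓡 d) 𝓘(ℝ, ℝ) (H ∘ ι₀) y v = 0 := (hen v).symm.trans (congrArg Prod.fst hv)
    have hline := liftPhase_transversal
      (tderiv (𝓡 d) 𝓘(ℝ, Phase (EuclideanSpace ℝ (Fin k))) (B ∘ f) y v)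
    rw [hv] at hline
    generalize (tderiv (𝓡 d) 𝓘(ℝ, Phase (EuclideanSpace ℝ (Fin k))) (B ∘ f) y v).1.1 = c at hline
    have hline' : tderiv (𝓡 d) 𝓘(ℝ, Phase (EuclideanSpace ℝ (Fin k))) (B ∘ f) y v =
        c • flowDir _ := by
      rw [← hline]; simp [liftPhase, flowDir]
    have hd1 : MDifferentiableAt (𝓡 d) (𝓡 m) ι₀ y := (hι₀ y).mdifferentiableAt (by simp)
    have hcomp (v) : tderiv (𝓡 d) 𝓘(ℝ, ℝ) (H ∘ ι₀) y v =
        tderiv (𝓡 m) 𝓘(ℝ, ℝ) H (ι₀ y) (tderiv (𝓡 d) (𝓡 m) ι₀ y v) := by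
      rw [tderiv_comp (mdifferentiable_of_contMDiff hH _) hd1]; rfl
    have hzero : tderiv (𝓡 d) (𝓡 m) ι₀ y v - c • σ.field H (ι₀ y) = 0 := by
      refine tderiv_eq_zero_of_transverse hd (hinj y) (htr y) (H := H) (fun w => ?_) ?_
      · rw [map_sub, sub_apply, ← hform, hline', map_smul, map_smul, smul_apply, smul_apply,
          stdForm_flowDir, bilin_field, ← hcomp, hen, sub_self]
      · rw [map_sub, ← hcomp, hv1, map_smul, ← bilin_field, bilin_self, smul_zero, sub_zero]
    have hc : c = 0 := by
      by_contra hc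
      refine htr y ⟨c⁻¹ • v, ?_⟩
      rw [map_smul, sub_eq_zero.1 hzero, smul_smul, inv_mul_cancel₀ hc, one_smul]
    rw [hc, zero_smul, sub_zero] at hzero
    exact hinj y v hzero
  have hOo : IsOpen (φ.target ∩ φ.symm ⁻¹' N) := φ.isOpen_inter_preimage_symm hNo
  have hbφ (u) (hu : u ∈ φ.target ∩ φ.symm ⁻¹' N) : fderiv ℝ (b ∘ φ.symm) u = (tderiv (𝓡 d)
      𝓘(ℝ, ℝ × (EuclideanSpace ℝ (Fin k) × EuclideanSpace ℝ (Fin k))) b (φ.symm u)).comp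
        (tderiv 𝓘(ℝ, EuclideanSpace ℝ (Fin d)) (𝓡 d) φ.symm u) := by
    rw [← tderiv_eq_fderiv]
    exact tderiv_comp ((hbsm _ hu.2).mdifferentiableAt (by simp)) (hφ.mdifferentiableAt_symm hu.1)
  have hgsm : ContDiffOn ℝ ∞ (b ∘ φ.symm) (φ.target ∩ φ.symm ⁻¹' N) := fun u hu =>
    ((hbsm _ hu.2).comp u (hφ.contMDiffAt_symm hu.1)).contDiffAt.contDiffWithinAt
  obtain ⟨e, hye, heO, heb, hesymm⟩ := exists_openPartialHomeomorph_of_injective_fderiv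
    (by simp; omega) hOo hgsm (fun u hu => by
      rw [injective_iff_map_eq_zero]
      intro v hv
      rw [hbφ u hu, ContinuousLinearMap.comp_apply] at hv
      have h1 := hbinj _ hu.2 _ hv
      rw [← hφ.tderiv_tderiv_symm hu.1 v, h1, map_zero])
    (z₀ := φ y₀) ⟨φ.map_source hy₀φ, by rw [mem_preimage, φ.left_inv hy₀φ]; exact hy₀N⟩
  have hWsrc (y) (hy : y ∈ (φ.trans e).source) : y ∈ N ∧ y ∈ φ.source := by
    rw [OpenPartialHomeomorph.trans_source] at hy
    have := (heO hy.2).2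
    rw [mem_preimage, φ.left_inv hy.1] at this
    exact ⟨this, hy.1⟩
  have hWb (y) (hy : y ∈ (φ.trans e).source) : φ.trans e y = b y := by
    rw [OpenPartialHomeomorph.coe_trans, Function.comp_apply, heb, Function.comp_apply,
      φ.left_inv (hWsrc y hy).2]
  have hWd (y) (hy : y ∈ (φ.trans e).source) (v) : tderiv (𝓡 d)
      𝓘(ℝ, ℝ × (EuclideanSpace ℝ (Fin k) × EuclideanSpace ℝ (Fin k))) (φ.trans e) y v =
      transversal _ (tderiv (𝓡 d) 𝓘(ℝ, Phase (EuclideanSpace ℝ (Fin k))) (B ∘ f) y v) := by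
    rw [← hbd y (hWsrc y hy).1]
    refine congrArg (fun T : EuclideanSpace ℝ (Fin d) →L[ℝ] _ => T v)
      (Filter.EventuallyEq.tderiv_eq ?_)
    filter_upwards [(φ.trans e).open_source.mem_nhds hy] with z hz using hWb z hz
  have hmem : y₀ ∈ (φ.trans e).source := by
    rw [OpenPartialHomeomorph.trans_source]
    exact ⟨hy₀φ, hye⟩
  refine ⟨B, φ.trans e, fun y => (B (f y)).1.1, a / 4, by positivity,
    ⟨hB, fun z hz => (haB (Metric.ball_subset_ball (by linarith) hz)).1, ⟨fun y hy => ?_, ?_⟩, hmem,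
      ?_, fun y hy => ?_, fun y hy r hr => ?_, fun y hy r hr => ?_, fun y hy => ?_, fun y hy v => ?_,
      fun y hy v w hv hw => ?_⟩,
    fun z hz => (haB (Metric.ball_subset_ball (by linarith) hz)).2⟩
  · refine ((hbsm y (hWsrc y hy).1).congr_of_eventuallyEq ?_).contMDiffWithinAt
    filter_upwards [(φ.trans e).open_source.mem_nhds hy] with z hz using hWb z hz
  · rw [OpenPartialHomeomorph.trans_target]
    intro u hu
    refine ContMDiffAt.contMDiffWithinAt ?_
    exact (hφ.contMDiffAt_symm hu.2).comp u
      (hesymm.contDiffAt (e.open_target.mem_nhds hu.1)).contMDiffAt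
  · rw [hWb y₀ hmem, hb, Function.comp_apply, Function.comp_apply, hB.apply_eq, map_zero]
  · exact ((continuous_fst.fst.continuousAt).comp
      (hN y (hWsrc y hy).1).2.1.2.1.continuousAt).continuousWithinAt
  · obtain ⟨n1, -, n3, n4⟩ := hN y (hWsrc y hy).1
    have h1 : |(B (f y)).1.1| < a / 4 := by
      refine lt_of_le_of_lt ?_ n3
      exact (norm_fst_le (B (f y)).1).trans (norm_fst_le _)
    rw [abs_lt] at h1 hr
    constructor <;> linarith
  · obtain ⟨n1, n2, n3, n4⟩ := hN y (hWsrc y hy).1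
    have h1 : |(B (f y)).1.1| < a / 4 := by
      refine lt_of_le_of_lt ?_ n3
      exact (norm_fst_le (B (f y)).1).trans (norm_fst_le _)
    have h2 : |t₁ - (B (f y)).1.1 + r - t₁| < a / 2 := by
      rw [abs_lt] at h1 hr ⊢
      constructor <;> linarith
    have h3 : t₁ - (B (f y)).1.1 + r ∈ Icc 0 (τ y) := by
      rw [abs_lt] at h1 hr
      constructor <;> linarith
    rw [hB.orbit_eq_line hH ordConnected_Icc (h.orbit y) ⟨ht₁.1.le, n1.le⟩ h3 n2.1
      (fun z hz => (haB hz).1) (by change ‖B (f y)‖ + _ < a; linarith)]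
    congr 1
    rw [hWb y hy]
    have h4 := liftPhase_transversal (B (f y))
    change B (f y) + _ = liftPhase r (transversal _ (B (f y)))
    nth_rw 1 [← h4]
    rw [liftPhase_add_smul]
    congr 1
    ring
  · have h1 := (hN y (hWsrc y hy).1).2.1.2.2.2.1
    have h2 : H (Γ y₀ t₁) = H (ι₀ y₀) := h.energy_eq hH ht₁'
    rw [hWb y hy]
    change _ = _ + (B (f y)).2.1
    rw [h1, h2]
    ring
  · rw [hWd y hy]
    exact (hN y (hWsrc y hy).1).2.1.2.2.2.2 v
  · obtain ⟨-, -, hform, -, hen⟩ := (hN y (hWsrc y hy).1).2.1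
    rw [hWd y hy, hWd y hy, ← stdForm_eq_areaForm ((hen v).trans hv) ((hen w).trans hw), hform]

end SymplecticForm

/-! ### Families of perturbations converging in the smooth topology -/

section Perturbation

/-- The partial derivatives are the full ones composed with the inclusion of the second factor.
Joint continuity in the parameter is what uniform estimates on compact sets require. -/
theorem continuousOn_iteratedFDeriv_partial {E : Type*} [NormedAddCommGroup E] [NormedSpace ℝ E]
    {O : Set E} (hO : IsOpen O) {Q : ℝ × E → ℝ} (hQ : ContDiffOn ℝ ∞ Q (univ ×ˢ O)) (j : ℕ) :
    ContinuousOn (fun q : ℝ × E => iteratedFDeriv ℝ j (fun u => Q (q.1, u)) q.2) (univ ×ˢ O) := by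
  have hO' : IsOpen ((univ : Set ℝ) ×ˢ O) := isOpen_univ.prod hO
  have key (q : ℝ × E) (hq : q ∈ (univ : Set ℝ) ×ˢ O) :
      iteratedFDeriv ℝ j (fun u => Q (q.1, u)) q.2 =
        (iteratedFDerivWithin ℝ j Q (univ ×ˢ O) q).compContinuousLinearMap
          fun _ => ContinuousLinearMap.inr ℝ ℝ E := by
    let a : ℝ × E := (q.1, 0)
    let s₁ : Set (ℝ × E) := (fun p => a + p) ⁻¹' (univ ×ˢ O)
    have hs₁ : IsOpen s₁ := hO'.preimage (by fun_prop)
    have hs₂ : IsOpen (ContinuousLinearMap.inr ℝ ℝ E ⁻¹' s₁) :=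
      hs₁.preimage (ContinuousLinearMap.inr ℝ ℝ E).continuous
    have ha (u : E) : a + ContinuousLinearMap.inr ℝ ℝ E u = (q.1, u) := by simp [a]
    have hq₁ : ContinuousLinearMap.inr ℝ ℝ E q.2 ∈ s₁ := by
      change a + _ ∈ (univ : Set ℝ) ×ˢ O
      rwa [ha]
    have h0 : ContDiffOn ℝ ∞ (fun p => Q (a + p)) s₁ :=
      hQ.comp (contDiff_const.add contDiff_id).contDiffOn fun p hp => hp
    have h1 := (ContinuousLinearMap.inr ℝ ℝ E).iteratedFDerivWithin_comp_right h0
      hs₁.uniqueDiffOn hs₂.uniqueDiffOn hq₁ (i := j) (by exact_mod_cast le_top)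
    have h2 : (fun p => Q (a + p)) ∘ ContinuousLinearMap.inr ℝ ℝ E = fun u => Q (q.1, u) :=
      funext fun u => congrArg Q (ha u)
    rw [h2, iteratedFDerivWithin_of_isOpen _ hs₂ hq₁] at h1
    rw [h1, iteratedFDerivWithin_of_isOpen _ hs₁ hq₁,
      iteratedFDeriv_comp_add_left, ha, iteratedFDerivWithin_of_isOpen _ hO' hq]
  refine ContinuousOn.congr ?_ key
  exact (ContinuousMultilinearMap.compContinuousLinearMapL
    (fun _ : Fin j => ContinuousLinearMap.inr ℝ ℝ E)).continuous.comp_continuousOn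
    (hQ.continuousOn_iteratedFDerivWithin (by exact_mod_cast le_top) hO'.uniqueDiffOn)

variable {m : ℕ} {M : Type*} [TopologicalSpace M] [T2Space M]
  [ChartedSpace (EuclideanSpace ℝ (Fin m)) M] [IsManifold (𝓡 m) ∞ M]
  {E : Type*} [NormedAddCommGroup E] [NormedSpace ℝ E]

/-- Smooth perturbations of a function supported in a coordinate neighbourhood. -/
theorem exists_tendsto_perturbation (H : C^∞⟮𝓡 m, M; 𝓘(ℝ, ℝ), ℝ⟯) {B : OpenPartialHomeomorph M E}
    (hB : IsSmoothChart (𝓡 m) B) {K : Set E} (hK : IsCompact K) (hKB : K ⊆ B.target)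
    {D : ℝ × E → ℝ} (hD : ContDiff ℝ ∞ D) (hD0 : ∀ z, D (0, z) = 0)
    (hDK : ∀ s, ∀ z ∉ K, D (s, z) = 0) :
    ∃ Hs : ℝ → C^∞⟮𝓡 m, M; 𝓘(ℝ, ℝ), ℝ⟯, (∀ s, ∀ x ∈ B.source, Hs s x = H x + D (s, B x)) ∧
      (∀ s, ∀ x ∉ B.symm '' K, Hs s x = H x) ∧
      Filter.Tendsto Hs (𝓝 0) (@nhds _ (smoothFunctionTopology m M) H) := by
  have hC : IsClosed (B.symm '' K) :=
    (hK.image_of_continuousOn (B.continuousOn_symm.mono hKB)).isClosed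
  let P (s : ℝ) (x : M) : ℝ := B.source.indicator (fun x => D (s, B x)) x
  have hP (s) (x) (hx : x ∈ B.source) : P s x = D (s, B x) := indicator_of_mem hx _
  have hP' (s) (x) (hx : x ∉ B.symm '' K) : P s x = 0 := by
    by_cases hxB : x ∈ B.source
    · rw [hP s x hxB]
      exact hDK s _ fun h => hx ⟨B x, h, B.left_inv hxB⟩
    · exact indicator_of_notMem hxB _
  -- The extension by zero is smooth on each of these two open sets: it is `D (s, B x)` on the first
  -- and zero on the second.
  have hcover (x : M) : x ∈ B.source ∨ x ∈ (B.symm '' K)ᶜ := by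
    by_cases hx : x ∈ B.symm '' K
    · obtain ⟨z, hz, rfl⟩ := hx
      exact Or.inl (B.map_target (hKB hz))
    · exact Or.inr hx
  have hPs (s : ℝ) : ContMDiff (𝓡 m) 𝓘(ℝ, ℝ) ∞ (P s) := fun x => by
    rcases hcover x with hx | hx
    · have h1 : ContMDiffAt (𝓡 m) 𝓘(ℝ, ℝ) ∞ (fun x => D (s, B x)) x :=
        (hD.comp (contDiff_const.prodMk contDiff_id)).contMDiff.contMDiffAt.comp
          (I' := 𝓘(ℝ, E)) (f := B) x (hB.contMDiffAt hx)
      refine h1.congr_of_eventuallyEq ?_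
      filter_upwards [B.open_source.mem_nhds hx] with y hy using hP s y hy
    · refine (contMDiffAt_const (c := (0 : ℝ))).congr_of_eventuallyEq ?_
      filter_upwards [hC.isOpen_compl.mem_nhds hx] with y hy using hP' s y hy
  let Hs (s : ℝ) : C^∞⟮𝓡 m, M; 𝓘(ℝ, ℝ), ℝ⟯ := ⟨fun x => H x + P s x, H.contMDiff.add (hPs s)⟩
  have hHs (s x) : Hs s x = H x + P s x := rfl
  refine ⟨Hs, fun s x hx => by rw [hHs, hP s x hx], fun s x hx => by rw [hHs, hP' s x hx, add_zero],
    TopologicalSpace.tendsto_nhds_generateFrom_iff.2 ?_⟩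
  rintro _ ⟨f, φ, K', r, ε, hφ, hK', hK'φ, hε, rfl⟩ hH
  have hφc := IsManifold.isSmoothChart_of_mem_maximalAtlas hφ
  have hQ : ContDiffOn ℝ ∞ (fun q : ℝ × EuclideanSpace ℝ (Fin m) => Hs q.1 (φ.symm q.2))
      (univ ×ˢ φ.target) := by
    have hHφ : ContDiffOn ℝ ∞ (fun q : ℝ × EuclideanSpace ℝ (Fin m) => H (φ.symm q.2))
        (univ ×ˢ φ.target) :=
      (SymplecticForm.contDiffOn_comp_symm hφ H.contMDiff).comp contDiff_snd.contDiffOn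
        fun q hq => hq.2
    refine hHφ.add fun q hq => ContDiffAt.contDiffWithinAt ?_
    have hcont : ContinuousAt (fun q : ℝ × EuclideanSpace ℝ (Fin m) => φ.symm q.2) q :=
      (φ.symm.continuousAt hq.2).comp continuousAt_snd
    rcases hcover (φ.symm q.2) with hx | hx
    · have h1 : ContDiffAt ℝ ∞ (B ∘ φ.symm) q.2 :=
        ((hB.contMDiffAt hx).comp q.2 (hφc.contMDiffAt_symm hq.2)).contDiffAt
      have h2 : ContDiffAt ℝ ∞ (fun q : ℝ × EuclideanSpace ℝ (Fin m) =>
          D (q.1, (B ∘ φ.symm) q.2)) q :=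
        hD.contDiffAt.comp q (contDiffAt_fst.prodMk (h1.comp q contDiffAt_snd))
      refine h2.congr_of_eventuallyEq ?_
      filter_upwards [hcont.eventually (B.open_source.mem_nhds hx)] with y hy using hP _ _ hy
    · refine (contDiffAt_const (c := (0 : ℝ))).congr_of_eventuallyEq ?_
      filter_upwards [hcont.eventually (hC.isOpen_compl.mem_nhds hx)] with y hy using hP' _ _ hy
  have hQf : ContDiffOn ℝ ∞ (fun q : ℝ × EuclideanSpace ℝ (Fin m) => f (φ.symm q.2))
      (univ ×ˢ φ.target) :=
    (SymplecticForm.contDiffOn_comp_symm hφ f.contMDiff).comp contDiff_snd.contDiffOn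
      fun q hq => hq.2
  have hall : ∀ k ∈ Iic r, ∀ᶠ s in 𝓝 (0 : ℝ), ∀ x ∈ K',
      ‖iteratedFDeriv ℝ k (fun u => Hs s (φ.symm u)) (φ x) -
        iteratedFDeriv ℝ k (fun u => f (φ.symm u)) (φ x)‖ < ε := by
    intro k hk
    -- The strict inequality holds at `s = 0` by the choice of the subbasic set, persists nearby by
    -- joint continuity, and is uniform by compactness.
    refine hK'.eventually_forall_of_forall_eventually fun x hx => ?_
    have hxt : ((0 : ℝ), φ x) ∈ (univ : Set ℝ) ×ˢ φ.target :=
      ⟨mem_univ _, φ.map_source (hK'φ hx)⟩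
    have hnhds := (isOpen_univ.prod φ.open_target).mem_nhds hxt
    have hpair : ContinuousAt (fun p : ℝ × M => (p.1, φ p.2)) (0, x) :=
      continuousAt_fst.prodMk ((φ.continuousAt (hK'φ hx)).comp continuousAt_snd)
    have c1 := ((continuousOn_iteratedFDeriv_partial φ.open_target hQ k).continuousAt hnhds).sub
      ((continuousOn_iteratedFDeriv_partial φ.open_target hQf k).continuousAt hnhds)
    have c2 := (ContinuousAt.comp (f := fun p : ℝ × M => (p.1, φ p.2)) (x := (0, x)) c1 hpair).norm
    refine c2.eventually_lt continuousAt_const ?_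
    have h0 : (fun u => Hs 0 (φ.symm u)) = H ∘ φ.symm := funext fun u => by
      rw [hHs]
      change H (φ.symm u) + B.source.indicator (fun x => D (0, B x)) (φ.symm u) = _
      simp [hD0]
    have h1 := hH k hk x hx
    rw [← h0] at h1
    exact h1
  filter_upwards [(Filter.eventually_all_finite (finite_Iic r)).2 hall] with s hs k hk x hx using
    hs k hk x hx

end Perturbation

/-! ### Orbits of the perturbed Hamiltonian -/

namespace SymplecticForm

variable {m : ℕ} {Ω : Type*} [TopologicalSpace Ω] [T2Space Ω]
  [ChartedSpace (EuclideanSpace ℝ (Fin m)) Ω] [IsManifold (𝓡 m) ∞ Ω]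
  {d : ℕ} {S₀ S₁ : Type*} [TopologicalSpace S₀] [ChartedSpace (EuclideanSpace ℝ (Fin d)) S₀]
  {σ : SymplecticForm m Ω} {H H' : Ω → ℝ}
  {ι₀ : S₀ → Ω} {ι₁ : S₁ → Ω} {R : S₀ → S₁} {Γ : S₀ → ℝ → Ω} {τ : S₀ → ℝ} {y₀ : S₀} {t₁ : ℝ}
  {F : Type} [NormedAddCommGroup F] [InnerProductSpace ℝ F]
  {B : OpenPartialHomeomorph Ω (Phase F)} {W : OpenPartialHomeomorph S₀ (ℝ × (F × F))}
  {θ : S₀ → ℝ} {a : ℝ}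

omit [T2Space Ω] in
theorem field_congr {x : Ω} (h : H' =ᶠ[𝓝 x] H) : σ.field H' x = σ.field H x :=
  (σ.eq_field fun w => by rw [bilin_field, h.tderiv_eq])

omit [T2Space Ω] in
theorem IsOrbit.congr_field {γ : ℝ → Ω} {s : Set ℝ} (h : σ.IsOrbit H γ s) {C : Set Ω}
    (hC : IsClosed C) (hH' : ∀ x ∉ C, H' x = H x) (hγ : ∀ t ∈ s, γ t ∉ C) : σ.IsOrbit H' γ s :=
  fun t ht => by
    rw [field_congr (H := H) (Filter.eventually_of_mem (hC.isOpen_compl.mem_nhds (hγ t ht)) hH')]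
    exact h t ht

namespace IsFlowBox

variable (hb : σ.IsFlowBox d H ι₀ Γ τ y₀ t₁ B W θ a)
include hb

omit [T2Space Ω] in
theorem exists_eq {z : Phase F} (hz : |z.1.1| < a) (hzW : transversal F z ∈ W.target) :
    ∃ y ∈ W.source, W y = transversal F z ∧ t₁ - θ y + z.1.1 ∈ Ioo 0 (τ y) ∧
      Γ y (t₁ - θ y + z.1.1) = B.symm z := by
  have hy := W.map_target hzW
  refine ⟨_, hy, W.right_inv hzW, hb.time _ hy _ hz, ?_⟩
  rw [hb.orbit _ hy _ hz, W.right_inv hzW, liftPhase_transversal]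

omit [T2Space Ω] in
theorem notMem_range (hp : σ.IsPassage H ι₀ ι₁ R Γ τ) {z : Phase F} (hz : |z.1.1| < a)
    (hzW : transversal F z ∈ W.target) : B.symm z ∉ range ι₁ := by
  obtain ⟨y, -, -, ht, he⟩ := hb.exists_eq hz hzW
  rw [← he]
  exact hp.first y _ ht

/-- Each point of the box lies on the orbit labelled by its transversal coordinates, at a time
strictly inside the passage. Distinct orbits do not meet and none returns, so no other passage
visits that point. -/
theorem eq_of_orbit (hp : σ.IsPassage H ι₀ ι₁ R Γ τ) (hH : ContMDiff (𝓡 m) 𝓘(ℝ, ℝ) ∞ H)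
    (hι₁ : Function.Injective ι₁) (hR : Function.Injective R) {z : Phase F} (hz : |z.1.1| < a)
    (hzW : transversal F z ∈ W.target) {y : S₀} {t : ℝ} (ht : t ∈ Icc 0 (τ y))
    (h : Γ y t = B.symm z) : y ∈ W.source ∧ W y = transversal F z ∧ t = t₁ - θ y + z.1.1 := by
  obtain ⟨y', hy', hW, ht', he⟩ := hb.exists_eq hz hzW
  obtain ⟨rfl, rfl⟩ := hp.injective hH hι₁ hR ht ht' (h.trans he.symm)
  exact ⟨hy', hW, rfl⟩

theorem notMem_range_start (hp : σ.IsPassage H ι₀ ι₁ R Γ τ) (hH : ContMDiff (𝓡 m) 𝓘(ℝ, ℝ) ∞ H)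
    (hι₁ : Function.Injective ι₁) (hR : Function.Injective R) {z : Phase F} (hz : |z.1.1| < a)
    (hzW : transversal F z ∈ W.target) : B.symm z ∉ range ι₀ := by
  rintro ⟨y, hy⟩
  obtain ⟨h1, -, h2⟩ := hb.eq_of_orbit hp hH hι₁ hR hz hzW (y := y) (t := 0)
    ⟨le_rfl, (hp.pos y).le⟩ ((hp.start y).trans hy)
  exact (hb.time y h1 _ hz).1.ne h2

end IsFlowBox

/-- The data of a perturbation of the Hamiltonian in a flow box: the Hamiltonian is changed by `D`
and the orbits are the images of coordinate lines under `c`. -/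
structure IsBoxPerturbation (F : Type) [NormedAddCommGroup F] [InnerProductSpace ℝ F] (a ρ ε : ℝ)
    (D : Phase F → ℝ) (c : Phase F → Phase F) (f : ℝ × (F × F) → ℝ) (g : ℝ × (F × F) → F × F) :
    Prop where
  contDiff : ContDiff ℝ ∞ D
  contDiff_map : ContDiff ℝ ∞ c
  norm_sub_le : ∀ z, ‖c z - z‖ ≤ ε
  eq_self : ∀ z, z.1.1 < -(a / 4) → c z = z
  hamilton : ∀ z, z.1.1 < 2 * a → ∀ v,
    stdForm F (fderiv ℝ c z (flowDir F)) v = v.2.1 + fderiv ℝ D (c z) v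
  continuous_delay : Continuous f
  abs_delay_le : ∀ x, |f x| ≤ ε
  delay_eq_zero : ∀ x, ρ < ‖x‖ → f x = 0
  eq_lift : ∀ z, a / 4 < z.1.1 → z.1.1 < 2 * a →
    c z = liftPhase (z.1.1 + f (transversal F z)) (transversal F z + (0, g (transversal F z)))

/-- The support of a perturbation. -/
def boxSupport (F : Type) [NormedAddCommGroup F] [InnerProductSpace ℝ F] (a ρ : ℝ) :
    Set (Phase F) :=
  {z | |z.1.1| ≤ a ∧ ‖transversal F z‖ ≤ 3 * ρ}

theorem isCompact_boxSupport [FiniteDimensional ℝ F] (a ρ : ℝ) : IsCompact (boxSupport F a ρ) := by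
  refine (isCompact_closedBall (0 : Phase F) (max a (3 * ρ))).of_isClosed_subset ?_ fun z hz =>
    mem_closedBall_zero_iff.2 (norm_le_of_transversal z hz.1 hz.2)
  exact (isClosed_le continuous_fst.fst.abs continuous_const).inter
    (isClosed_le (transversal F).continuous.norm continuous_const)

section Perturbed

variable {ρ ε A : ℝ} {D : Phase F → ℝ} {c : Phase F → Phase F} {f : ℝ × (F × F) → ℝ}
  {g : ℝ × (F × F) → F × F}

-- The field `hamilton` is Hamilton's equation for `p₁ + D` along the image of a coordinate line,
-- and `H'` is `p₁ + D` in the chart up to a constant.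
omit [T2Space Ω] in
theorem IsBoxPerturbation.isOrbit (hD : IsBoxPerturbation F a ρ ε D c f g)
    {x : Ω} (hB : σ.IsDarbouxChart F H x B)
    (hH' : ContMDiff (𝓡 m) 𝓘(ℝ, ℝ) ∞ H') (hH'B : ∀ y ∈ B.source, H' y = H y + D (B y))
    {s : Set ℝ} {t₀ : ℝ} {w : ℝ × (F × F)} (hs : ∀ t ∈ s, t - t₀ < 2 * a)
    (hc : ∀ t ∈ s, c (liftPhase (t - t₀) w) ∈ B.target) :
    σ.IsOrbit H' (fun t => B.symm (c (liftPhase (t - t₀) w))) s := fun t ht => by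
  have h1 : HasDerivWithinAt (fun t : ℝ => liftPhase (t - t₀) w) (flowDir F) s t := by
    have h2 := (((hasDerivAt_id t).sub_const t₀).smul_const (flowDir F)).const_add (liftPhase 0 w)
    simp only [liftPhase_add_smul, one_smul, zero_add, id] at h2
    exact h2.hasDerivWithinAt
  have h2 : HasDerivWithinAt (fun t : ℝ => c (liftPhase (t - t₀) w)) _ s t :=
    ((hD.contDiff_map.differentiable (by simp)) _).hasFDerivAt.comp_hasDerivWithinAt t h1
  refine σ.hasVelocity_of_formIn hB.isSmoothChart h2 (hc t ht)
    (mdifferentiable_of_contMDiff hH' _) fun v => ?_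
  rw [hB.formIn_eq _ (hc t ht), hD.hamilton _ (by exact hs t ht)]
  have h3 : H' ∘ B.symm =ᶠ[𝓝 (c (liftPhase (t - t₀) w))] fun z => (H x + z.2.1) + D z := by
    filter_upwards [B.open_target.mem_nhds (hc t ht)] with z hz
    rw [Function.comp_apply, hH'B _ (B.map_target hz), hB.energy z hz, B.right_inv hz]
  let P : Phase F →L[ℝ] ℝ :=
    (ContinuousLinearMap.fst ℝ ℝ F).comp (ContinuousLinearMap.snd ℝ (Pos F) (Pos F))
  have h4 : HasFDerivAt (fun z => (H x + z.2.1) + D z) (P + fderiv ℝ D (c (liftPhase (t - t₀) w)))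
      (c (liftPhase (t - t₀) w)) :=
    (P.hasFDerivAt.const_add (H x)).add ((hD.contDiff.differentiable (by simp)) _).hasFDerivAt
  rw [h3.fderiv_eq, h4.fderiv]
  rfl

variable (hD : IsBoxPerturbation F a ρ ε D c f g) (ha : 0 < a) (hρ : 0 < ρ) (hερ : ε ≤ ρ)
  (hεa : ε ≤ a / 4) (haA : 2 * a < A) (hρA : 4 * ρ < A)
  (hb : σ.IsFlowBox d H ι₀ Γ τ y₀ t₁ B W θ A) (hρW : Metric.closedBall 0 (4 * ρ) ⊆ W.target)
  (hp : σ.IsPassage H ι₀ ι₁ R Γ τ) (hH : ContMDiff (𝓡 m) 𝓘(ℝ, ℝ) ∞ H)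
  (hι₁ : Function.Injective ι₁) (hR : Function.Injective R)
  (hH' : ContMDiff (𝓡 m) 𝓘(ℝ, ℝ) ∞ H') (hH'B : ∀ y ∈ B.source, H' y = H y + D (B y))
  (hC : IsClosed (B.symm '' boxSupport F a ρ))
  (hH'C : ∀ x ∉ B.symm '' boxSupport F a ρ, H' x = H x)

-- The new orbit follows `Γ y` up to the box, then the bent line, then `Γ y'`. It leaves on the line
-- of `y'` with `q₁` advanced by `f (W y)`; together with the offsets `θ` this gives the time shift
-- `κ` and the new passage time `τ y' - κ`.
include hD ha hρ hερ hεa haA hρA hb hρW hp hH hι₁ hR hH' hH'B hC hH'C in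
theorem IsFlowBox.exists_isFirstPassage {y y' : S₀} (hy : y ∈ W.source) (hy' : y' ∈ W.source)
    (hyρ : ‖W y‖ ≤ 3 * ρ) (hyy' : W y' = W y + (0, g (W y))) :
    ∃ γ, σ.IsFirstPassage H' ι₁ (ι₀ y) (τ y' + θ y' - θ y - f (W y)) γ (R y') := by
  have hf := abs_le.1 (hD.abs_delay_le (W y))
  have hneg : |-(3 * a / 2)| < A := by rw [abs_lt]; constructor <;> linarith
  have hpos : |3 * a / 2 + f (W y)| < A := by rw [abs_lt]; constructor <;> linarith
  have n1 := hb.time y hy _ hneg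
  have n2 := hb.time y' hy' _ hpos
  set t₀ := t₁ - θ y with ht₀
  set κ := θ y - θ y' + f (W y) with hκ
  have hT : τ y' + θ y' - θ y - f (W y) = τ y' - κ := by rw [hκ]; ring
  have n3 : t₀ + 3 * a / 2 + κ ∈ Ioo 0 (τ y') := by
    have : t₀ + 3 * a / 2 + κ = t₁ - θ y' + (3 * a / 2 + f (W y)) := by rw [ht₀, hκ]; ring
    rwa [this]
  rw [hT]
  have hbox (z : Phase F) (h1 : |z.1.1| ≤ a) (h2 : ‖transversal F z‖ ≤ 3 * ρ) :
      |z.1.1| < A ∧ transversal F z ∈ W.target :=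
    ⟨by linarith, hρW (mem_closedBall_zero_iff.2 (by linarith))⟩
  have hcz (t : ℝ) (ht : t ∈ Icc (t₀ + -(3 * a / 2)) (t₀ + 3 * a / 2)) :
      |(c (liftPhase (t - t₀) (W y))).1.1| < A ∧
        ‖transversal F (c (liftPhase (t - t₀) (W y)))‖ ≤ 4 * ρ := by
    have h1 := hD.norm_sub_le (liftPhase (t - t₀) (W y))
    generalize c (liftPhase (t - t₀) (W y)) = z at h1
    constructor
    · have h2 : |z.1.1 - (t - t₀)| ≤ ε :=
        ((norm_fst_le (z - liftPhase (t - t₀) (W y)).1).trans (norm_fst_le _)).trans h1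
      rw [abs_le] at h2
      rw [abs_lt]
      constructor <;> linarith [ht.1, ht.2]
    · have h2 := (norm_transversal_le _).trans h1
      rw [map_sub, transversal_liftPhase] at h2
      have h3 := norm_le_norm_add_norm_sub' (transversal F z) (W y)
      linarith
  have htarget (t : ℝ) (ht : t ∈ Icc (t₀ + -(3 * a / 2)) (t₀ + 3 * a / 2)) :
      c (liftPhase (t - t₀) (W y)) ∈ B.target := by
    refine hb.ball (mem_ball_zero_iff.2 ?_)
    have := norm_le_of_transversal _ (hcz t ht).1.le (hcz t ht).2
    have h2 := (hcz t ht)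
    refine (norm_le_of_transversal _ le_rfl (hcz t ht).2).trans_lt (max_lt h2.1 hρA)
  -- The pieces are joined at `q₁ = ± 3a/2`: outside the support `|q₁| ≤ a` even after a shift by `a
  -- / 4`, yet below `2 a`, up to which the bent line is known to be an orbit.
  let γ (t : ℝ) : Ω := if t ≤ t₀ + -(3 * a / 2) then Γ y t else
    if t ≤ t₀ + 3 * a / 2 then B.symm (c (liftPhase (t - t₀) (W y))) else Γ y' (t + κ)
  have hγ1 (t) (ht : t ≤ t₀ + -(3 * a / 2)) : γ t = Γ y t := if_pos ht
  have hγ2 (t) (ht : t ∈ Icc (t₀ + -(3 * a / 2)) (t₀ + 3 * a / 2)) :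
      γ t = B.symm (c (liftPhase (t - t₀) (W y))) := by
    rcases ht.1.eq_or_lt with h0 | h0
    · rw [hγ1 t h0.ge, ← h0, hb.orbit y hy _ hneg, add_sub_cancel_left, hD.eq_self]
      change -(3 * a / 2) < _
      linarith
    · rw [show γ t = if t ≤ t₀ + 3 * a / 2 then _ else _ from if_neg (not_le.2 h0), if_pos ht.2]
  have hγ3 (t) (ht : t₀ + 3 * a / 2 ≤ t) : γ t = Γ y' (t + κ) := by
    rcases ht.eq_or_lt with h0 | h0
    · rw [hγ2 t ⟨by linarith, h0.ge⟩, ← h0, add_sub_cancel_left,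
        hD.eq_lift _ (by change _ < 3 * a / 2; linarith) (by change 3 * a / 2 < _; linarith),
        transversal_liftPhase, ← hyy']
      change B.symm (liftPhase (3 * a / 2 + f (W y)) _) = _
      rw [← hb.orbit y' hy' _ hpos]
      congr 1
      rw [ht₀, hκ]
      ring
    · rw [show γ t = if t ≤ t₀ + 3 * a / 2 then _ else _ from if_neg (by linarith),
        if_neg (not_le.2 h0)]
  have o1 : σ.IsOrbit H' γ (Icc 0 (t₀ + -(3 * a / 2))) := by
    refine (((hp.orbit y).mono (Icc_subset_Icc_right n1.2.le)).congr_field hC hH'C ?_).congr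
      fun t ht => hγ1 t ht.2
    rintro t ht ⟨z, hz, hzt⟩
    obtain ⟨h1, h2⟩ := hbox z hz.1 hz.2
    obtain ⟨-, -, h3⟩ := hb.eq_of_orbit hp hH hι₁ hR h1 h2 ⟨ht.1, ht.2.trans n1.2.le⟩ hzt.symm
    have h4 := (abs_le.1 hz.1).1
    linarith [ht.2]
  have o2 : σ.IsOrbit H' γ (Icc (t₀ + -(3 * a / 2)) (t₀ + 3 * a / 2)) :=
    (hD.isOrbit hb.darboux hH' hH'B (fun t ht => by linarith [ht.2]) htarget).congr hγ2
  have o3 : σ.IsOrbit H' γ (Icc (t₀ + 3 * a / 2) (τ y' - κ)) := by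
    have h0 := (((hp.orbit y').mono (Icc_subset_Icc_left n3.1.le)).comp_add κ)
    rw [add_sub_cancel_right] at h0
    refine (h0.congr_field hC hH'C ?_).congr fun t ht => hγ3 t ht.1
    rintro t ht ⟨z, hz, hzt⟩
    obtain ⟨h1, h2⟩ := hbox z hz.1 hz.2
    obtain ⟨-, -, h3⟩ := hb.eq_of_orbit hp hH hι₁ hR h1 h2
      ⟨by linarith [n3.1, ht.1], by linarith [ht.2]⟩ hzt.symm
    have h4 := (abs_le.1 hz.1).2
    have h5 := ht.1
    rw [ht₀] at h5
    rw [hκ] at h3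
    linarith
  refine ⟨γ, by linarith [n1.1, n3.2],
    ((o1.union n1.1.le (by linarith) o2).union (by linarith [n1.1]) (by linarith [n3.2]) o3), ?_, ?_,
    fun t ht => ?_⟩
  · rw [hγ1 0 n1.1.le, hp.start]
  · rw [hγ3 _ (by linarith [n3.2]), sub_add_cancel, hp.finish]
  · rcases le_total t (t₀ + -(3 * a / 2)) with h1 | h1
    · rw [hγ1 t h1]
      exact hp.first y t ⟨ht.1, by linarith [n1.2]⟩
    -- The bent line stays in the box, whose points lie on old orbits strictly before they reach
    -- `S₁`.
    rcases le_total t (t₀ + 3 * a / 2) with h2 | h2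
    · rw [hγ2 t ⟨h1, h2⟩]
      obtain ⟨h3, h4⟩ := hcz t ⟨h1, h2⟩
      exact hb.notMem_range hp h3 (hρW (mem_closedBall_zero_iff.2 h4))
    · rw [hγ3 t h2]
      exact hp.first y' _ ⟨by linarith [n3.1], by linarith [ht.2]⟩

-- Orbits with `‖W y‖ ≤ 3 ρ` may cross the support of `D` and are glued; all others miss it and are
-- unchanged. On `W.source` outside `V` the shift and the displacement vanish, so the old and new
-- passage times agree there and patch continuously.
include hD ha hρ hερ hεa haA hρA hb hρW hp hH hι₁ hR hH' hH'B hC hH'C in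
theorem IsFlowBox.exists_time [T2Space S₀] [FiniteDimensional ℝ F] (hτ : Continuous τ) {Ψ : S₀ → S₀}
    (hΨ : Continuous Ψ) (hΨV : ∀ y ∉ W.symm '' Metric.closedBall 0 ρ, Ψ y = y)
    (hΨW : ∀ y ∈ W.source, ‖W y‖ ≤ 3 * ρ → Ψ y ∈ W.source ∧ W (Ψ y) = W y + (0, g (W y))) :
    ∃ τ' : S₀ → ℝ, Continuous τ' ∧
      ∀ y, ∃ γ, σ.IsFirstPassage H' ι₁ (ι₀ y) (τ' y) γ (R (Ψ y)) := by
  classical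
  have hsub : Metric.closedBall 0 ρ ⊆ W.target :=
    (Metric.closedBall_subset_closedBall (by linarith)).trans hρW
  set V := W.symm '' Metric.closedBall 0 ρ with hVdef
  have hV : IsClosed V :=
    ((isCompact_closedBall _ _).image_of_continuousOn (W.continuousOn_symm.mono hsub)).isClosed
  have hVmem (y) (hy : y ∈ V) : y ∈ W.source ∧ ‖W y‖ ≤ ρ := by
    obtain ⟨x, hx, rfl⟩ := hy
    rw [W.right_inv (hsub hx)]
    exact ⟨W.map_target (hsub hx), mem_closedBall_zero_iff.1 hx⟩
  have hmemV (y) (hy : y ∈ W.source) (hyρ : ‖W y‖ ≤ ρ) : y ∈ V :=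
    ⟨W y, mem_closedBall_zero_iff.2 hyρ, W.left_inv hy⟩
  let T (y : S₀) : ℝ := τ (Ψ y) + θ (Ψ y) - θ y - f (W y)
  let τ' (y : S₀) : ℝ := if y ∈ V then T y else τ y
  have hτ'T (y) (hy : y ∈ W.source) : τ' y = T y := by
    by_cases hyV : y ∈ V
    · exact if_pos hyV
    · have h1 : f (W y) = 0 := hD.delay_eq_zero _ (lt_of_not_ge fun h => hyV (hmemV y hy h))
      simp only [τ', T, if_neg hyV, hΨV y hyV, h1]
      ring
  refine ⟨τ', continuous_iff_continuousAt.2 fun y => ?_, fun y => ?_⟩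
  · by_cases hyV : y ∈ V
    · obtain ⟨hy, hyρ⟩ := hVmem y hyV
      have hΨy := (hΨW y hy (by linarith)).1
      have hθ (y) (hy : y ∈ W.source) : ContinuousAt θ y :=
        hb.cont.continuousAt (W.open_source.mem_nhds hy)
      have hT : ContinuousAt T y :=
        (((hτ.continuousAt.comp hΨ.continuousAt).add
          (ContinuousAt.comp (hθ _ hΨy) hΨ.continuousAt)).sub (hθ y hy)).sub
          (hD.continuous_delay.continuousAt.comp (W.continuousAt hy))
      refine hT.congr_of_eventuallyEq ?_
      filter_upwards [W.open_source.mem_nhds hy] with z hz using hτ'T z hz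
    · refine hτ.continuousAt.congr_of_eventuallyEq ?_
      filter_upwards [hV.isOpen_compl.mem_nhds hyV] with z hz using if_neg hz
  · by_cases hy : y ∈ W.source ∧ ‖W y‖ ≤ 3 * ρ
    · rw [hτ'T y hy.1]
      obtain ⟨h1, h2⟩ := hΨW y hy.1 hy.2
      exact hb.exists_isFirstPassage hD ha hρ hερ hεa haA hρA hρW hp hH hι₁ hR hH' hH'B hC hH'C
        hy.1 h1 hy.2 h2
    · have hyV : y ∉ V := fun h => hy ⟨(hVmem y h).1, by linarith [(hVmem y h).2]⟩
      rw [show τ' y = τ y from if_neg hyV, hΨV y hyV]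
      refine ⟨Γ y, hp.pos y, (hp.orbit y).congr_field hC hH'C ?_, hp.start y, hp.finish y,
        hp.first y⟩
      rintro t ht ⟨z, hz, hzt⟩
      obtain ⟨h1, h2, -⟩ := hb.eq_of_orbit hp hH hι₁ hR (by linarith [hz.1])
        (hρW (mem_closedBall_zero_iff.2 (by linarith [hz.2]))) ht hzt.symm
      exact hy ⟨h1, h2 ▸ hz.2⟩

end Perturbed

end SymplecticForm

/-! ### Diffeomorphisms in coordinates -/

section Displacement

variable {d : ℕ} {S E : Type*} [TopologicalSpace S] [ChartedSpace (EuclideanSpace ℝ (Fin d)) S]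
  [NormedAddCommGroup E] [NormedSpace ℝ E]

/-- A diffeomorphism supported in a coordinate neighbourhood, in coordinates. -/
theorem IsSmoothChart.exists_displacement {φ : OpenPartialHomeomorph S E}
    (hφ : IsSmoothChart (𝓡 d) φ) {K : Set E} (hK : IsClosed K) (hKφ : K ⊆ φ.target) {Ψ : S → S}
    (hΨ : ContMDiff (𝓡 d) (𝓡 d) ∞ Ψ) (hsrc : ∀ y ∈ φ.source, Ψ y ∈ φ.source)
    (hid : ∀ y ∉ φ.symm '' K, Ψ y = y) :
    ∃ g : E → E, ContDiff ℝ ∞ g ∧ (∀ u ∈ φ.target, φ (Ψ (φ.symm u)) = u + g u) ∧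
      (∀ u ∉ K, g u = 0) ∧ ∀ (r : ℕ) (δ : ℝ), 0 ≤ δ →
        (∀ j ≤ r, ∀ y ∈ φ.symm '' K, ‖iteratedFDeriv ℝ j (φ ∘ Ψ ∘ φ.symm) (φ y) -
          iteratedFDeriv ℝ j (fun u : E => u) (φ y)‖ ≤ δ) →
        ∀ j ≤ r, ∀ u, ‖iteratedFDeriv ℝ j g u‖ ≤ δ := by
  classical
  let g (u : E) : E := φ.target.indicator (fun u => φ (Ψ (φ.symm u)) - u) u
  have hg (u) (hu : u ∈ φ.target) : g u = φ (Ψ (φ.symm u)) - u := indicator_of_mem hu _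
  have hgK (u) (hu : u ∉ K) : g u = 0 := by
    by_cases hut : u ∈ φ.target
    · rw [hg u hut, hid, φ.right_inv hut, sub_self]
      rintro ⟨z, hz, hzu⟩
      rw [φ.symm.injOn (hKφ hz) hut hzu] at hz
      exact hu hz
    · exact indicator_of_notMem hut _
  have hgev (u) (hu : u ∈ φ.target) : g =ᶠ[𝓝 u] (φ ∘ Ψ ∘ φ.symm) - fun u => u := by
    filter_upwards [φ.open_target.mem_nhds hu] with z hz using hg z hz
  have hsm (u) (hu : u ∈ φ.target) : ContDiffAt ℝ ∞ (φ ∘ Ψ ∘ φ.symm) u :=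
    ((hφ.contMDiffAt (hsrc _ (φ.map_target hu))).comp u
      ((hΨ _).comp u (hφ.contMDiffAt_symm hu))).contDiffAt
  have hg0 (u) (hu : u ∉ K) : g =ᶠ[𝓝 u] fun _ => 0 := by
    filter_upwards [hK.isOpen_compl.mem_nhds hu] with z hz using hgK z hz
  refine ⟨g, contDiff_iff_contDiffAt.2 fun u => ?_, fun u hu => by rw [hg u hu]; abel, hgK,
    fun r δ hδ h j hj u => ?_⟩
  · by_cases hu : u ∈ K
    · exact ((hsm u (hKφ hu)).sub contDiffAt_id).congr_of_eventuallyEq (hgev u (hKφ hu))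
    · exact contDiffAt_const.congr_of_eventuallyEq (hg0 u hu)
  · by_cases hu : u ∈ K
    · have h1 := h j hj _ ⟨u, hu, rfl⟩
      rw [φ.right_inv (hKφ hu)] at h1
      rw [((hgev u (hKφ hu)).iteratedFDeriv ℝ j).eq_of_nhds, iteratedFDeriv_sub_apply]
      · exact h1
      · exact (hsm u (hKφ hu)).of_le (by exact_mod_cast le_top)
      · exact contDiffAt_id
    · rw [((hg0 u hu).iteratedFDeriv ℝ j).eq_of_nhds]
      have : iteratedFDeriv ℝ j (fun _ : E => (0 : E)) u = 0 := by
        rw [iteratedFDeriv_fun_zero]; rfl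
      rw [this, norm_zero]
      exact hδ

end Displacement

/-! ### The transition between two Poincaré maps is symplectic -/

namespace SymplecticForm

variable {m : ℕ} {Ω : Type*} [TopologicalSpace Ω] [T2Space Ω]
  [ChartedSpace (EuclideanSpace ℝ (Fin m)) Ω] [IsManifold (𝓡 m) ∞ Ω]
  {d : ℕ} {S₀ S₁ : Type*} [TopologicalSpace S₀] [ChartedSpace (EuclideanSpace ℝ (Fin d)) S₀]
  [TopologicalSpace S₁] [ChartedSpace (EuclideanSpace ℝ (Fin d)) S₁]
  {σ : SymplecticForm m Ω} {H : Ω → ℝ}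
  {ι₀ : S₀ → Ω} {ι₁ : S₁ → Ω} {R R' : S₀ → S₁} {Γ : S₀ → ℝ → Ω} {τ : S₀ → ℝ} {y₀ : S₀} {t₁ : ℝ}
  {F : Type} [NormedAddCommGroup F] [InnerProductSpace ℝ F]
  {B : OpenPartialHomeomorph Ω (Phase F)} {W : OpenPartialHomeomorph S₀ (ℝ × (F × F))}
  {θ : S₀ → ℝ} {a : ℝ} {Ψ : S₀ → S₀}

omit [T2Space Ω] [TopologicalSpace S₀] [TopologicalSpace S₁] in
theorem IsPassage.energy_comp (hp : σ.IsPassage H ι₀ ι₁ R Γ τ)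
    (hH : ContMDiff (𝓡 m) 𝓘(ℝ, ℝ) ∞ H) (hR' : ∀ y, R (Ψ y) = R' y)
    (hE : ∀ y, H (ι₁ (R' y)) = H (ι₀ y)) (y : S₀) : H (ι₀ (Ψ y)) = H (ι₀ y) := by
  rw [← hE y, ← hR', ← hp.finish, hp.energy_eq hH ⟨(hp.pos _).le, le_rfl⟩]

/-- The transition between two Poincaré maps is a symplectic map in the coordinates of a flow
box. -/
theorem IsFlowBox.areaForm_eq (hb : σ.IsFlowBox d H ι₀ Γ τ y₀ t₁ B W θ a)
    (hp : σ.IsPassage H ι₀ ι₁ R Γ τ) {k : ℕ} (hm : m = 2 * (k + 1))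
    (hH : ContMDiff (𝓡 m) 𝓘(ℝ, ℝ) ∞ H) (hτ : Continuous τ)
    (hι₀ : ContMDiff (𝓡 d) (𝓡 m) ∞ ι₀) (hι₁ : ContMDiff (𝓡 d) (𝓡 m) ∞ ι₁)
    (hR : ContMDiff (𝓡 d) (𝓡 d) ∞ R) (hfield : ∀ y, σ.field H (ι₀ y) ≠ 0)
    (hΨ : ContMDiff (𝓡 d) (𝓡 d) ∞ Ψ) (hR' : ∀ y, R (Ψ y) = R' y)
    (hform : ∀ y v w, tderiv (𝓡 d) 𝓘(ℝ, ℝ) (H ∘ ι₀) y v = 0 →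
      tderiv (𝓡 d) 𝓘(ℝ, ℝ) (H ∘ ι₀) y w = 0 →
      σ.bilin (ι₁ (R' y)) (tderiv (𝓡 d) (𝓡 m) ι₁ (R' y) (tderiv (𝓡 d) (𝓡 d) R' y v))
        (tderiv (𝓡 d) (𝓡 m) ι₁ (R' y) (tderiv (𝓡 d) (𝓡 d) R' y w)) =
      σ.bilin (ι₀ y) (tderiv (𝓡 d) (𝓡 m) ι₀ y v) (tderiv (𝓡 d) (𝓡 m) ι₀ y w))
    {g : ℝ × (F × F) → F × F} (hg : Differentiable ℝ g)
    (hgΨ : ∀ x ∈ W.target, W (Ψ (W.symm x)) = x + (0, g x))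
    (hsrc : ∀ y ∈ W.source, Ψ y ∈ W.source) {x : ℝ × (F × F)} (hx : x ∈ W.target) (u v : F × F) :
    areaForm F (u + fderiv ℝ g x (0, u)) (v + fderiv ℝ g x (0, v)) = areaForm F u v := by
  have hW := hb.chart
  set y := W.symm x with hy
  have hys : y ∈ W.source := W.map_target hx
  have hΨys := hsrc y hys
  have hΨd : MDifferentiableAt (𝓡 d) (𝓡 d) Ψ y := (hΨ y).mdifferentiableAt (by simp)
  have hq : HasFDerivAt (fun x => x + (0, g x)) (ContinuousLinearMap.id ℝ (ℝ × (F × F)) +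
      (ContinuousLinearMap.inr ℝ ℝ (F × F)).comp (fderiv ℝ g x)) x :=
    (hasFDerivAt_id x).add
      ((ContinuousLinearMap.inr ℝ ℝ (F × F)).hasFDerivAt.comp x (hg x).hasFDerivAt)
  have e1 : W ∘ (Ψ ∘ W.symm) =ᶠ[𝓝 x] fun x => x + (0, g x) := by
    filter_upwards [W.open_target.mem_nhds hx] with z hz using hgΨ z hz
  have e2 := e1.fderiv_eq (𝕜 := ℝ)
  rw [hq.fderiv, ← tderiv_eq_fderiv] at e2
  have e3 := tderiv_comp (f := Ψ ∘ W.symm) (hW.mdifferentiableAt hΨys)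
    (hΨd.comp x (hW.mdifferentiableAt_symm hx) : MDifferentiableAt 𝓘(ℝ, ℝ × (F × F)) (𝓡 d)
      (Ψ ∘ W.symm) x)
  rw [tderiv_comp (f := W.symm) hΨd (hW.mdifferentiableAt_symm hx), e2] at e3
  set T := tderiv 𝓘(ℝ, ℝ × (F × F)) (𝓡 d) W.symm x with hT
  have e4 (u : F × F) : tderiv (𝓡 d) 𝓘(ℝ, ℝ × (F × F)) W (Ψ y)
      (tderiv (𝓡 d) (𝓡 d) Ψ y (T (0, u))) = (0, u + fderiv ℝ g x (0, u)) := by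
    have h1 := congrArg (fun A : ℝ × (F × F) →L[ℝ] ℝ × (F × F) => A (0, u)) e3
    refine h1.symm.trans ?_
    change ((0, u) : ℝ × (F × F)) + (0, fderiv ℝ g x (0, u)) = _
    rw [Prod.mk_add_mk, add_zero]
  have e5 (u : F × F) : tderiv (𝓡 d) 𝓘(ℝ, ℝ × (F × F)) W y (T (0, u)) = (0, u) :=
    hW.tderiv_tderiv_symm hx _
  have z1 (u : F × F) : tderiv (𝓡 d) 𝓘(ℝ, ℝ) (H ∘ ι₀) y (T (0, u)) = 0 := by
    rw [← hb.tderiv_fst y hys, e5]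
  have z2 (u : F × F) : tderiv (𝓡 d) 𝓘(ℝ, ℝ) (H ∘ ι₀) (Ψ y)
      (tderiv (𝓡 d) (𝓡 d) Ψ y (T (0, u))) = 0 := by
    rw [← hb.tderiv_fst _ hΨys, e4]
  -- Vectors without `p₁`-component are tangent to energy levels, where the area form is the form of
  -- `S₀`. The form at `Ψ y` is carried to `S₁` by `R`; since `R ∘ Ψ = R'` preserves the form as
  -- well, it equals the form at `y`.
  have f1 := hb.form y hys _ _ (z1 u) (z1 v)
  have f2 := hb.form _ hΨys _ _ (z2 u) (z2 v)
  rw [e5, e5] at f1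
  rw [e4, e4, ← hp.bilin_eq hm hH hτ hι₀ hι₁ hR (hfield _) (z2 u) (z2 v)] at f2
  have f3 := hform y _ _ (z1 u) (z1 v)
  have hR'eq : R ∘ Ψ = R' := funext hR'
  have e6 : tderiv (𝓡 d) (𝓡 d) R' y = (tderiv (𝓡 d) (𝓡 d) R (Ψ y)).comp
      (tderiv (𝓡 d) (𝓡 d) Ψ y) := by
    rw [← hR'eq]
    exact tderiv_comp ((hR _).mdifferentiableAt (by simp)) hΨd
  rw [e6, ← hR' y] at f3
  exact f2.trans (f3.trans f1.symm)

end SymplecticForm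

/-! ### Realizing nearby maps as Poincaré maps -/

namespace SymplecticForm

variable {m : ℕ} {Ω : Type*} [TopologicalSpace Ω] [T2Space Ω]
  [ChartedSpace (EuclideanSpace ℝ (Fin m)) Ω] [IsManifold (𝓡 m) ∞ Ω]
  {σ : SymplecticForm m Ω}

omit [T2Space Ω] in
theorem PreservesFormOnLevels.bilin_eq {H : Ω → ℝ} {S₀ S₁ : Type*} [TopologicalSpace S₀]
    [ChartedSpace (EuclideanSpace ℝ (Fin (m - 1))) S₀] [TopologicalSpace S₁]
    [ChartedSpace (EuclideanSpace ℝ (Fin (m - 1))) S₁] {ι₀ : S₀ → Ω} {ι₁ : S₁ → Ω} {R : S₀ → S₁}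
    (h : σ.PreservesFormOnLevels H ι₀ ι₁ R) (y : S₀) (v w : EuclideanSpace ℝ (Fin (m - 1)))
    (hv : tderiv (𝓡 (m - 1)) 𝓘(ℝ, ℝ) (H ∘ ι₀) y v = 0)
    (hw : tderiv (𝓡 (m - 1)) 𝓘(ℝ, ℝ) (H ∘ ι₀) y w = 0) :
    σ.bilin (ι₁ (R y))
        (tderiv (𝓡 (m - 1)) (𝓡 m) ι₁ (R y) (tderiv (𝓡 (m - 1)) (𝓡 (m - 1)) R y v))
        (tderiv (𝓡 (m - 1)) (𝓡 m) ι₁ (R y) (tderiv (𝓡 (m - 1)) (𝓡 (m - 1)) R y w)) =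
      σ.bilin (ι₀ y) (tderiv (𝓡 (m - 1)) (𝓡 m) ι₀ y v) (tderiv (𝓡 (m - 1)) (𝓡 m) ι₀ y w) :=
  (σ.bilin_eq_form _ _ _).trans ((h y v w hv hw).trans (σ.bilin_eq_form _ _ _).symm)

omit [T2Space Ω] in
theorem IsSection.congr {H H' : Ω → ℝ} {S : Type*} [TopologicalSpace S]
    [ChartedSpace (EuclideanSpace ℝ (Fin (m - 1))) S] {ι : S → Ω} (h : σ.IsSection H ι)
    {C : Set Ω} (hC : IsClosed C) (hH' : ∀ x ∉ C, H' x = H x) (hι : ∀ x ∈ C, x ∉ range ι) :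
    σ.IsSection H' ι where
  isSmoothEmbedding := h.isSmoothEmbedding
  transverse y := by
    have h1 : ι y ∈ Cᶜ := fun hy => hι _ hy ⟨y, rfl⟩
    have h2 : σ.hamiltonianField H' (ι y) = σ.hamiltonianField H (ι y) :=
      field_congr (Filter.eventually_of_mem (hC.isOpen_compl.mem_nhds h1) hH')
    rw [h2]
    exact h.transverse y

omit [T2Space Ω] in
theorem IsSection.contMDiff {H : Ω → ℝ} {S : Type*} [TopologicalSpace S]
    [ChartedSpace (EuclideanSpace ℝ (Fin (m - 1))) S] [IsManifold (𝓡 (m - 1)) ∞ S] {ι : S → Ω}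
    (h : σ.IsSection H ι) : ContMDiff (𝓡 (m - 1)) (𝓡 m) ∞ ι :=
  h.isSmoothEmbedding.contMDiff

omit [T2Space Ω] in
theorem IsSection.field_ne_zero {H : Ω → ℝ} {S : Type*} [TopologicalSpace S]
    [ChartedSpace (EuclideanSpace ℝ (Fin (m - 1))) S] {ι : S → Ω} (h : σ.IsSection H ι) (y : S) :
    σ.field H (ι y) ≠ 0 := fun h0 =>
  h.transverse y ⟨0, ((tderiv (𝓡 (m - 1)) (𝓡 m) ι y).map_zero).trans h0.symm⟩

variable {H : C^∞⟮𝓡 m, Ω; 𝓘(ℝ, ℝ), ℝ⟯}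
  {S₀ : Type*} [TopologicalSpace S₀] [ChartedSpace (EuclideanSpace ℝ (Fin (m - 1))) S₀]
  [IsManifold (𝓡 (m - 1)) ∞ S₀]
  {S₁ : Type*} [TopologicalSpace S₁] [ChartedSpace (EuclideanSpace ℝ (Fin (m - 1))) S₁]
  [IsManifold (𝓡 (m - 1)) ∞ S₁]
  {ι₀ : S₀ → Ω} {ι₁ : S₁ → Ω} {R : S₀ → S₁} {Γ : S₀ → ℝ → Ω} {τ : S₀ → ℝ} {y₀ : S₀} {t₁ : ℝ}
  {F : Type} [NormedAddCommGroup F] [InnerProductSpace ℝ F]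
  {B : OpenPartialHomeomorph Ω (Phase F)} {W : OpenPartialHomeomorph S₀ (ℝ × (F × F))}
  {θ : S₀ → ℝ} {A ρ : ℝ}

/-- The maps which correspond in the coordinates of a flow box to a family of symplectic maps close
to the identity are Poincaré maps of perturbed Hamiltonians. -/
theorem IsFlowBox.exists_realization [FiniteDimensional ℝ F] [Nontrivial F]
    (hb : σ.IsFlowBox (m - 1) H ι₀ Γ τ y₀ t₁ B W θ A) (hA : 0 < A) (hρ : 0 < ρ) (hρA : 4 * ρ < A)
    (hρW : Metric.closedBall 0 (4 * ρ) ⊆ W.target) (hp : σ.IsPassage H ι₀ ι₁ R Γ τ) {k : ℕ}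
    (hm : m = 2 * (k + 1)) (hτ : Continuous τ) (h₀ : σ.IsSection H ι₀) (h₁ : σ.IsSection H ι₁)
    (hR : ContMDiff (𝓡 (m - 1)) (𝓡 (m - 1)) ∞ R) (hRinj : Function.Injective R)
    {G : ℝ × (ℝ × (F × F)) → F × F} (hG : ContDiff ℝ ∞ G) (hG0 : ∀ x, G (0, x) = 0)
    (hGρ : ∀ s x, ρ < ‖x‖ → G (s, x) = 0) :
    ∃ Hs : ℝ → C^∞⟮𝓡 m, Ω; 𝓘(ℝ, ℝ), ℝ⟯,
      Filter.Tendsto Hs (𝓝 0) (@nhds _ (smoothFunctionTopology m Ω) H) ∧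
      (∀ s, ∀ x ∉ B.symm '' Metric.ball 0 A, Hs s x = H x) ∧
      ∀ᶠ s in 𝓝 (0 : ℝ), ∀ (R' : S₀ → S₁) (Ψ : S₀ → S₀),
        ContMDiff (𝓡 (m - 1)) (𝓡 (m - 1)) ∞ Ψ → (∀ y, R (Ψ y) = R' y) →
        σ.PreservesFormOnLevels H ι₀ ι₁ R' →
        (∀ y ∉ W.symm '' Metric.closedBall 0 ρ, Ψ y = y) → (∀ y ∈ W.source, Ψ y ∈ W.source) →
        (∀ x ∈ W.target, W (Ψ (W.symm x)) = x + (0, G (s, x))) →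
        σ.IsPoincareMap (Hs s) ι₀ ι₁ R' := by
  have hH := H.contMDiff
  -- With `a = A / 3` the region `|q₁| < 2 a`, where orbits are modified, fits into the box of
  -- half-width `A`.
  have ha : 0 < A / 3 := by positivity
  have hε : 0 < min ρ (A / 3 / 4) := lt_min hρ (by positivity)
  obtain ⟨δ, hδ, D, c, hD, hc, hD0, hDsupp, hcε, hcid, hham, hsymp⟩ :=
    exists_hamiltonian_perturbation hρ ha hε hG hG0 hGρ
  have hKball : boxSupport F (A / 3) ρ ⊆ Metric.ball 0 A := fun z hz => by
    rw [mem_ball_zero_iff]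
    exact (norm_le_of_transversal z hz.1 hz.2).trans_lt (max_lt (by linarith) (by linarith))
  obtain ⟨Hs, hHsB, hHsC, hHs⟩ := exists_tendsto_perturbation H hb.darboux.isSmoothChart
    (isCompact_boxSupport (A / 3) ρ) (hKball.trans hb.ball) hD hD0 (fun s z hz => by
      refine hDsupp s z ?_
      by_contra hcon
      push Not at hcon
      exact hz hcon)
  refine ⟨Hs, hHs, fun s x hx => hHsC s x fun h => hx (image_mono hKball h), ?_⟩
  have hC : IsClosed (B.symm '' boxSupport F (A / 3) ρ) :=
    ((isCompact_boxSupport _ _).image_of_continuousOn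
      (B.continuousOn_symm.mono (hKball.trans hb.ball))).isClosed
  have hιinj : Function.Injective ι₁ := h₁.isSmoothEmbedding.isEmbedding.injective
  have : T2Space S₀ := h₀.isSmoothEmbedding.isEmbedding.t2Space
  have hbox (z : Phase F) (hz : z ∈ boxSupport F (A / 3) ρ) :
      |z.1.1| < A ∧ transversal F z ∈ W.target :=
    ⟨by linarith [hz.1], hρW (mem_closedBall_zero_iff.2 (by linarith [hz.2]))⟩
  filter_upwards [Metric.closedBall_mem_nhds (0 : ℝ) hδ] with s hs R' Ψ hΨ hR' hform hid hsrc hW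
  rw [mem_closedBall_zero_iff, Real.norm_eq_abs] at hs
  have hg : ContDiff ℝ ∞ fun x => G (s, x) := hG.comp (contDiff_const.prodMk contDiff_id)
  have hgd : Differentiable ℝ fun x => G (s, x) := hg.differentiable (by simp)
  obtain ⟨-, f, hf, hfε, hfρ, hcf⟩ := hsymp s hs fun h z u v => by
    have hchain : HasFDerivAt (fun z => G (s, (h, z)))
        ((fderiv ℝ (fun x => G (s, x)) (h, z)).comp (ContinuousLinearMap.inr ℝ ℝ (F × F))) z :=
      HasFDerivAt.comp (g := fun x => G (s, x)) z (hgd (h, z)).hasFDerivAt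
        (hasFDerivAt_prodMk_right h z)
    rw [hchain.fderiv]
    -- Outside `W.target` the norm exceeds `ρ`, so `G` vanishes nearby and the map is the identity.
    by_cases hx : (h, z) ∈ W.target
    · exact hb.areaForm_eq hp hm hH hτ h₀.contMDiff h₁.contMDiff hR h₀.field_ne_zero hΨ hR'
        hform.bilin_eq hgd hW hsrc hx u v
    · have hx' : ρ < ‖((h, z) : ℝ × (F × F))‖ := by
        by_contra hcon
        exact hx (hρW (mem_closedBall_zero_iff.2 (by linarith)))
      have h0 : (fun x => G (s, x)) =ᶠ[𝓝 (h, z)] fun _ => 0 := by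
        filter_upwards [(isOpen_lt continuous_const continuous_norm).mem_nhds hx'] with x hx using
          hGρ s x hx
      rw [h0.fderiv_eq]
      simp
  have hbp : IsBoxPerturbation F (A / 3) ρ (min ρ (A / 3 / 4)) (fun z => D (s, z))
      (fun z => c (s, z)) f (fun x => G (s, x)) :=
    ⟨hD.comp (contDiff_const.prodMk contDiff_id), hc.comp (contDiff_const.prodMk contDiff_id),
      hcε s, hcid s, hham s, hf, hfε, hfρ, fun z hz1 hz2 => by
        rw [hcf z hz1 hz2]
        simp [liftPhase, transversal_apply]⟩
  refine ⟨h₀.congr hC (hHsC s) ?_, h₁.congr hC (hHsC s) ?_, ?_⟩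
  · rintro _ ⟨z, hz, rfl⟩
    exact hb.notMem_range_start hp hH hιinj hRinj (hbox z hz).1 (hbox z hz).2
  · rintro _ ⟨z, hz, rfl⟩
    exact hb.notMem_range hp (hbox z hz).1 (hbox z hz).2
  · obtain ⟨τ', hτ', h⟩ := hb.exists_time hbp ha hρ (min_le_left _ _) (min_le_right _ _)
      (by linarith) hρA hρW hp hH hιinj hRinj (Hs s).contMDiff (hHsB s) hC (hHsC s) hτ
      hΨ.continuous hid (fun y hy _ => ⟨hsrc y hy, by
        have := hW (W y) (W.map_source hy)
        rwa [W.left_inv hy] at this⟩)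
    refine ⟨τ', hτ', fun y => ?_⟩
    rw [← hR']
    exact h y

end SymplecticForm

/-! ### The theorem -/

namespace SymplecticForm

variable {m : ℕ} {Ω : Type*} [TopologicalSpace Ω]
  [ChartedSpace (EuclideanSpace ℝ (Fin m)) Ω] [IsManifold (𝓡 m) ∞ Ω] {σ : SymplecticForm m Ω}

theorem IsPoincareMap.exists_isPassage {H : Ω → ℝ} {S₀ : Type*} [TopologicalSpace S₀]
    [ChartedSpace (EuclideanSpace ℝ (Fin (m - 1))) S₀] {S₁ : Type*} [TopologicalSpace S₁]
    [ChartedSpace (EuclideanSpace ℝ (Fin (m - 1))) S₁] {ι₀ : S₀ → Ω} {ι₁ : S₁ → Ω} {R : S₀ → S₁}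
    (h : σ.IsPoincareMap H ι₀ ι₁ R) :
    ∃ τ : S₀ → ℝ, ∃ Γ, Continuous τ ∧ σ.IsPassage H ι₀ ι₁ R Γ τ ∧
      ∀ y, σ.IsFirstPassage H ι₁ (ι₀ y) (τ y) (Γ y) (R y) := by
  obtain ⟨τ, hτ, hΓ⟩ := h.exists_time
  choose Γ hΓ using hΓ
  exact ⟨τ, Γ, hτ, ⟨fun y => (hΓ y).pos, fun y => (hΓ y).integralCurve, fun y => (hΓ y).start,
    fun y => (hΓ y).finish, fun y => (hΓ y).first⟩, hΓ⟩

/-- The given point may be an end of the segment. An interior point of the orbit close to it still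
has `U` as a neighbourhood, and a flow box needs an interior time. -/
theorem IsOrbit.exists_mem_Ioo {H : Ω → ℝ} {γ : ℝ → Ω} {T t : ℝ} (hT : 0 < T)
    (hγ : σ.IsOrbit H γ (Icc 0 T)) (ht : t ∈ Icc 0 T) {U : Set Ω} (hU : U ∈ 𝓝 (γ t)) :
    ∃ t₁ ∈ Ioo 0 T, U ∈ 𝓝 (γ t₁) := by
  have h1 := (hγ.continuousOn t ht).preimage_mem_nhdsWithin (interior_mem_nhds.2 hU)
  obtain ⟨O, hO, htO, hOU⟩ := mem_nhdsWithin.1 h1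
  rw [← closure_Ioo hT.ne] at ht
  obtain ⟨t₁, ht₁O, ht₁⟩ := mem_closure_iff.1 ht O hO htO
  exact ⟨t₁, ht₁, mem_interior_iff_mem_nhds.1 (hOU ⟨ht₁O, Ioo_subset_Icc_self ht₁⟩)⟩

end SymplecticForm

theorem IsSmoothChart.transHomeomorph {d : ℕ} {S E E' : Type*} [TopologicalSpace S]
    [ChartedSpace (EuclideanSpace ℝ (Fin d)) S] [NormedAddCommGroup E] [NormedSpace ℝ E]
    [NormedAddCommGroup E'] [NormedSpace ℝ E'] {W : OpenPartialHomeomorph S E}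
    (hW : IsSmoothChart (𝓡 d) W) (L : E ≃L[ℝ] E') :
    IsSmoothChart (𝓡 d) (W.transHomeomorph L.toHomeomorph) where
  contMDiffOn := L.contDiff.contMDiff.comp_contMDiffOn hW.contMDiffOn
  contMDiffOn_symm := hW.contMDiffOn_symm.comp L.symm.contDiff.contMDiff.contMDiffOn fun _ h => h

theorem mainTheorem3 (n : ℕ) (hn : 2 ≤ n)
    {Ω : Type*} [TopologicalSpace Ω] [T2Space Ω] [SecondCountableTopology Ω]
    [ChartedSpace (EuclideanSpace ℝ (Fin (2 * n))) Ω] [IsManifold (𝓡 (2 * n)) ∞ Ω]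
    (σ : SymplecticForm (2 * n) Ω) (H : C^∞⟮𝓡 (2 * n), Ω; 𝓘(ℝ, ℝ), ℝ⟯)
    {S₀ : Type*} [TopologicalSpace S₀]
    [ChartedSpace (EuclideanSpace ℝ (Fin (2 * n - 1))) S₀] [IsManifold (𝓡 (2 * n - 1)) ∞ S₀]
    {S₁ : Type*} [TopologicalSpace S₁]
    [ChartedSpace (EuclideanSpace ℝ (Fin (2 * n - 1))) S₁] [IsManifold (𝓡 (2 * n - 1)) ∞ S₁]
    (ι₀ : S₀ → Ω) (ι₁ : S₁ → Ω)
    (R : S₀ ≃ₘ^∞⟮𝓡 (2 * n - 1), 𝓡 (2 * n - 1)⟯ S₁) (hR : σ.IsPoincareMap H ι₀ ι₁ R)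
    (y₀ : S₀) (T : ℝ) (γ : ℝ → Ω) (hγ : σ.IsFirstPassage H ι₁ (ι₀ y₀) T γ (R y₀))
    (x₀ : Ω) (hx₀ : x₀ ∈ γ '' Icc 0 T) :
    ∀ U ∈ 𝓝 x₀, ∃ V ∈ 𝓝 y₀,
      ∀ 𝓗 ∈ @nhds _ (smoothFunctionTopology (2 * n) Ω) H,
        ∃ 𝓦 ∈ @nhds _ (smoothMapTopology (2 * n - 1) (2 * n - 1) S₀ S₁)
            (R : C^∞⟮𝓡 (2 * n - 1), S₀; 𝓡 (2 * n - 1), S₁⟯),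
          ∀ R' : S₀ ≃ₘ^∞⟮𝓡 (2 * n - 1), 𝓡 (2 * n - 1)⟯ S₁,
            (R' : C^∞⟮𝓡 (2 * n - 1), S₀; 𝓡 (2 * n - 1), S₁⟯) ∈ 𝓦 →
            (∀ y : S₀, H (ι₁ (R' y)) = H (ι₀ y)) →
            σ.PreservesFormOnLevels H ι₀ ι₁ R' →
            (∀ y ∉ V, R' y = R y) →
            ∃ H' ∈ 𝓗, (∀ x ∉ U, H' x = H x) ∧ σ.IsPoincareMap H' ι₀ ι₁ R' := by
  intro U hU
  obtain ⟨k, rfl⟩ : ∃ k, n = k + 1 := ⟨n - 1, by omega⟩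
  have : Nontrivial (EuclideanSpace ℝ (Fin k)) := by
    have : Nonempty (Fin k) := ⟨⟨0, by omega⟩⟩
    infer_instance
  have hH := H.contMDiff
  have h₀ := hR.section₀
  have h₁ := hR.section₁
  obtain ⟨τ, Γ, hτ, hp, hΓ⟩ := hR.exists_isPassage
  obtain ⟨t, ht, rfl⟩ := hx₀
  obtain ⟨rfl, hγΓ⟩ := SymplecticForm.IsFirstPassage.eqOn hH hγ (hΓ y₀)
  rw [hγΓ ht] at hU
  obtain ⟨t₁, ht₁, hU₁⟩ := (hp.orbit y₀).exists_mem_Ioo (hp.pos y₀) ht hU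
  obtain ⟨B, W, θ, A, hA, hb, hBU⟩ := hp.exists_isFlowBox rfl (by omega) hH hτ h₀.contMDiff
    (fun y v hv => (h₀.isSmoothEmbedding.isImmersion.isImmersionAt y).eq_zero_of_tderiv hv)
    h₀.transverse ht₁ hU₁
  obtain ⟨ρ, hρ, hρA, hρW⟩ : ∃ ρ > 0, 4 * ρ < A ∧ Metric.closedBall 0 (4 * ρ) ⊆ W.target := by
    have h1 : W.target ∈ 𝓝 0 := W.open_target.mem_nhds (hb.apply_eq ▸ W.map_source hb.mem)
    obtain ⟨r, hr, hrW⟩ := Metric.nhds_basis_closedBall.mem_iff.1 h1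
    refine ⟨min r (A / 2) / 4, by positivity, ?_, ?_⟩
    · linarith [min_le_right r (A / 2)]
    · exact (Metric.closedBall_subset_closedBall (by linarith [min_le_left r (A / 2)])).trans hrW
  have hρW' : Metric.closedBall 0 ρ ⊆ W.target :=
    (Metric.closedBall_subset_closedBall (by linarith)).trans hρW
  have hVnhds : W.symm '' Metric.closedBall 0 ρ ∈ 𝓝 y₀ := by
    have h1 : W ⁻¹' Metric.closedBall 0 ρ ∈ 𝓝 y₀ := (W.continuousAt hb.mem).preimage_mem_nhds (by
      rw [hb.apply_eq]; exact Metric.closedBall_mem_nhds 0 hρ)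
    filter_upwards [h1, W.open_source.mem_nhds hb.mem] with y hy hys
    exact ⟨W y, hy, W.left_inv hys⟩
  refine ⟨_, hVnhds, fun 𝓗 h𝓗 => ?_⟩
  -- Here `V` is already fixed, independently of `𝓗`. If no `𝓦` works, every term of a sequence of
  -- neighbourhoods of `R`, chosen to shrink as fast as `exists_special_curve` demands, contains a
  -- counterexample.
  by_contra hcon
  push Not at hcon
  -- The smooth topology is defined by charts with values in this Euclidean space.
  let L : (ℝ × (EuclideanSpace ℝ (Fin k) × EuclideanSpace ℝ (Fin k))) ≃L[ℝ]
      EuclideanSpace ℝ (Fin (2 * (k + 1) - 1)) :=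
    ContinuousLinearEquiv.ofFinrankEq (by simp; omega)
  let φ := W.transHomeomorph L.toHomeomorph
  have hφ : IsSmoothChart (𝓡 (2 * (k + 1) - 1)) φ := hb.chart.transHomeomorph L
  have hφatlas : φ ∈ IsManifold.maximalAtlas (𝓡 (2 * (k + 1) - 1)) ∞ S₀ :=
    φ.mem_maximalAtlas_of_contMDiffOn hφ.contMDiffOn hφ.contMDiffOn_symm
  -- Transporting the chart of `S₀` by `R` makes `R` the identity in coordinates, so that closeness
  -- of `R'` to `R` becomes smallness of the displacement of `Ψ`.
  let ψ := R.symm.toHomeomorph.transOpenPartialHomeomorph φ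
  have hψatlas : ψ ∈ IsManifold.maximalAtlas (𝓡 (2 * (k + 1) - 1)) ∞ S₁ :=
    ψ.mem_maximalAtlas_of_contMDiffOn
      (hφ.contMDiffOn.comp R.symm.contMDiff.contMDiffOn fun _ h => h)
      (R.contMDiff.comp_contMDiffOn hφ.contMDiffOn_symm)
  set V := W.symm '' Metric.closedBall 0 ρ with hVdef
  have hVW : V ⊆ W.source := by
    rintro _ ⟨x, hx, rfl⟩
    exact W.map_target (hρW' hx)
  have hVc : IsCompact V :=
    (isCompact_closedBall _ _).image_of_continuousOn (W.continuousOn_symm.mono hρW')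
  obtain ⟨δ, hδ, hcurve⟩ := exists_special_curve
  let 𝓦 (j : ℕ) : Set C^∞⟮𝓡 (2 * (k + 1) - 1), S₀; 𝓡 (2 * (k + 1) - 1), S₁⟯ :=
    {g | MapsTo g V ψ.source ∧ ∀ i ≤ j, ∀ x ∈ V,
      ‖iteratedFDeriv ℝ i (ψ ∘ g ∘ φ.symm) (φ x) -
        iteratedFDeriv ℝ i (ψ ∘ R ∘ φ.symm) (φ x)‖ < δ j}
  have hmaps : MapsTo R V ψ.source := fun y hy => by
    change R.symm (R y) ∈ W.source
    rw [R.symm_apply_apply]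
    exact hVW hy
  have h𝓦 (j : ℕ) : 𝓦 j ∈ @nhds _ (smoothMapTopology (2 * (k + 1) - 1) (2 * (k + 1) - 1) S₀ S₁)
      (R : C^∞⟮𝓡 (2 * (k + 1) - 1), S₀; 𝓡 (2 * (k + 1) - 1), S₁⟯) := by
    refine @IsOpen.mem_nhds _ (smoothMapTopology (2 * (k + 1) - 1) (2 * (k + 1) - 1) S₀ S₁) _ _
      (TopologicalSpace.isOpen_generateFrom_of_mem ⟨R, φ, ψ, V, j, δ j, hφatlas, hψatlas, hVc, hVW,
        hmaps, hδ j, rfl⟩) ⟨hmaps, fun i _ x _ => ?_⟩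
    change ‖iteratedFDeriv ℝ i (ψ ∘ R ∘ φ.symm) (φ x) -
        iteratedFDeriv ℝ i (ψ ∘ R ∘ φ.symm) (φ x)‖ < δ j
    rw [sub_self, norm_zero]
    exact hδ j
  choose R' hR'𝓦 hR'E hR'form hR'V hR'not using fun j => hcon (𝓦 j) (h𝓦 j)
  let Ψ (j : ℕ) (y : S₀) : S₀ := R.symm (R' j y)
  have hRΨ (j y) : R (Ψ j y) = R' j y := R.apply_symm_apply _
  have hΨ (j) : ContMDiff (𝓡 (2 * (k + 1) - 1)) (𝓡 (2 * (k + 1) - 1)) ∞ (Ψ j) :=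
    R.symm.contMDiff.comp (R' j).contMDiff
  have hΨV (j) (y) (hy : y ∉ V) : Ψ j y = y := by
    simp only [Ψ, hR'V j y hy, R.symm_apply_apply]
  have hΨinj (j) : Function.Injective (Ψ j) := R.symm.injective.comp (R' j).injective
  have hΨsrc (j) (y) (hy : y ∈ W.source) : Ψ j y ∈ W.source := by
    -- If `Ψ y` is outside `V`, then `Ψ` fixes it, and injectivity gives `Ψ y = y`.
    by_cases h : Ψ j y ∈ V
    · exact hVW h
    · rwa [hΨinj j (hΨV j _ h)]
  have hΨE (j) (y) : H (ι₀ (Ψ j y)) = H (ι₀ y) := hp.energy_comp hH (hRΨ j) (hR'E j) y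
  have hKcl : IsClosed (L '' Metric.closedBall 0 ρ) :=
    ((isCompact_closedBall _ _).image L.continuous).isClosed
  have hKφ : L '' Metric.closedBall 0 ρ ⊆ φ.target := by
    rintro _ ⟨x, hx, rfl⟩
    change L.symm (L x) ∈ W.target
    rw [L.symm_apply_apply]
    exact hρW' hx
  have hKV : φ.symm '' (L '' Metric.closedBall 0 ρ) = V := by
    rw [image_image]
    refine image_congr fun x _ => ?_
    change W.symm (L.symm (L x)) = _
    rw [L.symm_apply_apply]
  choose g hg hgφ hgK hgbound using fun j => hφ.exists_displacement hKcl hKφ (hΨ j) (hΨsrc j)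
    (by rw [hKV]; exact hΨV j)
  have hRid (y) (hy : y ∈ V) (i : ℕ) : iteratedFDeriv ℝ i (ψ ∘ R ∘ φ.symm) (φ y) =
      iteratedFDeriv ℝ i (fun u => u) (φ y) := by
    refine (Filter.EventuallyEq.iteratedFDeriv ℝ ?_ i).eq_of_nhds
    filter_upwards [φ.open_target.mem_nhds (φ.map_source (hVW hy))] with u hu
    change φ (R.symm (R (φ.symm u))) = u
    rw [R.symm_apply_apply, φ.right_inv hu]
  -- One smooth family passes through all the counterexamples, the one with index `j` at parameter
  -- `(1 / 2) ^ j`, and through the identity at `0`.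
  obtain ⟨G, hG, hG0, hGg, hGz⟩ := hcurve g hg fun j i hi u =>
    hgbound j j (δ j) (hδ j).le (fun i hi y hy => by
      rw [hKV] at hy
      rw [← hRid y hy]
      exact ((hR'𝓦 j).2 i hi y hy).le) i hi u
  obtain ⟨Hs, hHs, hHsU, hreal⟩ := hb.exists_realization hA hρ hρA hρW hp rfl hτ h₀ h₁ R.contMDiff
    R.injective (G := fun q => (L.symm (G (q.1, L q.2))).2)
    (contDiff_snd.comp (L.symm.contDiff.comp (hG.comp
      (contDiff_fst.prodMk (L.contDiff.comp contDiff_snd)))))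
    (fun x => by simp only [hG0, map_zero, Prod.snd_zero])
    (fun s x hx => by
      have : G (s, L x) = 0 := hGz s _ fun j => hgK j _ (by
        rintro ⟨z, hz, hzx⟩
        rw [L.injective hzx, mem_closedBall_zero_iff] at hz
        linarith)
      simp only [this, map_zero, Prod.snd_zero])
  have hlim : Filter.Tendsto (fun j : ℕ => ((1 : ℝ) / 2) ^ j) Filter.atTop (𝓝 0) :=
    tendsto_pow_atTop_nhds_zero_of_lt_one (by norm_num) (by norm_num)
  -- For large `j` the perturbed Hamiltonian at parameter `(1 / 2) ^ j` lies in `𝓗` and has `R' j`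
  -- as its Poincaré map, against the choice of `R' j`.
  obtain ⟨j, hj1, hj2⟩ := ((hlim.eventually hreal).and ((hHs.comp hlim).eventually h𝓗)).exists
  refine hR'not j _ hj2 (fun x hx => hHsU _ x ?_)
    (hj1 (R' j) (Ψ j) (hΨ j) (hRΨ j) (hR'form j) (hΨV j) (hΨsrc j) fun x hx => ?_)
  · rintro ⟨z, hz, rfl⟩
    exact hx (hBU z hz)
  · have h1 := hgφ j (L x) (by change L.symm (L x) ∈ W.target; rwa [L.symm_apply_apply])
    change L (W (Ψ j (W.symm (L.symm (L x))))) = _ at h1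
    rw [L.symm_apply_apply] at h1
    have h2 : W (Ψ j (W.symm x)) = x + L.symm (g j (L x)) := by
      apply L.injective
      rw [h1, map_add, L.apply_symm_apply]
    have hys := W.map_target hx
    -- The first coordinate of `W` is the energy up to a constant, so the displacement has no such
    -- component; hence only the second component of `G` was passed to the realization.
    have h3 : (W (Ψ j (W.symm x))).1 = x.1 := by
      have e1 := hb.energy _ hys
      have e2 := hb.energy _ (hΨsrc j _ hys)
      rw [W.right_inv hx] at e1
      rw [hΨE] at e2
      linarith
    refine Prod.ext ?_ ?_
    · rw [h3, Prod.fst_add, add_zero]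
    · rw [h2, Prod.snd_add, Prod.snd_add]
      simp only [hGg]
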